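/- **Theorem (Local approximation error bound).** Let $d\in\{2,3\}$, let $\Omega\subset\mathbb R^d$ be a bounded open set, and let $A$ be a measurable, symmetric matrix field on $\Omega$ with $\alpha_{\min}|\xi|^2\le A(x)\xi\cdot\xi\le\alpha_{\max}|\xi|^2$ for a.e. $x\in\Omega$ and all $\xi\in\mathbb R^d$, where $0<\alpha_{\min}\le\alpha_{\max}<\infty$. For open $S\subset\Omega$ write $a_S(u,v)=\int_S A\nabla u\cdot\nabla v\,dx$, $\|u\|_{a,S}=a_S(u,u)^{1/2}$ and $H_a(S)=\{v\in H^1(S): a_S(v,\varphi)=0\ \ \forall\varphi\in H^1_0(S)\}$ (operator-harmonic functions). *Geometry.* Let $\omega\subset\omega^*\subset\Omega$, $R\subset\omega$, $R\subset R^*\subset\omega^*$ and $\emptyset\ne\tilde\omega\subset\omega$ be open sets with $\tilde\omega\cup R=\omega$ and $\partial\tilde\omega\cap\Omega\subset R$ ($R$ is the ring, $R^*$ the oversampling ring, $\tilde\omega$ the inner region). Assume that $R^*$ has the segment property (for example, that it is a Lipschitz domain). Let $\chi\in W^{1,\infty}(\Omega)$ with $0\le\chi\le1$, $\chi=0$ on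 $\Omega\setminus\omega$ and $\chi=1$ on $\tilde\omega$ (a partition of unity function of $\omega$), and let $\eta\in W^{1,\infty}(\omega^*)$ with $0\le\eta\le1$, $\eta=1$ on $\omega\setminus R$ and $\eta=0$ on $\omega^*\setminus\tilde\omega$. ($W^{1,\infty}$ functions are represented by their continuous representatives.) Put $\chi^R=\chi-\eta$, which vanishes on $\omega^*\setminus R$, and $$\mathcal M^R(v)=\Big(\int_\omega A\nabla\chi^R\cdot\nabla\chi^R\,dx\Big)^{-1}\int_\omega A\nabla(\chi^Rv)\cdot\nabla\chi^R\,dx .$$ *Two cases.* - *Interior subdomain:* $\partial\omega^*\cap\partial\Omega=\emptyset$ and $R^*$ is connected. Put $V=\{v\in H_a(R^*):\mathcal M^R(v)=0\}$ and $U=\{u\in H_a(\omega^*):\mathcal M^R(u)=0\}$. - *Boundary subdomain:* $\partial\omega^*\cap\partial\Omega\neq\emptyset$. Put $V=\{v\in H_a(R^*): v=0\text{ on }\partial R^*\cap\partial\Omega\}$ and $U=\{u\in H_a(\omega^*): u=0\text{ on }\partial\omega^*\cap\partial\Omega\}$, where, for open $D$, "$v=0$ on $\partial D\cap\partial\Omega$"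 means that $v$ is an $H^1(D)$-limit of functions in $H^1(D)$ vanishing near $\partial D\cap\partial\Omega$. Assume that the only $v\in H^1(R^*)$ with $v=0$ on $\partial R^*\cap\partial\Omega$ and $\nabla v=0$ a.e. is $v=0$. *Local spaces.* Let $n\ge0$ and let $(v_1,\lambda_1),\dots,(v_n,\lambda_n)\in V\times\mathbb R$ be the first $n$ eigenpairs (nondecreasing eigenvalues, counted with multiplicity, linearly independent eigenfunctions) of $$a_{R^*}(v,\varphi)=\lambda\,a_R(\chi^Rv,\chi^R\varphi)\qquad\forall\varphi\in V .$$ Let $v_k^{\rm ext}$ be the operator-harmonic extension of $v_k$: $v_k^{\rm ext}=v_k$ on $R^*\setminus\tilde\omega$, and on $\tilde\omega$ it is the function of $H_a(\tilde\omega)$ with the boundary values of $v_k$ on $\partial\tilde\omega$ (and $0$ on $\partial\tilde\omega\cap\partial\Omega$), i.e. $v_k^{\rm ext}-(1-\eta)v_k\in H^1_0(\tilde\omega)$. Set $Q(n)=\operatorname{span}\{\chi v_1^{\rm ext},\dots,\chi v_n^{\rm ext}\}$. Let $$d_n(R,R^*)=\inf_{Q\subset H^1_0(R),\ \dim Q\le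 n}\ \sup_{0\neq u\in V}\ \inf_{q\in Q}\frac{\|\chi^Ru-q\|_{a,R}}{\|u\|_{a,R^*}}$$ be the Kolmogorov $n$-width of $P^R:V\to H^1_0(R)$, $u\mapsto\chi^Ru$. *Conclusion.* In both cases, for every $u\in U$, $$\inf_{q\in Q(n)}\|\chi u-q\|_{a,\omega}\le d_n(R,R^*)\,\|u\|_{a,R^*}.$$ -/

import Mathlib

open MeasureTheory Set Filter Topology
open scoped ENNReal

noncomputable section

namespace RingGFEM

/-- The Euclidean space `ℝ^d`. -/
abbrev Pt (d : ℕ) : Type := EuclideanSpace ℝ (Fin d)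

/-! ### Sobolev spaces on open sets

Functions on an open set `U` are represented by functions on `ℝ^d`; only their values almost
everywhere on `U` matter. -/

/-- `φ ∈ C_c^∞(U)`. -/
def IsTestFunction {d : ℕ} (U : Set (Pt d)) (φ : Pt d → ℝ) : Prop :=
  ContDiff ℝ (⊤ : ℕ∞) φ ∧ HasCompactSupport φ ∧ tsupport φ ⊆ U

/-- `G` is the weak (distributional) gradient of `u` on `U`; both are locally integrable. -/
def HasWeakGradient {d : ℕ} (U : Set (Pt d)) (u : Pt d → ℝ) (G : Pt d → Pt d) : Prop :=
  LocallyIntegrableOn u U ∧ LocallyIntegrableOn G U ∧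
    ∀ φ : Pt d → ℝ, IsTestFunction U φ → ∀ e : Pt d,
      ∫ x in U, u x * fderiv ℝ φ x e = - ∫ x in U, inner ℝ (G x) e * φ x

open Classical in
/-- The weak gradient of `u` on `U` (unique almost everywhere on `U` when it exists). -/
def weakGrad {d : ℕ} (U : Set (Pt d)) (u : Pt d → ℝ) : Pt d → Pt d :=
  if h : ∃ G, HasWeakGradient U u G then h.choose else 0

/-- `u ∈ H¹(U)`. -/
def MemH1 {d : ℕ} (U : Set (Pt d)) (u : Pt d → ℝ) : Prop :=
  MemLp u 2 (volume.restrict U) ∧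
    ∃ G, HasWeakGradient U u G ∧ MemLp G 2 (volume.restrict U)

/-- The (extended) distance in `H¹(U)`. -/
def h1Dist {d : ℕ} (U : Set (Pt d)) (u v : Pt d → ℝ) : ℝ≥0∞ :=
  eLpNorm (u - v) 2 (volume.restrict U) + eLpNorm (weakGrad U (u - v)) 2 (volume.restrict U)

/-- `u ∈ H¹₀(U)`, the closure of `C_c^∞(U)` in `H¹(U)`. -/
def MemH10 {d : ℕ} (U : Set (Pt d)) (u : Pt d → ℝ) : Prop :=
  MemH1 U u ∧ ∀ ε : ℝ≥0∞, 0 < ε → ∃ φ, IsTestFunction U φ ∧ h1Dist U u φ < ε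

/-- `u ∈ H¹(U)` with `u = 0` on the boundary part `Γ`: the closure in `H¹(U)` of the functions
in `H¹(U)` that vanish in a neighbourhood of `Γ`. -/
def MemH1Vanishing {d : ℕ} (U Γ : Set (Pt d)) (u : Pt d → ℝ) : Prop :=
  MemH1 U u ∧ ∀ ε : ℝ≥0∞, 0 < ε → ∃ φ, MemH1 U φ ∧
    (∃ N : Set (Pt d), IsOpen N ∧ Γ ⊆ N ∧ ∀ᵐ x ∂(volume.restrict U), x ∈ N → φ x = 0) ∧
    h1Dist U u φ < ε

/-- `f ∈ W^{1,∞}(U)`, represented by its continuous representative. -/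
def MemW1Infty {d : ℕ} (U : Set (Pt d)) (f : Pt d → ℝ) : Prop :=
  ContinuousOn f U ∧ (∃ C : ℝ, ∀ x ∈ U, |f x| ≤ C) ∧
    ∃ G, HasWeakGradient U f G ∧ MemLp G ∞ (volume.restrict U)

/-- The segment property of an open set; every Lipschitz domain has it. -/
def SegmentProperty {d : ℕ} (U : Set (Pt d)) : Prop :=
  ∀ x ∈ frontier U, ∃ V ∈ 𝓝 x, ∃ e : Pt d, ∀ y ∈ closure U ∩ V, ∀ t : ℝ,
    0 < t → t < 1 → y + t • e ∈ U

/-! ### The bilinear form -/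

/-- `a_S(u, v) = ∫_S (A ∇u) · ∇v`. -/
def energy {d : ℕ} (A : Pt d → Matrix (Fin d) (Fin d) ℝ) (S : Set (Pt d))
    (u v : Pt d → ℝ) : ℝ :=
  ∫ x in S, inner ℝ (Matrix.toEuclideanLin (A x) (weakGrad S u x)) (weakGrad S v x)

/-- The energy (semi)norm `‖u‖_{a,S}`. -/
def energyNorm {d : ℕ} (A : Pt d → Matrix (Fin d) (Fin d) ℝ) (S : Set (Pt d))
    (u : Pt d → ℝ) : ℝ :=
  Real.sqrt (energy A S u u)

/-- The space `H_a(U)` of operator-harmonic functions. -/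
def harmonicSpace {d : ℕ} (A : Pt d → Matrix (Fin d) (Fin d) ℝ) (U : Set (Pt d)) :
    Set (Pt d → ℝ) :=
  {v | MemH1 U v ∧ ∀ φ, MemH10 U φ → energy A U v φ = 0}

/-! ### One subdomain with its rings -/

/-- The data attached to one subdomain: the computational domain `Ω`, the coefficient `A`, the
subdomain `om`, the oversampling domain `oms`, the ring `R`, the oversampling ring `Rs`, the inner
region `omt`, the partition of unity function `χ` of `om` and the cut-off function `η`. -/
structure RingSetup (d : ℕ) where
  Ω : Set (Pt d)
  A : Pt d → Matrix (Fin d) (Fin d) ℝ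
  om : Set (Pt d)
  oms : Set (Pt d)
  R : Set (Pt d)
  Rs : Set (Pt d)
  omt : Set (Pt d)
  χ : Pt d → ℝ
  η : Pt d → ℝ
  isOpen_Ω : IsOpen Ω
  isBounded_Ω : Bornology.IsBounded Ω
  isOpen_om : IsOpen om
  isOpen_oms : IsOpen oms
  isOpen_R : IsOpen R
  isOpen_Rs : IsOpen Rs
  isOpen_omt : IsOpen omt
  -- the coefficient is measurable, symmetric, uniformly bounded and uniformly elliptic
  measurable_A : ∀ i j, AEMeasurable (fun x => A x i j) (volume.restrict Ω)
  symm_A : ∀ᵐ x ∂(volume.restrict Ω), (A x).IsSymm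
  elliptic_A : ∃ αmin αmax : ℝ, 0 < αmin ∧ ∀ᵐ x ∂(volume.restrict Ω), ∀ ξ : Pt d,
    αmin * ‖ξ‖ ^ 2 ≤ inner ℝ (Matrix.toEuclideanLin (A x) ξ) ξ ∧
    inner ℝ (Matrix.toEuclideanLin (A x) ξ) ξ ≤ αmax * ‖ξ‖ ^ 2
  -- the geometry
  om_subset : om ⊆ oms
  oms_subset : oms ⊆ Ω
  R_subset_om : R ⊆ om
  R_subset_Rs : R ⊆ Rs
  Rs_subset : Rs ⊆ oms
  omt_nonempty : omt.Nonempty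
  omt_union_R : omt ∪ R = om
  frontier_omt : frontier omt ∩ Ω ⊆ R
  segment_Rs : SegmentProperty Rs
  -- the partition of unity function
  χ_w1infty : MemW1Infty Ω χ
  χ_mem : ∀ x ∈ Ω, 0 ≤ χ x ∧ χ x ≤ 1
  χ_support : ∀ x ∈ Ω \ om, χ x = 0
  χ_eq_one : ∀ x ∈ omt, χ x = 1
  -- the cut-off function
  η_w1infty : MemW1Infty oms η
  η_mem : ∀ x ∈ oms, 0 ≤ η x ∧ η x ≤ 1
  η_eq_one : ∀ x ∈ om \ R, η x = 1
  η_eq_zero : ∀ x ∈ oms \ omt, η x = 0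

namespace RingSetup

variable {d : ℕ} (S : RingSetup d)

/-- The ring cut-off function `χ^R = χ - η`; it vanishes on `oms \ R`, so that `χ^R v` is
meaningful on `om` for functions `v` that are only given on `Rs`. -/
def χR : Pt d → ℝ := S.χ - S.η

/-- The functional `M^R`. -/
def MR (v : Pt d → ℝ) : ℝ :=
  (energy S.A S.om S.χR S.χR)⁻¹ * energy S.A S.om (S.χR * v) S.χR

/-- `H_{a,0}(Rs)`: operator-harmonic functions on the oversampling ring with `M^R v = 0`. -/
def interiorSpace : Set (Pt d → ℝ) :=
  {v | v ∈ harmonicSpace S.A S.Rs ∧ S.MR v = 0}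

/-- `H^b_a(U)`: operator-harmonic functions on `U` vanishing on `∂U ∩ ∂Ω`. -/
def boundarySpace (U : Set (Pt d)) : Set (Pt d → ℝ) :=
  {v | v ∈ harmonicSpace S.A U ∧ MemH1Vanishing U (frontier U ∩ frontier S.Ω) v}

/-- The Dirichlet condition on `∂Rs ∩ ∂Ω` excludes nonzero (locally) constant functions on `Rs`;
this holds if every component of `Rs` meets `∂Ω` in a boundary part of positive surface
measure. -/
def DirichletExcludesConstants : Prop :=
  ∀ v, MemH1Vanishing S.Rs (frontier S.Rs ∩ frontier S.Ω) v →
    weakGrad S.Rs v =ᵐ[volume.restrict S.Rs] 0 → v =ᵐ[volume.restrict S.Rs] 0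

/-- The Kolmogorov `n`-width of the operator `v ↦ χ^R v` from `V` (with the norm `‖·‖_{a,Rs}`) to
`H¹₀(R)` (with the norm `‖·‖_{a,R}`). In `ℝ≥0∞`, `0 / 0 = 0`, so `u = 0` does not contribute.
The subspaces have dimension at most `n`; as `H¹₀(R)` is infinite-dimensional, dimension exactly
`n` gives the same infimum. -/
def width (V : Set (Pt d → ℝ)) (n : ℕ) : ℝ≥0∞ :=
  ⨅ (Q : Submodule ℝ (Pt d → ℝ)) (_ : ∀ q ∈ Q, MemH10 S.R q)
    (_ : Module.Finite ℝ Q ∧ Module.finrank ℝ Q ≤ n),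
    ⨆ u ∈ V, (⨅ q ∈ Q, ENNReal.ofReal (energyNorm S.A S.R (S.χR * u - q))) /
      ENNReal.ofReal (energyNorm S.A S.Rs u)

/-- `(v, lam)` is an eigenpair of the ring eigenproblem in `V`. -/
def IsEigenpair (V : Set (Pt d → ℝ)) (v : Pt d → ℝ) (lam : ℝ) : Prop :=
  v ∈ V ∧ ¬ (v =ᵐ[volume.restrict S.Rs] 0) ∧
    ∀ φ ∈ V, energy S.A S.Rs v φ = lam * energy S.A S.R (S.χR * v) (S.χR * φ)

/-- `(v k, lam k)`, `k < n`, are the first `n` eigenpairs, in nondecreasing order and counted with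
multiplicity: they are linearly independent eigenpairs, and every eigenfunction that is not
already in their span has an eigenvalue at least as large as theirs. -/
def IsFirstEigenpairs (V : Set (Pt d → ℝ)) (n : ℕ) (v : Fin n → Pt d → ℝ) (lam : Fin n → ℝ) :
    Prop :=
  (∀ k, S.IsEigenpair V (v k) (lam k)) ∧
  (∀ c : Fin n → ℝ, (∑ k, c k • v k) =ᵐ[volume.restrict S.Rs] 0 → c = 0) ∧
  Monotone lam ∧
  ∀ w μ, S.IsEigenpair V w μ →
    (¬ ∃ c : Fin n → ℝ, w =ᵐ[volume.restrict S.Rs] ∑ k, c k • v k) → ∀ k, lam k ≤ μ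

/-- `w` is the operator-harmonic extension of `v` into `omt`: `w = v` on `Rs \ omt`, `w` is
operator-harmonic in `omt`, and `w = v` on `∂omt` in the sense of traces (and `w = 0` on
`∂omt ∩ ∂Ω` when `v` vanishes on `∂Ω`). Since `v` is not given on all of `omt`, the trace condition
reads `w - (1 - η) v ∈ H¹₀(omt)`: here `1 - η` equals `1` on `∂omt`, and it is `0` on `omt \ R`,
so that `(1 - η) v` is a function on all of `omt` with the boundary values of `v`. -/
def IsHarmonicExtension (v w : Pt d → ℝ) : Prop :=
  (∀ᵐ x ∂(volume.restrict (S.Rs \ S.omt)), w x = v x) ∧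
  w ∈ harmonicSpace S.A S.omt ∧ MemH10 S.omt (w - (1 - S.η) * v)

/-- `Q(n)`, the span of the functions `χ v_k^ext`. -/
def approxSpace {n : ℕ} (vext : Fin n → Pt d → ℝ) : Submodule ℝ (Pt d → ℝ) :=
  Submodule.span ℝ (Set.range fun k => S.χ * vext k)

/-- The best approximation error in the energy norm on `om` of `χ u` from `Q`. -/
def bestError (Q : Submodule ℝ (Pt d → ℝ)) (u : Pt d → ℝ) : ℝ≥0∞ :=
  ⨅ q ∈ Q, ENNReal.ofReal (energyNorm S.A S.om (S.χ * u - q))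

end RingSetup

end RingGFEM

end

noncomputable section

namespace RingGFEM

variable {d : ℕ}

/-! ### Square integrable fields -/

/-! Work on the ring with the forms `a(v,φ) = a_{R*}(v,φ)` and `b(v,φ) = a_R(χ^R v, χ^R φ)` on `V`.
Let `w = u - ∑ c_k v_k` be the error of the `a`-orthogonal projection of `u` onto the first `n`
eigenfunctions, and let `e = u - ∑ c_k v_k^ext` be the same combination of the extended functions.

Reduction to the ring (`energy_χ_mul_le`). The function `χ e` equals `χ^R w`, extended by zero from
`R`, plus `r = e - (1-η) w`, extended by zero from `omt`. Here `r ∈ H¹₀(omt)`, and `χ e = e` is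
operator-harmonic in `omt`, so `r` is energy-orthogonal to `χ e`. Removing `r` can therefore only
increase the energy (Dirichlet's principle), whence `‖χ e‖²_{a,om} ≤ b(w,w)`.

Spectral bound (`exists_spectral_gap`). Let `M` be the supremum of `b` over the `a`-unit ball of the
`a`-orthogonal complement of the eigenfunctions. Then `b(w,w) ≤ M a(w,w) ≤ M a(u,u)`. If `M > 0`,
the supremum is attained, its maximizer is an eigenvector with eigenvalue `1/M`, and by the choice
of the first eigenpairs all `λ_k ≤ 1/M`. Hence `b ≥ M a` on the `(n+1)`-dimensional span of the
maximizer and the `v_k`.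

Lower bound for the width (`le_width`). For each competitor `Q` of dimension at most `n`, this span
contains a nonzero element whose product with `χ^R` is energy-orthogonal to `Q`, so `√M ≤ d_n`.
Together these three facts give the theorem.

The maximizer exists because `b` is compact relative to `a`. Caccioppoli's inequality
(`exists_caccioppoli`) bounds `b(z,z)` by the `L²(R*)` norm of `z`; Rellich's theorem for the
segment property (`SegmentProperty.compactlyEmbedded`) makes `H¹(R*)` compact in `L²(R*)`; a
Poincaré inequality (`exists_poincare`) makes `V` complete in the energy norm. The Poincaré
inequality needs that `V` has no nonzero function with zero gradient: this is assumed for boundary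
subdomains, and follows from `M^R v = 0` and connectedness for interior ones, because `M^R`
reproduces constants. For an interior subdomain the Dirichlet condition is empty, so both cases are
instances of one argument for an `Admissible` space.

The Sobolev tools are developed with explicit pairs of a function and its gradient (`HG`, `H0`,
`HV`). The delicate one, `HV.h0_mul_cutoff`, puts products with `χ^R` and `η` into `H¹₀` although
these cut-offs need not have compact support. -/

theorem integrable_inner_of_memLp_two {E : Type*} [NormedAddCommGroup E] [InnerProductSpace ℝ E]
    {α : Type*} [MeasurableSpace α] {μ : Measure α} {F H : α → E}
    (hF : MemLp F 2 μ) (hH : MemLp H 2 μ) : Integrable (fun x => inner ℝ (F x) (H x)) μ := by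
  have := L2.integrable_inner (𝕜 := ℝ) hF.toLp hH.toLp
  refine this.congr ?_
  filter_upwards [hF.coeFn_toLp, hH.coeFn_toLp] with x h1 h2
  rw [h1, h2]

theorem abs_integral_inner_le {E : Type*} [NormedAddCommGroup E] [InnerProductSpace ℝ E]
    {α : Type*} [MeasurableSpace α] {μ : Measure α} {F H : α → E}
    (hF : MemLp F 2 μ) (hH : MemLp H 2 μ) :
    |∫ x, inner ℝ (F x) (H x) ∂μ| ≤ (eLpNorm F 2 μ).toReal * (eLpNorm H 2 μ).toReal := by
  have h := abs_real_inner_le_norm hF.toLp hH.toLp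
  rw [Lp.norm_toLp, Lp.norm_toLp, L2.inner_def] at h
  refine le_trans (le_of_eq ?_) h
  congr 1
  refine integral_congr_ae ?_
  filter_upwards [hF.coeFn_toLp, hH.coeFn_toLp] with x h1 h2
  rw [h1, h2]

theorem integrable_mul_of_memLp_two {α : Type*} [MeasurableSpace α] {μ : Measure α} {f h : α → ℝ}
    (hf : MemLp f 2 μ) (hh : MemLp h 2 μ) : Integrable (fun x => f x * h x) μ := by
  have := integrable_inner_of_memLp_two hh hf
  simpa using this

theorem abs_integral_mul_le {α : Type*} [MeasurableSpace α] {μ : Measure α} {f h : α → ℝ}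
    (hf : MemLp f 2 μ) (hh : MemLp h 2 μ) :
    |∫ x, f x * h x ∂μ| ≤ (eLpNorm f 2 μ).toReal * (eLpNorm h 2 μ).toReal := by
  have := abs_integral_inner_le hh hf
  simpa [mul_comm] using this

theorem sq_eLpNorm_two {E : Type*} [NormedAddCommGroup E] [InnerProductSpace ℝ E]
    {α : Type*} [MeasurableSpace α] {μ : Measure α} {F : α → E} (hF : MemLp F 2 μ) :
    (eLpNorm F 2 μ).toReal ^ 2 = ∫ x, ‖F x‖ ^ 2 ∂μ := by
  have h := real_inner_self_eq_norm_sq hF.toLp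
  rw [Lp.norm_toLp, L2.inner_def] at h
  rw [← h]
  refine integral_congr_ae ?_
  filter_upwards [hF.coeFn_toLp] with x h1
  rw [h1, real_inner_self_eq_norm_sq]

/-! ### Pairs of a function and its weak gradient -/

theorem IsTestFunction.memLp {U : Set (Pt d)} {φ : Pt d → ℝ} (h : IsTestFunction U φ)
    {p : ℝ≥0∞} {μ : Measure (Pt d)} [IsFiniteMeasureOnCompacts μ] : MemLp φ p μ :=
  h.1.continuous.memLp_of_hasCompactSupport h.2.1

theorem continuous_gradient_of_contDiff {φ : Pt d → ℝ} (h : ContDiff ℝ (⊤ : ℕ∞) φ) :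
    Continuous (gradient φ) :=
  (InnerProductSpace.toDual ℝ (Pt d)).symm.continuous.comp (h.continuous_fderiv (by simp))

theorem IsTestFunction.hasCompactSupport_gradient {U : Set (Pt d)} {φ : Pt d → ℝ}
    (h : IsTestFunction U φ) : HasCompactSupport (gradient φ) :=
  (h.2.1.fderiv (𝕜 := ℝ)).comp_left (g := (InnerProductSpace.toDual ℝ (Pt d)).symm) (map_zero _)

theorem IsTestFunction.memLp_gradient {U : Set (Pt d)} {φ : Pt d → ℝ} (h : IsTestFunction U φ)
    {p : ℝ≥0∞} {μ : Measure (Pt d)} [IsFiniteMeasureOnCompacts μ] : MemLp (gradient φ) p μ :=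
  (continuous_gradient_of_contDiff h.1).memLp_of_hasCompactSupport h.hasCompactSupport_gradient

theorem IsTestFunction.memLp_fderiv {U : Set (Pt d)} {φ : Pt d → ℝ} (h : IsTestFunction U φ)
    {p : ℝ≥0∞} {μ : Measure (Pt d)} [IsFiniteMeasureOnCompacts μ] (e : Pt d) :
    MemLp (fun x => fderiv ℝ φ x e) p μ := by
  have hc : Continuous (fun x => fderiv ℝ φ x e) :=
    (h.1.continuous_fderiv (by simp)).clm_apply continuous_const
  exact hc.memLp_of_hasCompactSupport
    ((h.2.1.fderiv (𝕜 := ℝ)).comp_left (g := fun L : Pt d →L[ℝ] ℝ => L e) (by simp))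

theorem IsTestFunction.mono {U V : Set (Pt d)} {φ : Pt d → ℝ} (h : IsTestFunction V φ)
    (hVU : V ⊆ U) : IsTestFunction U φ := ⟨h.1, h.2.1, h.2.2.trans hVU⟩

/-- `u` and `G` are square integrable on `U` and `G` is the weak gradient of `u`. -/
def HG (U : Set (Pt d)) (u : Pt d → ℝ) (G : Pt d → Pt d) : Prop :=
  MemLp u 2 (volume.restrict U) ∧ MemLp G 2 (volume.restrict U) ∧
    ∀ φ : Pt d → ℝ, IsTestFunction U φ → ∀ e : Pt d,
      ∫ x in U, u x * fderiv ℝ φ x e = - ∫ x in U, inner ℝ (G x) e * φ x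

theorem memLp_inner_const {p : ℝ≥0∞} {μ : Measure (Pt d)} {G : Pt d → Pt d}
    (hG : MemLp G p μ) (e : Pt d) : MemLp (fun x => inner ℝ (G x) e) p μ := by
  have h : MemLp (fun x => inner ℝ e (G x)) p μ := (innerSL ℝ e).comp_memLp' hG
  simpa only [real_inner_comm] using h

theorem locallyIntegrableOn_of_memLp {E : Type*} [NormedAddCommGroup E]
    {U : Set (Pt d)} {u : Pt d → E} {p : ℝ≥0∞} (hp : 1 ≤ p)
    (hu : MemLp u p (volume.restrict U)) : LocallyIntegrableOn u U :=
  locallyIntegrableOn_of_locallyIntegrable_restrict (hu.locallyIntegrable hp)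

theorem HG.hasWeakGradient {U : Set (Pt d)} {u : Pt d → ℝ} {G : Pt d → Pt d} (h : HG U u G) :
    HasWeakGradient U u G :=
  ⟨locallyIntegrableOn_of_memLp one_le_two h.1, locallyIntegrableOn_of_memLp one_le_two h.2.1,
    h.2.2⟩

theorem HG.memH1 {U : Set (Pt d)} {u : Pt d → ℝ} {G : Pt d → Pt d} (h : HG U u G) :
    MemH1 U u := ⟨h.1, G, h.hasWeakGradient, h.2.1⟩

theorem setIntegral_eq_integral_of_test {U : Set (Pt d)} {φ f : Pt d → ℝ}
    (hφ : tsupport φ ⊆ U) : ∫ x in U, f x * φ x = ∫ x, f x * φ x :=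
  setIntegral_eq_integral_of_forall_compl_eq_zero fun x hx => by
    rw [image_eq_zero_of_notMem_tsupport (fun h => hx (hφ h)), mul_zero]

/-- The fundamental lemma of the calculus of variations, applied to `G - G'`. Pairing with every
direction `e` turns the scalar definition into a vector-valued identity. -/
theorem HasWeakGradient.ae_eq {U : Set (Pt d)} (hU : IsOpen U) {u : Pt d → ℝ}
    {G G' : Pt d → Pt d} (h : HasWeakGradient U u G) (h' : HasWeakGradient U u G') :
    G =ᵐ[volume.restrict U] G' := by
  have key : ∀ᵐ x ∂(volume : Measure (Pt d)), x ∈ U → G x - G' x = 0 := by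
    refine hU.ae_eq_zero_of_integral_contDiff_smul_eq_zero (h.2.1.sub h'.2.1) ?_
    intro g hg hgc hgs
    have ht : IsTestFunction U g := ⟨hg, hgc, hgs⟩
    have hint : ∀ {H : Pt d → Pt d}, LocallyIntegrableOn H U → Integrable (fun x => g x • H x) := by
      intro H hH
      have h1 := hH.integrableOn_compact_subset hgs hgc
      refine (integrableOn_iff_integrable_of_support_subset (s := tsupport g) ?_).1 ?_
      · intro x hx
        by_contra hx'
        exact hx (by simp [image_eq_zero_of_notMem_tsupport hx'])
      · exact IntegrableOn.continuousOn_smul h1 hg.continuous.continuousOn hgc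
    have hH : ∀ {H : Pt d → Pt d}, LocallyIntegrableOn H U → ∀ e : Pt d,
        ∫ x in U, inner ℝ (H x) e * g x = inner ℝ (∫ x, g x • H x) e := by
      intro H hH e
      rw [setIntegral_eq_integral_of_test hgs, real_inner_comm, ← integral_inner (hint hH)]
      refine integral_congr_ae (Eventually.of_forall fun x => ?_)
      simp only [inner_smul_right]
      rw [mul_comm, real_inner_comm]
    have hsub : ∫ x, g x • (G x - G' x) = (∫ x, g x • G x) - ∫ x, g x • G' x := by
      rw [← integral_sub (hint h.2.1) (hint h'.2.1)]
      simp only [smul_sub]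
    change ∫ x, g x • (G x - G' x) = 0
    rw [hsub, sub_eq_zero]
    refine ext_inner_right ℝ fun e => ?_
    rw [← hH h.2.1, ← hH h'.2.1]
    have h1 := h.2.2 g ht e
    have h2 := h'.2.2 g ht e
    linarith
  rw [Filter.EventuallyEq, ae_restrict_iff' hU.measurableSet]
  filter_upwards [key] with x hx hxU
  exact sub_eq_zero.1 (hx hxU)

theorem weakGrad_spec {U : Set (Pt d)} {u : Pt d → ℝ} {G : Pt d → Pt d}
    (h : HasWeakGradient U u G) : HasWeakGradient U u (weakGrad U u) := by
  have h' : ∃ G, HasWeakGradient U u G := ⟨G, h⟩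
  rw [weakGrad, dif_pos h']
  exact h'.choose_spec

/-- The bridge between `weakGrad`, which is obtained by choice, and gradients given by explicit
formulas. It allows all computations to be done with pairs `(u, G)`. -/
theorem HG.weakGrad_ae {U : Set (Pt d)} (hU : IsOpen U) {u : Pt d → ℝ} {G : Pt d → Pt d}
    (h : HG U u G) : weakGrad U u =ᵐ[volume.restrict U] G :=
  (weakGrad_spec h.hasWeakGradient).ae_eq hU h.hasWeakGradient

theorem HG.unique {U : Set (Pt d)} (hU : IsOpen U) {u : Pt d → ℝ} {G G' : Pt d → Pt d}
    (h : HG U u G) (h' : HG U u G') : G =ᵐ[volume.restrict U] G' :=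
  h.hasWeakGradient.ae_eq hU h'.hasWeakGradient

theorem HG.congr {U : Set (Pt d)} {u v : Pt d → ℝ} {G H : Pt d → Pt d}
    (h : HG U u G) (huv : u =ᵐ[volume.restrict U] v) (hGH : G =ᵐ[volume.restrict U] H) :
    HG U v H := by
  refine ⟨(memLp_congr_ae huv).1 h.1, (memLp_congr_ae hGH).1 h.2.1, fun φ hφ e => ?_⟩
  have h1 : ∫ x in U, v x * fderiv ℝ φ x e = ∫ x in U, u x * fderiv ℝ φ x e :=
    integral_congr_ae (by filter_upwards [huv] with x hx; rw [hx])
  have h2 : ∫ x in U, inner ℝ (H x) e * φ x = ∫ x in U, inner ℝ (G x) e * φ x :=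
    integral_congr_ae (by filter_upwards [hGH] with x hx; rw [hx])
  rw [h1, h2, h.2.2 φ hφ e]

theorem MemH1.hg {U : Set (Pt d)} (hU : IsOpen U) {u : Pt d → ℝ} (h : MemH1 U u) :
    HG U u (weakGrad U u) := by
  obtain ⟨h1, G, h2, h3⟩ := h
  have h4 : HG U u G := ⟨h1, h3, h2.2.2⟩
  exact h4.congr EventuallyEq.rfl (h4.weakGrad_ae hU).symm

theorem HG.zero (U : Set (Pt d)) : HG U 0 0 :=
  ⟨MemLp.zero, MemLp.zero, fun φ _ e => by simp⟩

theorem HG.smul {U : Set (Pt d)} {u : Pt d → ℝ} {G : Pt d → Pt d} (h : HG U u G) (c : ℝ) :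
    HG U (c • u) (c • G) := by
  refine ⟨h.1.const_smul c, h.2.1.const_smul c, fun φ hφ e => ?_⟩
  simp only [Pi.smul_apply, smul_eq_mul, inner_smul_left, mul_assoc, integral_const_mul,
    h.2.2 φ hφ e, RCLike.conj_to_real, mul_neg]

theorem HG.add {U : Set (Pt d)} {u v : Pt d → ℝ} {G H : Pt d → Pt d} (h : HG U u G)
    (h' : HG U v H) : HG U (u + v) (G + H) := by
  refine ⟨h.1.add h'.1, h.2.1.add h'.2.1, fun φ hφ e => ?_⟩
  simp only [Pi.add_apply, inner_add_left, add_mul]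
  rw [integral_add (integrable_mul_of_memLp_two h.1 (hφ.memLp_fderiv e))
    (integrable_mul_of_memLp_two h'.1 (hφ.memLp_fderiv e)),
    integral_add (integrable_mul_of_memLp_two (memLp_inner_const h.2.1 e) hφ.memLp)
      (integrable_mul_of_memLp_two (memLp_inner_const h'.2.1 e) hφ.memLp),
    h.2.2 φ hφ e, h'.2.2 φ hφ e]
  ring

theorem HG.sub {U : Set (Pt d)} {u v : Pt d → ℝ} {G H : Pt d → Pt d} (h : HG U u G)
    (h' : HG U v H) : HG U (u - v) (G - H) := by
  have := h.add (h'.smul (-1))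
  simpa [sub_eq_add_neg] using this

theorem memLp_restrict_mono {E : Type*} [NormedAddCommGroup E] {U V : Set (Pt d)} (hVU : V ⊆ U)
    {f : Pt d → E} {p : ℝ≥0∞} (h : MemLp f p (volume.restrict U)) :
    MemLp f p (volume.restrict V) := h.mono_measure (Measure.restrict_mono_set _ hVU)

theorem HG.mono {U V : Set (Pt d)} (hVU : V ⊆ U)
    {u : Pt d → ℝ} {G : Pt d → Pt d} (h : HG U u G) : HG V u G := by
  refine ⟨memLp_restrict_mono hVU h.1, memLp_restrict_mono hVU h.2.1, fun φ hφ e => ?_⟩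
  have := h.2.2 φ (hφ.mono hVU) e
  have hz : ∀ x, x ∉ V → fderiv ℝ φ x e = 0 := fun x hx => by
    rw [fderiv_of_notMem_tsupport (𝕜 := ℝ) (fun h => hx (hφ.2.2 h))]; rfl
  rw [setIntegral_eq_integral_of_test (hφ.2.2.trans hVU)] at this
  rw [setIntegral_eq_integral_of_test hφ.2.2, ← this,
    setIntegral_eq_integral_of_forall_compl_eq_zero (fun x hx => by simp [hz x hx]),
    setIntegral_eq_integral_of_forall_compl_eq_zero (fun x hx => by simp [hz x fun h => hx (hVU h)])]

theorem MemH1.mono {U V : Set (Pt d)} (hU : IsOpen U) (hVU : V ⊆ U) {u : Pt d → ℝ}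
    (h : MemH1 U u) : MemH1 V u := ((h.hg hU).mono hVU).memH1

theorem IsTestFunction.hg_univ {V : Set (Pt d)} {φ : Pt d → ℝ} (h : IsTestFunction V φ) :
    HG univ φ (gradient φ) := by
  refine ⟨h.memLp, h.memLp_gradient, fun ψ hψ e => ?_⟩
  simp only [inner_gradient_left, Measure.restrict_univ]
  refine integral_mul_fderiv_eq_neg_fderiv_mul_of_integrable
    (integrable_mul_of_memLp_two (h.memLp_fderiv e) hψ.memLp)
    (integrable_mul_of_memLp_two h.memLp (hψ.memLp_fderiv e))
    (integrable_mul_of_memLp_two h.memLp hψ.memLp)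
    (fun x _ => (h.1.differentiable (by simp)).differentiableAt)
    (fun x _ => (hψ.1.differentiable (by simp)).differentiableAt)

theorem IsTestFunction.hg {V : Set (Pt d)} {φ : Pt d → ℝ} (h : IsTestFunction V φ)
    (U : Set (Pt d)) : HG U φ (gradient φ) := h.hg_univ.mono (subset_univ U)

/-- The distance of two pairs in `L²(U)`. -/
def pairDist (U : Set (Pt d)) (u : Pt d → ℝ) (G : Pt d → Pt d) (v : Pt d → ℝ)
    (H : Pt d → Pt d) : ℝ≥0∞ :=
  eLpNorm (u - v) 2 (volume.restrict U) + eLpNorm (G - H) 2 (volume.restrict U)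

theorem pairDist_comm (U : Set (Pt d)) (u v : Pt d → ℝ) (G H : Pt d → Pt d) :
    pairDist U u G v H = pairDist U v H u G := by
  rw [pairDist, pairDist, eLpNorm_sub_comm, eLpNorm_sub_comm G]

theorem pairDist_triangle {U : Set (Pt d)} {u v w : Pt d → ℝ} {G H K : Pt d → Pt d}
    (hu : HG U u G) (hv : HG U v H) (hw : HG U w K) :
    pairDist U u G w K ≤ pairDist U u G v H + pairDist U v H w K := by
  have h1 : u - w = (u - v) + (v - w) := by abel
  have h2 : G - K = (G - H) + (H - K) := by abel
  rw [pairDist, h1, h2, pairDist, pairDist, add_add_add_comm]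
  exact add_le_add
    (eLpNorm_add_le (hu.1.sub hv.1).1 (hv.1.sub hw.1).1 one_le_two)
    (eLpNorm_add_le (hu.2.1.sub hv.2.1).1 (hv.2.1.sub hw.2.1).1 one_le_two)

theorem HG.h1Dist_eq {U : Set (Pt d)} (hU : IsOpen U) {u v : Pt d → ℝ} {G H : Pt d → Pt d}
    (hu : HG U u G) (hv : HG U v H) : h1Dist U u v = pairDist U u G v H := by
  rw [h1Dist, pairDist, eLpNorm_congr_ae ((hu.sub hv).weakGrad_ae hU)]

/-- The last step of the density arguments: an identity between continuous expressions that holds up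
to a multiple of every approximation error. -/
theorem eq_of_forall_abs_sub_le {a b C : ℝ} (h : ∀ ε > 0, |a - b| ≤ ε * C) : a = b := by
  -- The case `ε = 1` already forces `C ≥ 0`, so no sign hypothesis is needed.
  have hC : 0 ≤ C := by simpa using (abs_nonneg _).trans (h 1 one_pos)
  refine eq_of_abs_sub_nonpos (le_of_forall_pos_le_add fun ε hε => ?_)
  refine (h (ε / (C + 1)) (by positivity)).trans ?_
  rw [zero_add, div_mul_eq_mul_div, div_le_iff₀ (by positivity)]
  nlinarith

theorem toReal_le_of_pairDist_lt {U : Set (Pt d)} {u v : Pt d → ℝ} {G H : Pt d → Pt d}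
    {ε : ℝ} (hε : 0 ≤ ε) (h : pairDist U u G v H < ENNReal.ofReal ε) :
    (eLpNorm (u - v) 2 (volume.restrict U)).toReal ≤ ε ∧
      (eLpNorm (G - H) 2 (volume.restrict U)).toReal ≤ ε := by
  constructor
  · refine ENNReal.toReal_le_of_le_ofReal hε (le_trans ?_ h.le)
    exact le_self_add
  · refine ENNReal.toReal_le_of_le_ofReal hε (le_trans ?_ h.le)
    exact le_add_self

/-- Weak gradients are closed under `L²` limits. -/
theorem HG.of_approx {U : Set (Pt d)} {u : Pt d → ℝ} {G : Pt d → Pt d}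
    (hu : MemLp u 2 (volume.restrict U)) (hG : MemLp G 2 (volume.restrict U))
    (h : ∀ ε : ℝ≥0∞, 0 < ε → ∃ v H, HG U v H ∧ pairDist U u G v H < ε) : HG U u G := by
  refine ⟨hu, hG, fun φ hφ e => ?_⟩
  refine eq_of_forall_abs_sub_le
    (C := (eLpNorm (fun x => fderiv ℝ φ x e) 2 (volume.restrict U)).toReal +
      (eLpNorm (fun x => φ x • e) 2 (volume.restrict U)).toReal) fun ε hε => ?_
  obtain ⟨v, H, hv, hd⟩ := h (ENNReal.ofReal ε) (by simpa using hε)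
  obtain ⟨h1, h2⟩ := toReal_le_of_pairDist_lt hε.le hd
  have hφe : MemLp (fun x => φ x • e) 2 (volume.restrict U) := by
    have : MemLp φ 2 (volume.restrict U) := hφ.memLp
    exact (ContinuousLinearMap.toSpanSingleton ℝ e).comp_memLp' this
  have e1 : ∫ x in U, (u - v) x * fderiv ℝ φ x e =
      (∫ x in U, u x * fderiv ℝ φ x e) - ∫ x in U, v x * fderiv ℝ φ x e := by
    rw [← integral_sub (integrable_mul_of_memLp_two hu (hφ.memLp_fderiv e))
      (integrable_mul_of_memLp_two hv.1 (hφ.memLp_fderiv e))]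
    simp [sub_mul]
  have e2 : ∫ x in U, inner ℝ ((G - H) x) (φ x • e) =
      (∫ x in U, inner ℝ (G x) e * φ x) - ∫ x in U, inner ℝ (H x) e * φ x := by
    rw [← integral_sub (integrable_mul_of_memLp_two (memLp_inner_const hG e) hφ.memLp)
      (integrable_mul_of_memLp_two (memLp_inner_const hv.2.1 e) hφ.memLp)]
    simp [inner_smul_right, inner_sub_left, mul_comm, mul_sub]
  have b1 := abs_integral_mul_le (hu.sub hv.1) (hφ.memLp_fderiv (μ := volume.restrict U) e)
  have b2 := abs_integral_inner_le (hG.sub hv.2.1) hφe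
  rw [e1] at b1
  rw [e2] at b2
  have hw := hv.2.2 φ hφ e
  have : (∫ x in U, u x * fderiv ℝ φ x e) - -∫ x in U, inner ℝ (G x) e * φ x =
      ((∫ x in U, u x * fderiv ℝ φ x e) - ∫ x in U, v x * fderiv ℝ φ x e) +
      ((∫ x in U, inner ℝ (G x) e * φ x) - ∫ x in U, inner ℝ (H x) e * φ x) := by
    rw [hw]; ring
  rw [this, mul_add]
  refine (abs_add_le _ _).trans (add_le_add (b1.trans ?_) (b2.trans ?_))
  · exact mul_le_mul_of_nonneg_right h1 ENNReal.toReal_nonneg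
  · exact mul_le_mul_of_nonneg_right h2 ENNReal.toReal_nonneg

/-- The pair `(u, G)` is a limit of test functions on `U` and their gradients. -/
def H0 (U : Set (Pt d)) (u : Pt d → ℝ) (G : Pt d → Pt d) : Prop :=
  HG U u G ∧ ∀ ε : ℝ≥0∞, 0 < ε → ∃ φ, IsTestFunction U φ ∧ pairDist U u G φ (gradient φ) < ε

theorem H0.of_approx {U : Set (Pt d)} {u : Pt d → ℝ} {G : Pt d → Pt d}
    (hu : MemLp u 2 (volume.restrict U)) (hG : MemLp G 2 (volume.restrict U))
    (h : ∀ ε : ℝ≥0∞, 0 < ε → ∃ v H, H0 U v H ∧ pairDist U u G v H < ε) : H0 U u G := by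
  have h1 : HG U u G := HG.of_approx hu hG fun ε hε => by
    obtain ⟨v, H, hv, hd⟩ := h ε hε
    exact ⟨v, H, hv.1, hd⟩
  refine ⟨h1, fun ε hε => ?_⟩
  obtain ⟨v, H, hv, hd⟩ := h (ε / 2) (ENNReal.half_pos hε.ne')
  obtain ⟨φ, hφ, hd'⟩ := hv.2 (ε / 2) (ENNReal.half_pos hε.ne')
  refine ⟨φ, hφ, (pairDist_triangle h1 hv.1 (hφ.hg U)).trans_lt ?_⟩
  rw [← ENNReal.add_halves ε]
  exact ENNReal.add_lt_add hd hd'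

theorem H0.memH10 {U : Set (Pt d)} (hU : IsOpen U) {u : Pt d → ℝ} {G : Pt d → Pt d}
    (h : H0 U u G) : MemH10 U u := by
  refine ⟨h.1.memH1, fun ε hε => ?_⟩
  obtain ⟨φ, hφ, hd⟩ := h.2 ε hε
  exact ⟨φ, hφ, by rwa [h.1.h1Dist_eq hU (hφ.hg U)]⟩

theorem MemH10.h0 {U : Set (Pt d)} (hU : IsOpen U) {u : Pt d → ℝ} (h : MemH10 U u) :
    H0 U u (weakGrad U u) := by
  refine ⟨h.1.hg hU, fun ε hε => ?_⟩
  obtain ⟨φ, hφ, hd⟩ := h.2 ε hε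
  exact ⟨φ, hφ, by rwa [(h.1.hg hU).h1Dist_eq hU (hφ.hg U)] at hd⟩

theorem pairDist_congr {U : Set (Pt d)} {u u' v v' : Pt d → ℝ} {G G' H H' : Pt d → Pt d}
    (hu : u =ᵐ[volume.restrict U] u') (hG : G =ᵐ[volume.restrict U] G')
    (hv : v =ᵐ[volume.restrict U] v') (hH : H =ᵐ[volume.restrict U] H') :
    pairDist U u G v H = pairDist U u' G' v' H' := by
  rw [pairDist, pairDist, eLpNorm_congr_ae (hu.sub hv), eLpNorm_congr_ae (hG.sub hH)]

theorem H0.congr {U : Set (Pt d)} {u v : Pt d → ℝ} {G H : Pt d → Pt d}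
    (h : H0 U u G) (huv : u =ᵐ[volume.restrict U] v) (hGH : G =ᵐ[volume.restrict U] H) :
    H0 U v H := by
  refine ⟨h.1.congr huv hGH, fun ε hε => ?_⟩
  obtain ⟨φ, hφ, hd⟩ := h.2 ε hε
  exact ⟨φ, hφ, by rwa [pairDist_congr huv hGH EventuallyEq.rfl EventuallyEq.rfl] at hd⟩

theorem IsTestFunction.h0 {U : Set (Pt d)} {φ : Pt d → ℝ} (h : IsTestFunction U φ) :
    H0 U φ (gradient φ) :=
  ⟨h.hg U, fun ε hε => ⟨φ, h, by simpa [pairDist] using hε⟩⟩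

/-! ### Mollification -/

/-- Translation is continuous in `L²`. -/
theorem exists_eLpNorm_translate_sub_le {E : Type*} [NormedAddCommGroup E] {f : Pt d → E}
    (hf : MemLp f 2 volume) {ε : ℝ} (hε : 0 < ε) :
    ∃ δ > 0, ∀ h : Pt d, ‖h‖ ≤ δ →
      eLpNorm (fun x => f (x - h) - f x) 2 volume ≤ ENNReal.ofReal ε := by
  -- Translations depend continuously on the shift in the compact-open topology, which is the form
  -- of continuity needed for composition with measure preserving maps on `L²`.
  let g : Pt d → C(Pt d, Pt d) := fun h => ⟨fun x => x - h, by fun_prop⟩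
  have hg : Continuous g :=
    ContinuousMap.continuous_of_continuous_uncurry _ (by
      change Continuous fun p : Pt d × Pt d => p.2 - p.1
      fun_prop)
  have hm : ∀ h, MeasurePreserving (g h) volume volume := fun h =>
    measurePreserving_sub_right volume h
  have ht := Filter.Tendsto.compMeasurePreservingLp (p := 2) (l := 𝓝 (0 : Pt d))
    (f := fun _ => hf.toLp) (f₀ := hf.toLp)
    tendsto_const_nhds (hg.tendsto 0) hm (hm 0) (by simp)
  rw [Metric.tendsto_nhds_nhds] at ht
  obtain ⟨δ, hδ, h⟩ := ht ε hε
  refine ⟨δ / 2, by positivity, fun k hk => ?_⟩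
  have hk' : dist k 0 < δ := by rw [dist_zero_right]; linarith
  have h1 := (h hk').le
  rw [Lp.dist_def] at h1
  rw [← ENNReal.le_ofReal_iff_toReal_le ((Lp.memLp _).sub (Lp.memLp _)).eLpNorm_ne_top hε.le]
    at h1
  refine le_trans (le_of_eq (eLpNorm_congr_ae ?_)) h1
  have a1 := Lp.coeFn_compMeasurePreserving hf.toLp (hm k)
  have a2 := Lp.coeFn_compMeasurePreserving hf.toLp (hm 0)
  have a3 := (hm k).quasiMeasurePreserving.ae_eq_comp hf.coeFn_toLp
  filter_upwards [a1, a2, a3, hf.coeFn_toLp] with x h1 h2 h3 h4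
  simp only [Pi.sub_apply, h1, h2, h3]
  simp [g, h4]

/-- Hölder's inequality against the constant one, whose norm is one: Jensen's inequality for the
square. -/
theorem sq_lintegral_le_of_isProbabilityMeasure {α : Type*} [MeasurableSpace α] {ν : Measure α}
    [IsProbabilityMeasure ν] {g : α → ℝ≥0∞} (hg : AEMeasurable g ν) :
    (∫⁻ x, g x ∂ν) ^ 2 ≤ ∫⁻ x, g x ^ 2 ∂ν := by
  have h := ENNReal.lintegral_mul_le_Lp_mul_Lq ν Real.HolderConjugate.two_two hg
    (aemeasurable_const (b := (1 : ℝ≥0∞)))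
  simp only [Pi.mul_apply, mul_one, ENNReal.one_rpow, lintegral_const, measure_univ] at h
  calc (∫⁻ x, g x ∂ν) ^ 2 ≤ ((∫⁻ x, g x ^ (2 : ℝ) ∂ν) ^ (1 / 2 : ℝ)) ^ 2 := by gcongr
    _ = ∫⁻ x, g x ^ 2 ∂ν := by
      rw [← ENNReal.rpow_natCast, ← ENNReal.rpow_mul]
      norm_num

theorem eLpNorm_two_sq {E : Type*} [NormedAddCommGroup E] {α : Type*} [MeasurableSpace α]
    {μ : Measure α} (f : α → E) : eLpNorm f 2 μ ^ 2 = ∫⁻ x, ‖f x‖ₑ ^ 2 ∂μ := by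
  rw [eLpNorm_eq_lintegral_rpow_enorm_toReal (by simp) (by simp), ← ENNReal.rpow_natCast,
    ← ENNReal.rpow_mul]
  norm_num

-- Since the kernel is a probability density, the mollification error is an average of the
-- differences `f (x - t) - f x`. Jensen's inequality and Tonelli's theorem bound its `L²` norm by
-- the largest translation error within the support radius.
open Convolution in
theorem eLpNorm_normed_convolution_sub_le {E : Type*} [NormedAddCommGroup E] [NormedSpace ℝ E]
    [CompleteSpace E] {f : Pt d → E} (hf : StronglyMeasurable f) (hf2 : MemLp f 2 volume)
    (ρ : ContDiffBump (0 : Pt d)) {ε : ℝ≥0∞}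
    (h : ∀ k : Pt d, ‖k‖ ≤ ρ.rOut → eLpNorm (fun x => f (x - k) - f x) 2 volume ≤ ε) :
    eLpNorm ((ρ.normed volume ⋆[ContinuousLinearMap.lsmul ℝ ℝ, volume] f) - f) 2 volume ≤ ε := by
  set r := ρ.normed (volume : Measure (Pt d)) with hr
  have hrm : Measurable fun t => ENNReal.ofReal (r t) :=
    ρ.continuous_normed.measurable.ennreal_ofReal
  set ν := (volume : Measure (Pt d)).withDensity fun t => ENNReal.ofReal (r t) with hν
  have hprob : IsProbabilityMeasure ν := by
    refine ⟨?_⟩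
    rw [hν, withDensity_apply _ MeasurableSet.univ, Measure.restrict_univ,
      ← ofReal_integral_eq_lintegral_ofReal ρ.integrable_normed
        (Eventually.of_forall ρ.nonneg_normed), ρ.integral_normed, ENNReal.ofReal_one]
  have hmeas : Measurable fun p : Pt d × Pt d => ‖f (p.1 - p.2) - f p.1‖ₑ :=
    ((hf.comp_measurable (measurable_fst.sub measurable_snd)).sub
      (hf.comp_measurable measurable_fst)).enorm
  have hmx : ∀ x, Measurable fun t => ‖f (x - t) - f x‖ₑ := fun x =>
    hmeas.comp (measurable_const.prodMk measurable_id)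
  have hex : ∀ x, Integrable (fun t => r t • f (x - t)) volume := fun x =>
    (ρ.hasCompactSupport_normed.convolutionExists_left (ContinuousLinearMap.lsmul ℝ ℝ)
      ρ.continuous_normed (hf2.locallyIntegrable one_le_two) x)
  have hpt : ∀ x, ‖((r ⋆[ContinuousLinearMap.lsmul ℝ ℝ, volume] f) - f) x‖ₑ ^ 2 ≤
      ∫⁻ t, ‖f (x - t) - f x‖ₑ ^ 2 ∂ν := by
    intro x
    have e1 : ((r ⋆[ContinuousLinearMap.lsmul ℝ ℝ, volume] f) - f) x =
        ∫ t, r t • (f (x - t) - f x) := by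
      simp only [smul_sub]
      rw [integral_sub (hex x) (ρ.integrable_normed.smul_const _), ρ.integral_normed_smul]
      rfl
    have e2 : ‖∫ t, r t • (f (x - t) - f x)‖ₑ ≤ ∫⁻ t, ‖f (x - t) - f x‖ₑ ∂ν := by
      refine (enorm_integral_le_lintegral_enorm _).trans (le_of_eq ?_)
      rw [hν, lintegral_withDensity_eq_lintegral_mul _ hrm (hmx x)]
      refine lintegral_congr fun t => ?_
      simp only [enorm_smul, Pi.mul_apply]
      rw [Real.enorm_of_nonneg (ρ.nonneg_normed t)]
    rw [e1]
    calc _ ≤ (∫⁻ t, ‖f (x - t) - f x‖ₑ ∂ν) ^ 2 := by gcongr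
      _ ≤ _ := sq_lintegral_le_of_isProbabilityMeasure
        (hmx x).aemeasurable
  have hsq : eLpNorm ((r ⋆[ContinuousLinearMap.lsmul ℝ ℝ, volume] f) - f) 2 volume ^ 2 ≤
      ε ^ 2 := by
    rw [eLpNorm_two_sq]
    calc _ ≤ ∫⁻ x, ∫⁻ t, ‖f (x - t) - f x‖ₑ ^ 2 ∂ν := lintegral_mono hpt
      _ = ∫⁻ t, (∫⁻ x, ‖f (x - t) - f x‖ₑ ^ 2) ∂ν := 
        lintegral_lintegral_swap (hmeas.pow_const 2).aemeasurable
      _ ≤ ∫⁻ t, ε ^ 2 ∂ν := by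
        have hm2 : Measurable fun t => ∫⁻ x, ‖f (x - t) - f x‖ₑ ^ 2 :=
          (hmeas.pow_const 2).lintegral_prod_left'
        rw [hν, lintegral_withDensity_eq_lintegral_mul _ hrm hm2,
          lintegral_withDensity_eq_lintegral_mul _ hrm measurable_const]
        refine lintegral_mono fun t => ?_
        simp only [Pi.mul_apply]
        -- Shifts outside the support have weight zero, so the translation estimate is needed only
        -- for `‖t‖ < rOut`.
        by_cases ht : r t = 0
        · simp [ht]
        · have : t ∈ Function.support r := ht
          rw [hr, ρ.support_normed_eq, mem_ball_zero_iff] at this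
          have h1 := h t this.le
          rw [← eLpNorm_two_sq]
          gcongr
      _ = ε ^ 2 := by simp
  exact (ENNReal.pow_le_pow_left_iff two_ne_zero).1 hsq

-- The reflected kernel `y ↦ r (x - y)` is a test function; testing the weak gradient with it moves
-- the derivative from the kernel to `f`.
open Convolution in
theorem gradient_convolution {f : Pt d → ℝ} {G : Pt d → Pt d} (h : HG univ f G)
    (ρ : ContDiffBump (0 : Pt d)) :
    gradient (ρ.normed volume ⋆[ContinuousLinearMap.lsmul ℝ ℝ, volume] f) =
      (ρ.normed volume ⋆[ContinuousLinearMap.lsmul ℝ ℝ, volume] G) := by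
  have hf2 : MemLp f 2 volume := by simpa using h.1
  have hG2 : MemLp G 2 volume := by simpa using h.2.1
  have hfl := hf2.locallyIntegrable one_le_two
  have hGl := hG2.locallyIntegrable one_le_two
  set r := ρ.normed (volume : Measure (Pt d)) with hr
  have hrc : ContDiff ℝ (⊤ : ℕ∞) r := ρ.contDiff_normed
  have hrs : HasCompactSupport r := ρ.hasCompactSupport_normed
  funext x
  refine ext_inner_right ℝ fun e => ?_
  have h1 := hrs.hasFDerivAt_convolution_left (ContinuousLinearMap.lsmul ℝ ℝ)
    (hrc.of_le (by simp)) hfl x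
  have hex : Integrable (fun t => r t • G (x - t)) volume :=
    (hrs.convolutionExists_left (ContinuousLinearMap.lsmul ℝ ℝ)
      hrc.continuous hGl x)
  have hex' : Integrable (fun t => ((ContinuousLinearMap.lsmul ℝ ℝ).precompL (Pt d)
      (fderiv ℝ r t)) (f (x - t))) volume :=
    ((hrs.fderiv (𝕜 := ℝ)).convolutionExists_left _ (hrc.continuous_fderiv (by simp)) hfl x)
  rw [inner_gradient_left, h1.fderiv]
  have e1 : ((fderiv ℝ r ⋆[(ContinuousLinearMap.lsmul ℝ ℝ).precompL (Pt d), volume] f) x) e =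
      ∫ t, fderiv ℝ r t e * f (x - t) := by
    rw [convolution, ContinuousLinearMap.integral_apply hex']
    rfl
  have e2 : inner ℝ ((r ⋆[ContinuousLinearMap.lsmul ℝ ℝ, volume] G) x) e =
      ∫ t, inner ℝ (G (x - t)) e * r t := by
    change inner ℝ (∫ t, r t • G (x - t)) e = _
    rw [real_inner_comm, ← integral_inner hex]
    refine integral_congr_ae (Eventually.of_forall fun t => ?_)
    simp only [inner_smul_right]
    rw [mul_comm, real_inner_comm]
  rw [e1, e2]
  set φ : Pt d → ℝ := fun y => r (x - y) with hφ
  have hφc : ContDiff ℝ (⊤ : ℕ∞) φ := hrc.comp (contDiff_const.sub contDiff_id)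
  have hφt : IsTestFunction univ φ := by
    refine ⟨hφc, ?_, subset_univ _⟩
    exact hrs.comp_homeomorph (Homeomorph.subLeft x)
  have hder : ∀ y, fderiv ℝ φ y e = - fderiv ℝ r (x - y) e := by
    intro y
    have hd : HasFDerivAt φ ((fderiv ℝ r (x - y)).comp (-ContinuousLinearMap.id ℝ (Pt d))) y :=
      ((hrc.differentiable (by simp)).differentiableAt.hasFDerivAt).comp y
        ((hasFDerivAt_id y).const_sub x)
    rw [hd.fderiv]
    simp
  have hw := h.2.2 φ hφt e
  simp only [Measure.restrict_univ, hder] at hw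
  rw [← integral_sub_left_eq_self (fun t => fderiv ℝ r t e * f (x - t)) volume x,
    ← integral_sub_left_eq_self (fun t => inner ℝ (G (x - t)) e * r t) volume x]
  simp only [sub_sub_cancel]
  simp only [mul_neg, integral_neg, neg_inj] at hw
  rw [← hw]
  simp only [mul_comm]

/-- A smooth cut-off function between a compact set and an open neighbourhood. -/
theorem exists_isTestFunction_eq_one {U K : Set (Pt d)} (hU : IsOpen U) (hK : IsCompact K)
    (hKU : K ⊆ U) : ∃ ζ : Pt d → ℝ, IsTestFunction U ζ ∧ (∀ x, 0 ≤ ζ x ∧ ζ x ≤ 1) ∧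
      ∃ N, IsOpen N ∧ K ⊆ N ∧ ∀ x ∈ N, ζ x = 1 := by
  obtain ⟨δ, hδ, hδU⟩ := hK.exists_cthickening_subset_open hU hKU
  have hsub : Metric.cthickening (δ / 2) K ⊆ Metric.thickening δ K :=
    Metric.cthickening_subset_thickening' hδ (by linarith) K
  -- Interpolating between two thickenings of `K`, rather than between `K` and `U`, makes `ζ = 1` on
  -- a neighbourhood of `K`; its derivative then vanishes on `K`.
  obtain ⟨ζ, h1, h2, h3, h4⟩ := exists_contMDiff_support_eq_eq_one_iff (n := ⊤)
    (modelWithCornersSelf ℝ (Pt d)) (Metric.isOpen_thickening (δ := δ) (E := K))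
    (Metric.isClosed_cthickening (δ := δ / 2) (E := K)) hsub
  have hts : tsupport ζ ⊆ Metric.cthickening δ K := by
    rw [tsupport, h3]
    exact Metric.closure_thickening_subset_cthickening δ K
  refine ⟨ζ, ⟨h1.contDiff, ?_, hts.trans hδU⟩, fun x => h2 (mem_range_self x),
    Metric.thickening (δ / 2) K, Metric.isOpen_thickening,
    Metric.self_subset_thickening (by linarith) K,
    fun x hx => (h4 x).1 (Metric.thickening_subset_cthickening _ _ hx)⟩
  exact hK.cthickening.of_isClosed_subset (isClosed_tsupport ζ) hts

theorem contDiff_mul_fderiv {φ ζ : Pt d → ℝ} (hφ : ContDiff ℝ (⊤ : ℕ∞) φ)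
    (hζ : ContDiff ℝ (⊤ : ℕ∞) ζ) (x e : Pt d) :
    fderiv ℝ (fun y => ζ y * φ y) x e = ζ x * fderiv ℝ φ x e + fderiv ℝ ζ x e * φ x := by
  rw [fderiv_fun_mul (hζ.differentiable (by simp)).differentiableAt
    (hφ.differentiable (by simp)).differentiableAt]
  simp [mul_comm]

theorem IsTestFunction.mul_left {U : Set (Pt d)} {φ ζ : Pt d → ℝ} (hφ : IsTestFunction U φ)
    (hζ : ContDiff ℝ (⊤ : ℕ∞) ζ) : IsTestFunction U (fun y => ζ y * φ y) :=
  ⟨hζ.mul hφ.1, hφ.2.1.mul_left, (tsupport_mul_subset_right).trans hφ.2.2⟩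

theorem IsTestFunction.mul_right {U : Set (Pt d)} {φ ζ : Pt d → ℝ} (hφ : IsTestFunction U φ)
    (hζ : ContDiff ℝ (⊤ : ℕ∞) ζ) : IsTestFunction U (fun y => φ y * ζ y) :=
  ⟨hφ.1.mul hζ, hφ.2.1.mul_right, (tsupport_mul_subset_left).trans hφ.2.2⟩

theorem HG.ae_eq_zero_of_ae_eq_zero {U : Set (Pt d)} (hU : IsOpen U) {u : Pt d → ℝ}
    {G : Pt d → Pt d} (h : HG U u G) (hu : u =ᵐ[volume.restrict U] 0) :
    G =ᵐ[volume.restrict U] 0 :=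
  h.unique hU ((HG.zero U).congr hu.symm EventuallyEq.rfl)

theorem memLp_indicator_univ {E : Type*} [NormedAddCommGroup E] {U K : Set (Pt d)}
    (hK : MeasurableSet K) (hKU : K ⊆ U) {f : Pt d → E} {p : ℝ≥0∞}
    (h : MemLp f p (volume.restrict U)) : MemLp (K.indicator f) p volume :=
  (memLp_indicator_iff_restrict hK).2 (memLp_restrict_mono hKU h)

/-- Extension by zero of a function with compact support. -/
theorem HG.indicator_univ {U K : Set (Pt d)} (hU : IsOpen U) (hK : IsCompact K) (hKU : K ⊆ U)
    {u : Pt d → ℝ} {G : Pt d → Pt d} (h : HG U u G)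
    (h0 : ∀ᵐ x ∂(volume.restrict U), x ∉ K → u x = 0) :
    HG univ (K.indicator u) (K.indicator G) := by
  have hGz : ∀ᵐ x ∂(volume.restrict U), x ∉ K → G x = 0 := by
    have h1 : G =ᵐ[volume.restrict (U \ K)] 0 := by
      refine (h.mono sdiff_subset).ae_eq_zero_of_ae_eq_zero (hU.sdiff hK.isClosed) ?_
      rw [EventuallyEq, ae_restrict_iff' (hU.sdiff hK.isClosed).measurableSet]
      rw [ae_restrict_iff' hU.measurableSet] at h0
      filter_upwards [h0] with x hx hxU
      exact hx hxU.1 hxU.2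
    rw [EventuallyEq, ae_restrict_iff' (hU.sdiff hK.isClosed).measurableSet] at h1
    rw [ae_restrict_iff' hU.measurableSet]
    filter_upwards [h1] with x hx hxU hxK
    exact hx ⟨hxU, hxK⟩
  refine ⟨?_, ?_, fun φ hφ e => ?_⟩
  · simpa using memLp_indicator_univ hK.measurableSet hKU h.1
  · simpa using memLp_indicator_univ hK.measurableSet hKU h.2.1
  -- Multiplying by `ζ` turns a test function on the whole space into one on `U` without changing it
  -- or its derivative on `K`, where `u` and `G` live.
  obtain ⟨ζ, hζ, -, N, hN, hKN, hζ1⟩ := exists_isTestFunction_eq_one hU hK hKU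
  have hζd : ∀ x ∈ N, fderiv ℝ ζ x = 0 := fun x hx => by
    have : ζ =ᶠ[𝓝 x] fun _ => (1 : ℝ) := by
      filter_upwards [hN.mem_nhds hx] with y hy using hζ1 y hy
    rw [this.fderiv_eq]
    simp
  have hw := h.2.2 _ (hζ.mul_right hφ.1) e
  have e1 : ∫ x in univ, K.indicator u x * fderiv ℝ φ x e =
      ∫ x in U, u x * fderiv ℝ (fun y => ζ y * φ y) x e := by
    rw [Measure.restrict_univ]
    rw [← setIntegral_eq_integral_of_forall_compl_eq_zero (s := U)
      (fun x hx => by rw [indicator_of_notMem (fun h => hx (hKU h)), zero_mul])]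
    refine integral_congr_ae ?_
    filter_upwards [h0] with x hx
    by_cases hxK : x ∈ K
    · rw [contDiff_mul_fderiv hφ.1 hζ.1, hζ1 x (hKN hxK), hζd x (hKN hxK)]
      simp [hxK]
    · simp [hxK, hx hxK]
  have e2 : ∫ x in univ, inner ℝ (K.indicator G x) e * φ x =
      ∫ x in U, inner ℝ (G x) e * (ζ x * φ x) := by
    rw [Measure.restrict_univ]
    rw [← setIntegral_eq_integral_of_forall_compl_eq_zero (s := U)
      (fun x hx => by rw [indicator_of_notMem (fun h => hx (hKU h)), inner_zero_left, zero_mul])]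
    refine integral_congr_ae ?_
    filter_upwards [hGz] with x hx
    by_cases hxK : x ∈ K
    · simp [hxK, hζ1 x (hKN hxK)]
    · simp [hxK, hx hxK]
  rw [e1, e2, hw]

/-- An `H¹` function with compact support can be approximated by test functions. -/
theorem HG.h0_of_ae_eq_zero {U K : Set (Pt d)} (hU : IsOpen U) (hK : IsCompact K) (hKU : K ⊆ U)
    {u : Pt d → ℝ} {G : Pt d → Pt d} (h : HG U u G)
    (h0 : ∀ᵐ x ∂(volume.restrict U), x ∉ K → u x = 0) : H0 U u G := by
  refine ⟨h, fun ε hε => ?_⟩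
  have hu := h.indicator_univ hU hK hKU h0
  have hGz : ∀ᵐ x ∂(volume.restrict U), x ∉ K → G x = 0 := by
    have h1 := (hu.mono (subset_univ U)).unique hU
      (h.congr (v := K.indicator u) (H := G) ?_ EventuallyEq.rfl)
    · filter_upwards [h1] with x hx hxK
      rw [← hx, indicator_of_notMem hxK]
    · filter_upwards [h0] with x hx
      by_cases hxK : x ∈ K
      · simp [hxK]
      · simp [hxK, hx hxK]
  obtain ⟨ε', hε', hεε⟩ : ∃ ε' : ℝ, 0 < ε' ∧ ENNReal.ofReal ε' + ENNReal.ofReal ε' < ε := by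
    rcases eq_or_ne ε ⊤ with rfl | hεt
    · exact ⟨1, one_pos, by simp⟩
    · have hpos := ENNReal.toReal_pos hε.ne' hεt
      refine ⟨ε.toReal / 3, by positivity, ?_⟩
      rw [← ENNReal.ofReal_add (by positivity) (by positivity)]
      refine (ENNReal.ofReal_lt_iff_lt_toReal (by positivity) hεt).2 (by linarith)
  obtain ⟨f, hf, hfu⟩ : ∃ f : Pt d → ℝ, StronglyMeasurable f ∧ K.indicator u =ᵐ[volume] f := by
    have := hu.1.1
    rw [Measure.restrict_univ] at this
    exact ⟨this.mk _, this.stronglyMeasurable_mk, this.ae_eq_mk⟩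
  obtain ⟨g, hg, hgG⟩ : ∃ g : Pt d → Pt d, StronglyMeasurable g ∧ K.indicator G =ᵐ[volume] g := by
    have := hu.2.1.1
    rw [Measure.restrict_univ] at this
    exact ⟨this.mk _, this.stronglyMeasurable_mk, this.ae_eq_mk⟩
  -- A strongly measurable representative may be nonzero off `K` on a null set. It is cut off again
  -- so that the support of the convolution is controlled pointwise.
  set f' := K.indicator f with hf'
  have hf's : StronglyMeasurable f' := hf.indicator hK.measurableSet
  have hf'u : K.indicator u =ᵐ[volume] f' := by
    filter_upwards [hfu] with x hx
    by_cases hxK : x ∈ K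
    · simp only [hf', indicator_of_mem hxK] at hx ⊢; exact hx
    · simp [hf', hxK]
  have hfg : HG univ f' g := hu.congr (by simpa using hf'u) (by simpa using hgG)
  have hf2 : MemLp f' 2 volume := by simpa using hfg.1
  have hg2 : MemLp g 2 volume := by simpa using hfg.2.1
  obtain ⟨δ, hδ, hδU⟩ := hK.exists_cthickening_subset_open hU hKU
  obtain ⟨δ₁, hδ₁, h1⟩ := exists_eLpNorm_translate_sub_le hf2 hε'
  obtain ⟨δ₂, hδ₂, h2⟩ := exists_eLpNorm_translate_sub_le hg2 hε'
  -- The mollification radius keeps the support inside `U` (by `δ`) and makes the errors of the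
  -- function and of the gradient at most `ε'` (by `δ₁`, `δ₂`).
  set r := min δ (min δ₁ δ₂) with hr
  have hr0 : 0 < r := by positivity
  let ρ : ContDiffBump (0 : Pt d) := ⟨r / 2, r, by positivity, by linarith⟩
  have b1 := eLpNorm_normed_convolution_sub_le hf's hf2 ρ fun k hk =>
    h1 k (hk.trans ((min_le_right _ _).trans (min_le_left _ _)))
  have b2 := eLpNorm_normed_convolution_sub_le hg hg2 ρ fun k hk =>
    h2 k (hk.trans ((min_le_right _ _).trans (min_le_right _ _)))
  rw [← gradient_convolution hfg ρ] at b2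
  set φ := convolution (ρ.normed volume) f' (ContinuousLinearMap.lsmul ℝ ℝ) volume with hφ
  have hφs : tsupport φ ⊆ Metric.cthickening δ K := by
    refine closure_minimal ?_ Metric.isClosed_cthickening
    refine (support_convolution_subset_swap _).trans ?_
    rintro x ⟨a, ha, b, hb, rfl⟩
    have haK : a ∈ K := by
      by_contra h
      exact ha (by simp [hf', h])
    rw [ρ.support_normed_eq, mem_ball_zero_iff] at hb
    refine Metric.mem_cthickening_of_dist_le _ a _ _ haK ?_
    simp only [dist_eq_norm, add_sub_cancel_left]
    exact hb.le.trans (min_le_left _ _)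
  have ht : IsTestFunction U φ := by
    refine ⟨?_, ?_, hφs.trans hδU⟩
    · exact ρ.hasCompactSupport_normed.contDiff_convolution_left _ ρ.contDiff_normed
        (hf2.locallyIntegrable one_le_two)
    · exact hK.cthickening.of_isClosed_subset (isClosed_tsupport φ) hφs
  refine ⟨φ, ht, ?_⟩
  have c1 : u =ᵐ[volume.restrict U] f' := by
    filter_upwards [h0, ae_restrict_of_ae hf'u] with x hx hx'
    rw [← hx']
    by_cases hxK : x ∈ K
    · simp [hxK]
    · simp [hxK, hx hxK]
  have c2 : G =ᵐ[volume.restrict U] g := by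
    filter_upwards [hGz, ae_restrict_of_ae hgG] with x hx hx'
    rw [← hx']
    by_cases hxK : x ∈ K
    · simp [hxK]
    · simp [hxK, hx hxK]
  rw [pairDist_congr c1 c2 EventuallyEq.rfl EventuallyEq.rfl, pairDist_comm, pairDist]
  refine lt_of_le_of_lt (add_le_add ?_ ?_) hεε
  · exact (eLpNorm_mono_measure _ Measure.restrict_le_self).trans b1
  · exact (eLpNorm_mono_measure _ Measure.restrict_le_self).trans b2

/-! ### Product rule and chain rule -/

theorem memLp_mul_of_bound {α : Type*} [MeasurableSpace α] {μ : Measure α} {E : Type*}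
    [NormedAddCommGroup E] [NormedSpace ℝ E] {f : α → E} {ψ : α → ℝ} {p : ℝ≥0∞} {C : ℝ}
    (hf : MemLp f p μ)
    (hψ : AEStronglyMeasurable ψ μ) (hC : ∀ᵐ x ∂μ, |ψ x| ≤ C) :
    MemLp (fun x => ψ x • f x) p μ := by
  refine MemLp.of_le_mul (c := C) hf (hψ.smul hf.1) ?_
  filter_upwards [hC] with x hx
  rw [norm_smul, Real.norm_eq_abs]
  gcongr

theorem memLp_smul_of_bound_right {α : Type*} [MeasurableSpace α] {μ : Measure α} {E : Type*}
    [NormedAddCommGroup E] [NormedSpace ℝ E] {f : α → ℝ} {g : α → E} {p : ℝ≥0∞} {C : ℝ}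
    (hf : MemLp f p μ)
    (hg : AEStronglyMeasurable g μ) (hC : ∀ᵐ x ∂μ, ‖g x‖ ≤ C) :
    MemLp (fun x => f x • g x) p μ := by
  refine MemLp.of_le_mul (c := C) hf (hf.1.smul hg) ?_
  filter_upwards [hC] with x hx
  rw [norm_smul, mul_comm]
  gcongr

theorem IsTestFunction.exists_bound {U : Set (Pt d)} {φ : Pt d → ℝ} (h : IsTestFunction U φ) :
    ∃ C, ∀ x, |φ x| ≤ C := by
  obtain ⟨C, hC⟩ := h.2.1.exists_bound_of_continuous h.1.continuous
  exact ⟨C, hC⟩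

theorem IsTestFunction.exists_bound_gradient {U : Set (Pt d)} {φ : Pt d → ℝ}
    (h : IsTestFunction U φ) : ∃ C, ∀ x, ‖gradient φ x‖ ≤ C :=
  h.hasCompactSupport_gradient.exists_bound_of_continuous (continuous_gradient_of_contDiff h.1)

/-- Product of an `H¹` function with a test function. -/
theorem HG.mul_test {U : Set (Pt d)} {u ζ : Pt d → ℝ} {G : Pt d → Pt d} (h : HG U u G)
    (hζ : IsTestFunction U ζ) :
    HG U (fun x => ζ x * u x) (fun x => ζ x • G x + u x • gradient ζ x) := by
  obtain ⟨C, hC⟩ := hζ.exists_bound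
  obtain ⟨C', hC'⟩ := hζ.exists_bound_gradient
  have m1 : MemLp (fun x => ζ x * u x) 2 (volume.restrict U) :=
    memLp_mul_of_bound h.1 hζ.1.continuous.aestronglyMeasurable (ae_of_all _ hC)
  have m2 : MemLp (fun x => ζ x • G x) 2 (volume.restrict U) :=
    memLp_mul_of_bound h.2.1 hζ.1.continuous.aestronglyMeasurable (ae_of_all _ hC)
  have m3 : MemLp (fun x => u x • gradient ζ x) 2 (volume.restrict U) :=
    memLp_smul_of_bound_right h.1
      (continuous_gradient_of_contDiff hζ.1).aestronglyMeasurable (ae_of_all _ hC')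
  refine ⟨m1, m2.add m3, fun φ hφ e => ?_⟩
  have hw := h.2.2 _ (hφ.mul_left hζ.1) e
  simp only [contDiff_mul_fderiv hφ.1 hζ.1] at hw
  have i1 := integrable_mul_of_memLp_two m1 (hφ.memLp_fderiv (μ := volume.restrict U) e)
  have i2 := integrable_mul_of_memLp_two (memLp_inner_const m3 e)
    (hφ.memLp (p := 2) (μ := volume.restrict U))
  have i3 := integrable_mul_of_memLp_two (memLp_inner_const m2 e)
    (hφ.memLp (p := 2) (μ := volume.restrict U))
  have e1 : ∫ x in U, u x * (ζ x * fderiv ℝ φ x e + fderiv ℝ ζ x e * φ x) =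
      (∫ x in U, ζ x * u x * fderiv ℝ φ x e) +
        ∫ x in U, inner ℝ (u x • gradient ζ x) e * φ x := by
    rw [← integral_add i1 i2]
    refine integral_congr_ae (ae_of_all _ fun x => ?_)
    simp only [inner_smul_left, inner_gradient_left, RCLike.conj_to_real]
    ring
  have e2 : ∫ x in U, inner ℝ (ζ x • G x + u x • gradient ζ x) e * φ x =
      (∫ x in U, inner ℝ (G x) e * (ζ x * φ x)) +
        ∫ x in U, inner ℝ (u x • gradient ζ x) e * φ x := by
    simp only [inner_add_left, add_mul]
    rw [integral_add i3 i2]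
    congr 1
    refine integral_congr_ae (ae_of_all _ fun x => ?_)
    simp only [inner_smul_left, RCLike.conj_to_real]
    ring
  rw [e2]
  linarith

/-- Local approximation of an `H¹` function by test functions. -/
theorem HG.exists_test_approx {U K : Set (Pt d)} (hU : IsOpen U) (hK : IsCompact K) (hKU : K ⊆ U)
    {u : Pt d → ℝ} {G : Pt d → Pt d} (h : HG U u G) {ε : ℝ≥0∞} (hε : 0 < ε) :
    ∃ φ, IsTestFunction U φ ∧ pairDist K u G φ (gradient φ) < ε := by
  obtain ⟨ζ, hζ, -, N, hN, hKN, hζ1⟩ := exists_isTestFunction_eq_one hU hK hKU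
  have hm := h.mul_test hζ
  have h0 := hm.h0_of_ae_eq_zero hU hζ.2.1 hζ.2.2 (ae_of_all _ fun x hx => by
    rw [image_eq_zero_of_notMem_tsupport hx, zero_mul])
  obtain ⟨φ, hφ, hd⟩ := h0.2 ε hε
  refine ⟨φ, hφ, lt_of_le_of_lt ?_ hd⟩
  have hζd : ∀ x ∈ N, gradient ζ x = 0 := fun x hx => by
    have : ζ =ᶠ[𝓝 x] fun _ => (1 : ℝ) := by
      filter_upwards [hN.mem_nhds hx] with y hy using hζ1 y hy
    rw [this.gradient_eq]
    simp
  have c1 : u =ᵐ[volume.restrict K] fun x => ζ x * u x := by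
    filter_upwards [ae_restrict_mem hK.measurableSet] with x hx
    rw [hζ1 x (hKN hx), one_mul]
  have c2 : G =ᵐ[volume.restrict K] fun x => ζ x • G x + u x • gradient ζ x := by
    filter_upwards [ae_restrict_mem hK.measurableSet] with x hx
    simp [hζ1 x (hKN hx), hζd x (hKN hx)]
  rw [pairDist_congr c1 c2 EventuallyEq.rfl EventuallyEq.rfl]
  exact add_le_add (eLpNorm_mono_measure _ (Measure.restrict_mono_set _ hKU))
    (eLpNorm_mono_measure _ (Measure.restrict_mono_set _ hKU))

/-- A functional that is continuous on pairs and vanishes on approximations vanishes. -/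
theorem pairing_eq_zero_of_approx {K : Set (Pt d)} {u p : Pt d → ℝ} {G P : Pt d → Pt d}
    (hu : MemLp u 2 (volume.restrict K)) (hG : MemLp G 2 (volume.restrict K))
    (hp : MemLp p 2 (volume.restrict K)) (hP : MemLp P 2 (volume.restrict K))
    (h : ∀ ε : ℝ≥0∞, 0 < ε → ∃ v H, MemLp v 2 (volume.restrict K) ∧
      MemLp H 2 (volume.restrict K) ∧ pairDist K u G v H < ε ∧
      (∫ x in K, v x * p x) + ∫ x in K, inner ℝ (H x) (P x) = 0) :
    (∫ x in K, u x * p x) + ∫ x in K, inner ℝ (G x) (P x) = 0 := by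
  refine eq_of_forall_abs_sub_le
    (C := (eLpNorm p 2 (volume.restrict K)).toReal +
      (eLpNorm P 2 (volume.restrict K)).toReal) fun ε hε => ?_
  obtain ⟨v, H, hv, hH, hd, h0⟩ := h (ENNReal.ofReal ε) (by simpa using hε)
  obtain ⟨h1, h2⟩ := toReal_le_of_pairDist_lt hε.le hd
  have b1 := abs_integral_mul_le (hu.sub hv) hp
  have b2 := abs_integral_inner_le (hG.sub hH) hP
  have e1 : ∫ x in K, (u - v) x * p x = (∫ x in K, u x * p x) - ∫ x in K, v x * p x := by
    rw [← integral_sub (integrable_mul_of_memLp_two hu hp) (integrable_mul_of_memLp_two hv hp)]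
    simp [sub_mul]
  have e2 : ∫ x in K, inner ℝ ((G - H) x) (P x) =
      (∫ x in K, inner ℝ (G x) (P x)) - ∫ x in K, inner ℝ (H x) (P x) := by
    rw [← integral_sub (integrable_inner_of_memLp_two hG hP) (integrable_inner_of_memLp_two hH hP)]
    simp [inner_sub_left]
  have : (∫ x in K, u x * p x) + (∫ x in K, inner ℝ (G x) (P x)) - 0 =
      (∫ x in K, (u - v) x * p x) + ∫ x in K, inner ℝ ((G - H) x) (P x) := by
    rw [e1, e2, ← h0]; ring
  rw [this, mul_add]
  refine (abs_add_le _ _).trans (add_le_add (b1.trans ?_) (b2.trans ?_))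
  · exact mul_le_mul_of_nonneg_right h1 ENNReal.toReal_nonneg
  · exact mul_le_mul_of_nonneg_right h2 ENNReal.toReal_nonneg

/-- Product of an `H¹` function with a Lipschitz function. -/
theorem HG.mul_of_bound {U : Set (Pt d)} (hU : IsOpen U) {u ψ : Pt d → ℝ} {G g : Pt d → Pt d}
    (h : HG U u G) (hψ : HG U ψ g) {C : ℝ} (hC : ∀ᵐ x ∂(volume.restrict U), |ψ x| ≤ C)
    (hC' : ∀ᵐ x ∂(volume.restrict U), ‖g x‖ ≤ C) :
    HG U (fun x => ψ x * u x) (fun x => ψ x • G x + u x • g x) := by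
  have m1 : MemLp (fun x => ψ x * u x) 2 (volume.restrict U) :=
    memLp_mul_of_bound h.1 hψ.1.1 hC
  have m2 : MemLp (fun x => ψ x • G x) 2 (volume.restrict U) :=
    memLp_mul_of_bound h.2.1 hψ.1.1 hC
  have m3 : MemLp (fun x => u x • g x) 2 (volume.restrict U) :=
    memLp_smul_of_bound_right h.1 hψ.2.1.1 hC'
  refine ⟨m1, m2.add m3, fun φ hφ e => ?_⟩
  set K := tsupport φ with hKdef
  have hK : IsCompact K := hφ.2.1
  have hKU : K ⊆ U := hφ.2.2
  obtain ⟨Cφ, hCφ⟩ := hφ.exists_bound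
  obtain ⟨Cg, hCg⟩ := hφ.exists_bound_gradient
  -- The product rule tested with `φ` says that the pairing of `(u, G)` with `(p, P)` vanishes. This
  -- pairing is continuous in `L²` on the support of `φ`, so it suffices to verify it for test
  -- functions `v` close to `u` there.
  set p : Pt d → ℝ := fun x => ψ x * fderiv ℝ φ x e + inner ℝ (g x) e * φ x with hp
  set P : Pt d → Pt d := fun x => (φ x * ψ x) • e with hP
  have hpm : MemLp p 2 (volume.restrict U) := by
    refine MemLp.add ?_ ?_
    · have := memLp_mul_of_bound (C := Cg * ‖e‖) hψ.1
        (hφ.memLp_fderiv (p := 2) (μ := volume.restrict U) e).1 (ae_of_all _ fun x => by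
          rw [← inner_gradient_left]
          exact (abs_real_inner_le_norm _ _).trans (by gcongr; exact hCg x))
      simpa only [smul_eq_mul, mul_comm] using this
    · have := memLp_mul_of_bound (C := Cφ) (memLp_inner_const hψ.2.1 e)
        hφ.1.continuous.aestronglyMeasurable (ae_of_all _ hCφ)
      simpa only [smul_eq_mul, mul_comm] using this
  have hPm : MemLp P 2 (volume.restrict U) := by
    have : MemLp (fun x => φ x * ψ x) 2 (volume.restrict U) :=
      memLp_mul_of_bound hψ.1 hφ.1.continuous.aestronglyMeasurable (ae_of_all _ hCφ)
    exact (ContinuousLinearMap.toSpanSingleton ℝ e).comp_memLp' this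
  have hz : ∀ x, x ∉ K → φ x = 0 ∧ fderiv ℝ φ x = 0 := fun x hx =>
    ⟨image_eq_zero_of_notMem_tsupport hx, fderiv_of_notMem_tsupport (𝕜 := ℝ) hx⟩
  have hUK : ∀ {f : Pt d → ℝ}, (∀ x, x ∉ K → f x = 0) → ∫ x in U, f x = ∫ x in K, f x := by
    intro f hf
    rw [setIntegral_eq_integral_of_forall_compl_eq_zero (fun x hx => hf x fun h => hx (hKU h)),
      setIntegral_eq_integral_of_forall_compl_eq_zero hf]
  have key : (∫ x in K, u x * p x) + ∫ x in K, inner ℝ (G x) (P x) = 0 := by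
    refine pairing_eq_zero_of_approx (memLp_restrict_mono hKU h.1) (memLp_restrict_mono hKU h.2.1)
      (memLp_restrict_mono hKU hpm) (memLp_restrict_mono hKU hPm) fun ε hε => ?_
    obtain ⟨v, hv, hd⟩ := h.exists_test_approx hU hK hKU hε
    refine ⟨v, gradient v, hv.memLp, hv.memLp_gradient, hd, ?_⟩
    rw [← hUK (fun x hx => by simp [hp, hz x hx]), ← hUK (fun x hx => by simp [hP, hz x hx]),
      ← integral_add (integrable_mul_of_memLp_two hv.memLp hpm)
        (integrable_inner_of_memLp_two hv.memLp_gradient hPm)]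
    -- For smooth `v` the claim is the weak gradient of `ψ` tested with `v φ`.
    have hw := hψ.2.2 _ (hφ.mul_left hv.1) e
    simp only [contDiff_mul_fderiv hφ.1 hv.1] at hw
    have hvd : MemLp (fun x => v x * fderiv ℝ φ x e + fderiv ℝ v x e * φ x) 2
        (volume.restrict U) := by
      have := (hφ.mul_left hv.1).memLp_fderiv (p := 2) (μ := volume.restrict U) e
      simpa only [contDiff_mul_fderiv hφ.1 hv.1] using this
    have i1 := integrable_mul_of_memLp_two hψ.1 hvd
    have i2 := integrable_mul_of_memLp_two (memLp_inner_const hψ.2.1 e)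
      ((hφ.mul_left hv.1).memLp (p := 2) (μ := volume.restrict U))
    rw [← add_eq_zero_iff_eq_neg, ← integral_add i1 i2] at hw
    rw [← hw]
    refine integral_congr_ae (ae_of_all _ fun x => ?_)
    simp only [hp, hP, inner_smul_right, inner_gradient_left]
    ring
  rw [← hUK (fun x hx => by simp [hp, hz x hx]), ← hUK (fun x hx => by simp [hP, hz x hx]),
      ← integral_add (integrable_mul_of_memLp_two h.1 hpm)
        (integrable_inner_of_memLp_two h.2.1 hPm)] at key
  have i1 := integrable_mul_of_memLp_two m1 (hφ.memLp_fderiv (μ := volume.restrict U) e)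
  have i2 := integrable_mul_of_memLp_two (memLp_inner_const (m2.add m3) e)
    (hφ.memLp (p := 2) (μ := volume.restrict U))
  refine add_eq_zero_iff_eq_neg.1 ((integral_add i1 i2).symm.trans ?_)
  rw [← key]
  refine integral_congr_ae (ae_of_all _ fun x => ?_)
  simp only [hp, hP, inner_smul_right, inner_add_left, inner_smul_left, Pi.add_apply,
    RCLike.conj_to_real]
  ring

theorem fderiv_comp_of_contDiff {F : ℝ → ℝ} (hF : ContDiff ℝ (⊤ : ℕ∞) F) {v : Pt d → ℝ}
    (hv : ContDiff ℝ (⊤ : ℕ∞) v) (x e : Pt d) :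
    fderiv ℝ (fun y => F (v y)) x e = deriv F (v x) * fderiv ℝ v x e := by
  have h1 : HasDerivAt F (deriv F (v x)) (v x) :=
    (hF.differentiable (by simp)).differentiableAt.hasDerivAt
  have h2 := h1.comp_hasFDerivAt x (hv.differentiable (by simp)).differentiableAt.hasFDerivAt
  have h3 := h2.fderiv
  rw [show (fun y => F (v y)) = F ∘ v from rfl, h3]
  simp

/-- Chain rule. -/
theorem HG.comp_of_bound {U : Set (Pt d)} (hU : IsOpen U) {u : Pt d → ℝ} {G : Pt d → Pt d}
    (h : HG U u G) {F : ℝ → ℝ} (hF : ContDiff ℝ (⊤ : ℕ∞) F) (hF0 : F 0 = 0) {C : ℝ}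
    (hC0 : 0 ≤ C)
    (hFl : ∀ s t, |F s - F t| ≤ C * |s - t|) (hFd : ∀ s, |deriv F s| ≤ C)
    (hFdl : ∀ s t, |deriv F s - deriv F t| ≤ C * |s - t|) :
    HG U (fun x => F (u x)) (fun x => deriv F (u x) • G x) := by
  have hdc : Continuous (deriv F) := hF.continuous_deriv (by simp)
  have m1 : ∀ {S : Set (Pt d)} {v : Pt d → ℝ}, MemLp v 2 (volume.restrict S) →
      MemLp (fun x => F (v x)) 2 (volume.restrict S) := by
    intro S v hv
    refine MemLp.of_le_mul (c := C) hv (hF.continuous.comp_aestronglyMeasurable hv.1)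
      (ae_of_all _ fun x => ?_)
    simpa [hF0] using hFl (v x) 0
  have m2 : ∀ {S : Set (Pt d)} {v : Pt d → ℝ} {H : Pt d → Pt d}, MemLp v 2 (volume.restrict S) →
      MemLp H 2 (volume.restrict S) →
      MemLp (fun x => deriv F (v x) • H x) 2 (volume.restrict S) := by
    intro S v H hv hH
    exact memLp_mul_of_bound hH (hdc.comp_aestronglyMeasurable hv.1) (ae_of_all _ fun x => hFd _)
  refine ⟨m1 h.1, m2 h.1 h.2.1, fun φ hφ e => ?_⟩
  set K := tsupport φ with hKdef
  have hK : IsCompact K := hφ.2.1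
  have hKU : K ⊆ U := hφ.2.2
  obtain ⟨Cφ, hCφ⟩ := hφ.exists_bound
  have hz : ∀ x, x ∉ K → φ x = 0 ∧ fderiv ℝ φ x = 0 := fun x hx =>
    ⟨image_eq_zero_of_notMem_tsupport hx, fderiv_of_notMem_tsupport (𝕜 := ℝ) hx⟩
  have hUK : ∀ {f : Pt d → ℝ}, (∀ x, x ∉ K → f x = 0) → ∫ x in U, f x = ∫ x in K, f x := by
    intro f hf
    rw [setIntegral_eq_integral_of_forall_compl_eq_zero (fun x hx => hf x fun h => hx (hKU h)),
      setIntegral_eq_integral_of_forall_compl_eq_zero hf]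
  have hu := memLp_restrict_mono hKU h.1
  have hG := memLp_restrict_mono hKU h.2.1
  have hφe : MemLp (fun x => φ x • e) 2 (volume.restrict K) := by
    have : MemLp φ 2 (volume.restrict K) := hφ.memLp
    exact (ContinuousLinearMap.toSpanSingleton ℝ e).comp_memLp' this
  have hGφ : MemLp (fun x => φ x * inner ℝ (G x) e) 2 (volume.restrict K) :=
    memLp_mul_of_bound (memLp_inner_const hG e) hφ.1.continuous.aestronglyMeasurable
      (ae_of_all _ hCφ)
  rw [hUK (fun x hx => by simp [hz x hx]), hUK (fun x hx => by simp [hz x hx])]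
  refine eq_of_forall_abs_sub_le
    (C := C * (eLpNorm (fun x => fderiv ℝ φ x e) 2 (volume.restrict K)).toReal +
      (C * (eLpNorm (fun x => φ x • e) 2 (volume.restrict K)).toReal +
      C * (eLpNorm (fun x => φ x * inner ℝ (G x) e) 2 (volume.restrict K)).toReal))
      fun ε hε => ?_
  obtain ⟨v, hv, hd⟩ := h.exists_test_approx hU hK hKU (ε := ENNReal.ofReal ε) (by simpa using hε)
  obtain ⟨h1, h2⟩ := toReal_le_of_pairDist_lt hε.le hd
  have hvm : MemLp v 2 (volume.restrict K) := hv.memLp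
  have hvg : MemLp (gradient v) 2 (volume.restrict K) := hv.memLp_gradient
  have hFvt : IsTestFunction U (fun x => F (v x)) :=
    ⟨hF.comp hv.1, hv.2.1.comp_left hF0, (closure_mono fun x (hx : F (v x) ≠ 0) (hx' : v x = 0) =>
      hx (by rw [hx', hF0])).trans hv.2.2⟩
  have hw := (hFvt.hg U).2.2 φ hφ e
  simp only [inner_gradient_left, fderiv_comp_of_contDiff hF hv.1] at hw
  rw [hUK (fun x hx => by simp [hz x hx]), hUK (fun x hx => by simp [hz x hx])] at hw
  have d1 : MemLp (fun x => F (u x) - F (v x)) 2 (volume.restrict K) := (m1 hu).sub (m1 hvm)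
  have d2 : MemLp (fun x => deriv F (v x) • (G x - gradient v x)) 2 (volume.restrict K) :=
    m2 hvm (hG.sub hvg)
  have d3 : MemLp (fun x => deriv F (u x) - deriv F (v x)) 2 (volume.restrict K) := by
    refine MemLp.of_le_mul (c := C) (hu.sub hvm) ((hdc.comp_aestronglyMeasurable hu.1).sub
      (hdc.comp_aestronglyMeasurable hvm.1)) (ae_of_all _ fun x => ?_)
    exact hFdl _ _
  have scale : ∀ {E E' : Type} [NormedAddCommGroup E] [NormedAddCommGroup E']
      {f : Pt d → E} {g : Pt d → E'},
      MemLp g 2 (volume.restrict K) → (∀ x, ‖f x‖ ≤ C * ‖g x‖) →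
      (eLpNorm g 2 (volume.restrict K)).toReal ≤ ε →
      (eLpNorm f 2 (volume.restrict K)).toReal ≤ ε * C := by
    intro E E' _ _ f g hg hfg hgε
    have := eLpNorm_le_mul_eLpNorm_of_ae_le_mul (p := 2) (ae_of_all (volume.restrict K) hfg)
    refine (ENNReal.toReal_mono (ENNReal.mul_ne_top ENNReal.ofReal_ne_top
      hg.eLpNorm_ne_top) this).trans ?_
    rw [ENNReal.toReal_mul, ENNReal.toReal_ofReal hC0, mul_comm]
    gcongr
  have n1 := scale (f := fun x => F (u x) - F (v x)) (hu.sub hvm) (fun x => hFl _ _) h1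
  have n2 := scale (f := fun x => deriv F (v x) • (G x - gradient v x)) (hG.sub hvg)
    (fun x => by
      rw [norm_smul, Real.norm_eq_abs]; exact mul_le_mul_of_nonneg_right (hFd _) (norm_nonneg _))
    h2
  have n3 := scale (f := fun x => deriv F (u x) - deriv F (v x)) (hu.sub hvm)
    (fun x => hFdl _ _) h1
  have b1 := abs_integral_mul_le d1 (hφ.memLp_fderiv (μ := volume.restrict K) e)
  have b2 := abs_integral_inner_le d2 hφe
  have b3 := abs_integral_mul_le d3 hGφ
  -- The error against a smooth approximation `v` has three parts: the change of `F`, the change of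
  -- the gradient, and the change of `deriv F` times the fixed field `G`. In the last part the
  -- Lipschitz bound on `deriv F` puts one factor in `L²`, and `φ G` is the other.
  have split : (∫ x in K, F (u x) * fderiv ℝ φ x e) -
      (-∫ x in K, inner ℝ (deriv F (u x) • G x) e * φ x) =
      (∫ x in K, (F (u x) - F (v x)) * fderiv ℝ φ x e) +
      ((∫ x in K, inner ℝ (deriv F (v x) • (G x - gradient v x)) (φ x • e)) +
      ∫ x in K, (deriv F (u x) - deriv F (v x)) * (φ x * inner ℝ (G x) e)) := by
    have i1 := integrable_mul_of_memLp_two (m1 hu) (hφ.memLp_fderiv (μ := volume.restrict K) e)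
    have i2 := integrable_mul_of_memLp_two (m1 hvm) (hφ.memLp_fderiv (μ := volume.restrict K) e)
    have i3 := integrable_mul_of_memLp_two (memLp_inner_const (m2 hu hG) e)
      (hφ.memLp (p := 2) (μ := volume.restrict K))
    have i4 := integrable_mul_of_memLp_two (memLp_inner_const (m2 hvm hvg) e)
      (hφ.memLp (p := 2) (μ := volume.restrict K))
    have e1 : ∫ x in K, (F (u x) - F (v x)) * fderiv ℝ φ x e =
        (∫ x in K, F (u x) * fderiv ℝ φ x e) - ∫ x in K, F (v x) * fderiv ℝ φ x e := by
      rw [← integral_sub i1 i2]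
      simp only [sub_mul]
    have e2 : (∫ x in K, inner ℝ (deriv F (v x) • (G x - gradient v x)) (φ x • e)) +
        (∫ x in K, (deriv F (u x) - deriv F (v x)) * (φ x * inner ℝ (G x) e)) =
        (∫ x in K, inner ℝ (deriv F (u x) • G x) e * φ x) -
        ∫ x in K, inner ℝ (deriv F (v x) • gradient v x) e * φ x := by
      rw [← integral_add (integrable_inner_of_memLp_two d2 hφe)
        (integrable_mul_of_memLp_two d3 hGφ), ← integral_sub i3 i4]
      refine integral_congr_ae (ae_of_all _ fun x => ?_)
      simp only [inner_smul_left, inner_smul_right, inner_sub_left, RCLike.conj_to_real]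
      ring
    rw [e1, e2, hw]
    simp only [inner_smul_left, inner_gradient_left, RCLike.conj_to_real]
    ring
  rw [split]
  refine (abs_add_le _ _).trans ?_
  refine (add_le_add b1 ((abs_add_le _ _).trans (add_le_add b2 b3))).trans ?_
  rw [mul_add, mul_add, ← mul_assoc, ← mul_assoc, ← mul_assoc]
  gcongr

/-! ### Cut-off functions -/

/-- A smooth truncation that vanishes on `[-1, 1]` and is the identity away from `[-2, 2]`. -/
theorem exists_smooth_truncation : ∃ (T : ℝ → ℝ) (C : ℝ), 0 < C ∧ ContDiff ℝ (⊤ : ℕ∞) T ∧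
    (∀ s, |s| ≤ 1 → T s = 0) ∧ deriv T 0 = 0 ∧ (∀ s, 2 ≤ |s| → deriv T s = 1) ∧
    (∀ s, |T s - s| ≤ 2) ∧ (∀ s, |deriv T s| ≤ C) ∧ (∀ s t, |T s - T t| ≤ C * |s - t|) ∧
    ∀ s t, |deriv T s - deriv T t| ≤ C * |s - t| := by
  -- The transition in `s ^ 2 - 1` is zero for `|s| ≤ 1` and one for `|s| ≥ √2`.
  set T : ℝ → ℝ := fun s => s * Real.smoothTransition (s ^ 2 - 1) with hT
  have hTc : ContDiff ℝ (⊤ : ℕ∞) T :=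
    contDiff_id.mul (Real.smoothTransition.contDiff.comp ((contDiff_id.pow 2).sub contDiff_const))
  have h0 : ∀ s, |s| ≤ 1 → T s = 0 := fun s hs => by
    have : s ^ 2 ≤ 1 := by rw [← sq_abs]; exact pow_le_one₀ (abs_nonneg _) hs
    simp [hT, Real.smoothTransition.zero_of_nonpos (show s ^ 2 - 1 ≤ 0 by linarith)]
  -- The value `3 / 2` lies between `√2` and `2`, so `T` is the identity on a neighbourhood of every
  -- point with `|s| ≥ 2`.
  have h1 : ∀ s, 3 / 2 ≤ |s| → T s = s := fun s hs => by
    have : 2 ≤ s ^ 2 := by rw [← sq_abs]; nlinarith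
    simp [hT, Real.smoothTransition.one_of_one_le (show 1 ≤ s ^ 2 - 1 by linarith)]
  have hd0 : deriv T 0 = 0 := by
    have : T =ᶠ[𝓝 0] fun _ => (0 : ℝ) := by
      filter_upwards [Metric.ball_mem_nhds (0 : ℝ) one_pos] with s hs
      rw [mem_ball_zero_iff, Real.norm_eq_abs] at hs
      exact h0 s hs.le
    rw [this.deriv_eq, deriv_const]
  have hd1 : ∀ s, 2 ≤ |s| → deriv T s = 1 := fun s hs => by
    have : T =ᶠ[𝓝 s] fun s => s := by
      filter_upwards [(continuous_abs.isOpen_preimage _ isOpen_Ioi).mem_nhds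
        (show s ∈ (fun t : ℝ => |t|) ⁻¹' Ioi (3 / 2) from by
          simp only [mem_preimage, mem_Ioi]; linarith)] with t ht
      exact h1 t (le_of_lt ht)
    rw [this.deriv_eq, deriv_id'']
  have h2 : ∀ s, |T s - s| ≤ 2 := fun s => by
    by_cases hs : 3 / 2 ≤ |s|
    · simp [h1 s hs]
    · push Not at hs
      have e : T s - s = s * (Real.smoothTransition (s ^ 2 - 1) - 1) := by rw [hT]; ring
      have hb : |Real.smoothTransition (s ^ 2 - 1) - 1| ≤ 1 := by
        rw [abs_le]
        constructor <;> linarith [Real.smoothTransition.nonneg (s ^ 2 - 1),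
          Real.smoothTransition.le_one (s ^ 2 - 1)]
      rw [e, abs_mul]
      nlinarith [abs_nonneg s, abs_nonneg (Real.smoothTransition (s ^ 2 - 1) - 1)]
  have hdc : ContDiff ℝ (⊤ : ℕ∞) (fun s => deriv T s - 1) :=
    ((contDiff_infty_iff_deriv.1 hTc).2).sub contDiff_const
  -- Subtracting one gives a compactly supported smooth function, from which the global bound and
  -- the Lipschitz constant of `deriv T` are read off.
  have hcs : HasCompactSupport (fun s => deriv T s - 1) := by
    refine HasCompactSupport.intro (isCompact_closedBall (0 : ℝ) 2) fun s hs => ?_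
    rw [mem_closedBall_zero_iff, Real.norm_eq_abs, not_le] at hs
    simp [hd1 s hs.le]
  obtain ⟨B, hB⟩ := hcs.exists_bound_of_continuous hdc.continuous
  obtain ⟨L, hL⟩ := hdc.lipschitzWith_of_hasCompactSupport hcs (by simp)
  have hB' : ∀ s, |deriv T s| ≤ B + 1 := fun s => by
    have := hB s
    rw [Real.norm_eq_abs, abs_le] at this
    rw [abs_le]; constructor <;> linarith
  have hB0 : 0 ≤ B := (norm_nonneg _).trans (hB 0)
  refine ⟨T, B + 1 + L, by positivity, hTc, h0, hd0, hd1, h2, fun s => (hB' s).trans ?_,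
    fun s t => ?_, fun s t => ?_⟩
  · linarith [L.coe_nonneg]
  · have := Convex.norm_image_sub_le_of_norm_deriv_le (f := T) (s := univ) (C := B + 1)
      (fun x _ => (hTc.differentiable (by simp)).differentiableAt) (fun x _ => hB' x)
      convex_univ (mem_univ t) (mem_univ s)
    refine this.trans ?_
    exact mul_le_mul_of_nonneg_right (by linarith [L.coe_nonneg]) (norm_nonneg _)
  · have := hL.dist_le_mul s t
    rw [Real.dist_eq, Real.dist_eq, sub_sub_sub_cancel_right] at this
    refine this.trans ?_
    gcongr
    linarith

theorem tendsto_eLpNorm_two_of_dominated {α E : Type*} [MeasurableSpace α] {μ : Measure α}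
    [NormedAddCommGroup E] {f : ℕ → α → E} {h : α → ℝ} (hf : ∀ n, AEStronglyMeasurable (f n) μ)
    (hh : MemLp h 2 μ) (hfh : ∀ n, ∀ᵐ x ∂μ, ‖f n x‖ ≤ h x)
    (hlim : ∀ᵐ x ∂μ, Tendsto (fun n => f n x) atTop (𝓝 0)) :
    Tendsto (fun n => eLpNorm (f n) 2 μ) atTop (𝓝 0) := by
  have h1 : Tendsto (fun n => ∫⁻ x, ‖f n x‖ₑ ^ 2 ∂μ) atTop (𝓝 (∫⁻ _, 0 ∂μ)) := by
    refine tendsto_lintegral_of_dominated_convergence' (fun x => ‖h x‖ₑ ^ 2)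
      (fun n => (hf n).enorm.pow_const 2) (fun n => ?_) ?_ ?_
    · filter_upwards [hfh n] with x hx
      gcongr
      rw [enorm_le_iff_norm_le]
      exact hx.trans (le_abs_self _)
    · rw [← eLpNorm_two_sq]
      exact ENNReal.pow_ne_top hh.eLpNorm_ne_top
    · filter_upwards [hlim] with x hx
      have := (ENNReal.continuous_pow 2).tendsto _ |>.comp
        ((continuous_enorm.tendsto (0 : E)).comp hx)
      simpa [Function.comp_def] using this
  have h2 : ∀ n, eLpNorm (f n) 2 μ = (∫⁻ x, ‖f n x‖ₑ ^ 2 ∂μ) ^ (1 / 2 : ℝ) := fun n => by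
    rw [← eLpNorm_two_sq, ← ENNReal.rpow_natCast, ← ENNReal.rpow_mul]
    norm_num
  have h3 := (ENNReal.continuous_rpow_const (y := 1 / 2)).tendsto (∫⁻ _, 0 ∂μ) |>.comp h1
  simp only [lintegral_zero, one_div, Function.comp_def] at h3
  simp only [h2]
  convert h3 using 2
  all_goals norm_num

/-- The pair `(z, Z)` is a limit of functions vanishing near `Γ`. -/
def HV (U Γ : Set (Pt d)) (z : Pt d → ℝ) (Z : Pt d → Pt d) : Prop :=
  HG U z Z ∧ ∀ ε : ℝ≥0∞, 0 < ε → ∃ v H, HG U v H ∧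
    (∃ N : Set (Pt d), IsOpen N ∧ Γ ⊆ N ∧ ∀ᵐ x ∂(volume.restrict U), x ∈ N → v x = 0) ∧
    pairDist U z Z v H < ε

theorem HV.memH1Vanishing {U Γ : Set (Pt d)} (hU : IsOpen U) {z : Pt d → ℝ} {Z : Pt d → Pt d}
    (h : HV U Γ z Z) : MemH1Vanishing U Γ z := by
  refine ⟨h.1.memH1, fun ε hε => ?_⟩
  obtain ⟨v, H, hv, hN, hd⟩ := h.2 ε hε
  exact ⟨v, hv.memH1, hN, by rwa [h.1.h1Dist_eq hU hv]⟩

theorem MemH1Vanishing.hv {U Γ : Set (Pt d)} (hU : IsOpen U) {z : Pt d → ℝ}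
    (h : MemH1Vanishing U Γ z) : HV U Γ z (weakGrad U z) := by
  refine ⟨h.1.hg hU, fun ε hε => ?_⟩
  obtain ⟨v, hv, hN, hd⟩ := h.2 ε hε
  exact ⟨v, weakGrad U v, hv.hg hU, hN, by rwa [(h.1.hg hU).h1Dist_eq hU (hv.hg hU)] at hd⟩

/-- Truncate the cut-off: `F n s = δ T (s / δ)` with `δ = 1 / (n + 1)` vanishes for `|s| ≤ δ`, so `F
n (ψ) z` vanishes off a compact subset of `W` and lies in `H¹₀(W)`. As `n` grows, these products and
their gradients converge by dominated convergence, and `H¹₀(W)` is closed. No regularity of the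
boundary of `W` is involved. -/
theorem H0.mul_cutoff_of_ae {U W : Set (Pt d)} (hU : IsOpen U) (hW : IsOpen W) (hWU : W ⊆ U)
    {ψ z : Pt d → ℝ} {g Z : Pt d → Pt d} (hψ : HG U ψ g) {C : ℝ}
    (hC : ∀ᵐ x ∂(volume.restrict U), |ψ x| ≤ C) (hC' : ∀ᵐ x ∂(volume.restrict U), ‖g x‖ ≤ C)
    (hz : HG U z Z)
    (hK : ∀ ε : ℝ, 0 < ε → ∃ K, IsCompact K ∧ K ⊆ W ∧
      ∀ᵐ x ∂(volume.restrict U), x ∉ K → |ψ x| ≤ ε ∨ z x = 0) :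
    H0 W (fun x => ψ x * z x) (fun x => ψ x • Z x + z x • g x) := by
  classical
  obtain ⟨T, B, hB, hTc, hT0, hTd0, hTd1, hT2, hTdb, hTl, hTdl⟩ := exists_smooth_truncation
  have hC0 : ∀ᵐ x ∂(volume.restrict U), 0 ≤ C := by
    filter_upwards [hC] with x hx using (abs_nonneg _).trans hx
  let δ : ℕ → ℝ := fun n => 1 / ((n : ℝ) + 1)
  have hδ : ∀ n, 0 < δ n := fun n => by positivity
  have hδ1 : ∀ n, δ n ≤ 1 := fun n => by
    rw [div_le_one (by positivity)]; linarith [n.cast_nonneg (α := ℝ)]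
  have hδt : Tendsto δ atTop (𝓝 0) := tendsto_one_div_add_atTop_nhds_zero_nat
  let F : ℕ → ℝ → ℝ := fun n s => δ n * T (s / δ n)
  have hFc : ∀ n, ContDiff ℝ (⊤ : ℕ∞) (F n) := fun n =>
    contDiff_const.mul (hTc.comp (contDiff_id.div_const _))
  have hFd : ∀ n s, deriv (F n) s = deriv T (s / δ n) := fun n s => by
    have h1 : HasDerivAt T (deriv T (s / δ n)) (s / δ n) :=
      (hTc.differentiable (by simp)).differentiableAt.hasDerivAt
    have h2 := (h1.comp s ((hasDerivAt_id s).div_const (δ n))).const_mul (δ n)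
    refine h2.deriv.trans ?_
    field_simp [(hδ n).ne']
  have hF2 : ∀ n s, |F n s - s| ≤ 2 * δ n := fun n s => by
    have e : F n s - s = δ n * (T (s / δ n) - s / δ n) := by
      simp only [F]; field_simp [(hδ n).ne']
    rw [e, abs_mul, abs_of_pos (hδ n), mul_comm]
    exact mul_le_mul_of_nonneg_right (hT2 _) (hδ n).le
  have hF0 : ∀ n s, |s| ≤ δ n → F n s = 0 := fun n s hs => by
    simp only [F]
    rw [hT0 _ (by rw [abs_div, abs_of_pos (hδ n)]; exact (div_le_one (hδ n)).2 hs), mul_zero]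
  have hFl : ∀ n s t, |F n s - F n t| ≤ B * |s - t| := fun n s t => by
    simp only [F]
    rw [← mul_sub, abs_mul, abs_of_pos (hδ n)]
    calc _ ≤ δ n * (B * |s / δ n - t / δ n|) := mul_le_mul_of_nonneg_left (hTl _ _) (hδ n).le
      _ = B * |s - t| := by
        rw [← sub_div, abs_div, abs_of_pos (hδ n)]; field_simp [(hδ n).ne']
  have hFdl : ∀ n s t, |deriv (F n) s - deriv (F n) t| ≤ B / δ n * |s - t| := fun n s t => by
    rw [hFd, hFd]
    refine (hTdl _ _).trans (le_of_eq ?_)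
    rw [← sub_div, abs_div, abs_of_pos (hδ n)]; field_simp
  have hBδ : ∀ n, B ≤ B / δ n := fun n => by
    rw [le_div_iff₀ (hδ n)]; nlinarith [hδ1 n]
  have hFψ : ∀ n, HG U (fun x => F n (ψ x)) (fun x => deriv (F n) (ψ x) • g x) := fun n => by
    refine hψ.comp_of_bound hU (hFc n) (hF0 n 0 (by simpa using (hδ n).le)) (C := B / δ n)
      (by positivity) (fun s t => (hFl n s t).trans ?_) (fun s => ?_) (hFdl n)
    · gcongr; exact hBδ n
    · rw [hFd]; exact (hTdb _).trans (hBδ n)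
  have hprod : ∀ n, HG U (fun x => F n (ψ x) * z x)
      (fun x => F n (ψ x) • Z x + z x • deriv (F n) (ψ x) • g x) := fun n => by
    refine hz.mul_of_bound hU (hFψ n) (C := C + 2 + B * C) ?_ ?_
    · filter_upwards [hC, hC0] with x hx h0
      have h1 := hF2 n (ψ x)
      have h2 := hδ1 n
      have h3 : 0 ≤ B * C := by positivity
      rw [abs_le] at hx h1 ⊢
      constructor <;> linarith
    · filter_upwards [hC', hC0] with x hx h0
      rw [norm_smul, Real.norm_eq_abs, hFd]
      have := mul_le_mul (hTdb (ψ x / δ n)) hx (norm_nonneg _) hB.le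
      linarith
  have hH0 : ∀ n, H0 W (fun x => F n (ψ x) * z x)
      (fun x => F n (ψ x) • Z x + z x • deriv (F n) (ψ x) • g x) := fun n => by
    obtain ⟨K, hKc, hKW, hKz⟩ := hK (δ n) (hδ n)
    refine ((hprod n).mono hWU).h0_of_ae_eq_zero hW hKc hKW ?_
    filter_upwards [ae_restrict_of_ae_restrict_of_subset hWU hKz] with x hx hxK
    rcases hx hxK with h | h
    · rw [hF0 n _ h, zero_mul]
    · rw [h, mul_zero]
  have hCW := ae_restrict_of_ae_restrict_of_subset hWU hC
  have hCW' := ae_restrict_of_ae_restrict_of_subset hWU hC'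
  have hψW := hψ.mono hWU
  have hzW := hz.mono hWU
  have hpW := (hz.mul_of_bound hU hψ hC hC').mono hWU
  -- The derivatives `deriv (F n) (ψ x)` tend to one where `ψ ≠ 0` and to zero where `ψ = 0`, so the
  -- limit of the gradients carries this indicator in front of `g`.
  let χ : Pt d → ℝ := fun x => if ψ x = 0 then 0 else 1
  set L : Pt d → Pt d := fun x => ψ x • Z x + z x • χ x • g x with hL
  have hχlim : ∀ x, Tendsto (fun n => deriv (F n) (ψ x)) atTop (𝓝 (χ x)) := fun x => by
    simp only [hFd, χ]
    by_cases h : ψ x = 0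
    · simp [h, hTd0]
    · simp only [h, if_false]
      refine tendsto_const_nhds.congr' ?_
      filter_upwards [hδt.eventually (gt_mem_nhds (show 0 < |ψ x| / 2 by positivity))] with n hn
      rw [hTd1]
      rw [abs_div, abs_of_pos (hδ n), le_div_iff₀ (hδ n)]
      linarith
  have hχm : AEStronglyMeasurable χ (volume.restrict W) :=
    aestronglyMeasurable_of_tendsto_ae atTop
      (fun n => ((hFc n).continuous_deriv (by simp)).comp_aestronglyMeasurable hψW.1.1)
      (ae_of_all _ hχlim)
  have hχb : ∀ x, |χ x| ≤ 1 := fun x => by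
    simp only [χ]; split_ifs <;> simp
  have hLm : MemLp L 2 (volume.restrict W) := by
    refine MemLp.add (memLp_mul_of_bound hzW.2.1 hψW.1.1 hCW)
      (memLp_smul_of_bound_right (C := C) hzW.1 (hχm.smul hψW.2.1.1) ?_)
    filter_upwards [hCW'] with x hx
    simp only [norm_smul, Real.norm_eq_abs]
    calc |χ x| * ‖g x‖ ≤ 1 * C := mul_le_mul (hχb x) hx (norm_nonneg _) zero_le_one
      _ = C := one_mul C
  have hlim : H0 W (fun x => ψ x * z x) L := by
    refine H0.of_approx hpW.1 hLm fun ε hε => ?_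
    have t1 : Tendsto (fun n => eLpNorm ((fun x => ψ x * z x) - fun x => F n (ψ x) * z x) 2
        (volume.restrict W)) atTop (𝓝 0) := by
      refine tendsto_eLpNorm_two_of_dominated (h := fun x => 2 * |z x|)
        (fun n => (hpW.1.sub (hH0 n).1.1).1) (hzW.1.norm.const_mul 2)
        (fun n => ae_of_all _ fun x => ?_) (ae_of_all _ fun x => ?_)
      · simp only [Pi.sub_apply, ← sub_mul, Real.norm_eq_abs, abs_mul]
        gcongr
        rw [abs_sub_comm]
        exact (hF2 n _).trans (by linarith [hδ1 n])
      · have : Tendsto (fun n => (ψ x - F n (ψ x)) * z x) atTop (𝓝 (0 * z x)) := by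
          refine Tendsto.mul_const _ ?_
          refine squeeze_zero_norm (fun n => ?_) (by simpa using hδt.const_mul 2)
          rw [Real.norm_eq_abs, abs_sub_comm]
          exact hF2 n _
        simpa [sub_mul] using this
    have t2 : Tendsto (fun n => eLpNorm (L - fun x => F n (ψ x) • Z x +
        z x • deriv (F n) (ψ x) • g x) 2 (volume.restrict W)) atTop (𝓝 0) := by
      have e : ∀ n x, (L - fun x => F n (ψ x) • Z x + z x • deriv (F n) (ψ x) • g x) x =
          (ψ x - F n (ψ x)) • Z x + (z x * (χ x - deriv (F n) (ψ x))) • g x := fun n x => by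
        simp only [hL, Pi.sub_apply, sub_smul, mul_sub, mul_smul]
        abel
      refine tendsto_eLpNorm_two_of_dominated (h := fun x => 2 * ‖Z x‖ + (1 + B) * C * |z x|)
        (fun n => (hLm.sub (hH0 n).1.2.1).1)
        ((hzW.2.1.norm.const_mul 2).add (hzW.1.norm.const_mul _))
        (fun n => ?_) (ae_of_all _ fun x => ?_)
      · filter_upwards [hCW'] with x hx
        rw [e n x]
        refine (norm_add_le _ _).trans (add_le_add ?_ ?_)
        · rw [norm_smul]
          gcongr
          rw [Real.norm_eq_abs, abs_sub_comm]
          exact (hF2 n _).trans (by linarith [hδ1 n])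
        · rw [norm_smul, norm_mul, Real.norm_eq_abs, Real.norm_eq_abs]
          have h1 : |χ x - deriv (F n) (ψ x)| ≤ 1 + B := by
            refine (abs_sub _ _).trans (add_le_add (hχb x) ?_)
            rw [hFd]; exact hTdb _
          calc |z x| * |χ x - deriv (F n) (ψ x)| * ‖g x‖ ≤ |z x| * (1 + B) * C := by
                gcongr
            _ = _ := by ring
      · simp only [e]
        have a1 : Tendsto (fun n => (ψ x - F n (ψ x)) • Z x) atTop (𝓝 ((0 : ℝ) • Z x)) := by
          refine Tendsto.smul_const ?_ _
          refine squeeze_zero_norm (fun n => ?_) (by simpa using hδt.const_mul 2)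
          rw [Real.norm_eq_abs, abs_sub_comm]
          exact hF2 n _
        have a2 : Tendsto (fun n => (z x * (χ x - deriv (F n) (ψ x))) • g x) atTop
            (𝓝 ((z x * (χ x - χ x)) • g x)) :=
          (((hχlim x).const_sub (χ x)).const_mul (z x)).smul_const _
        simpa using a1.add a2
    have t3 := t1.add t2
    rw [add_zero] at t3
    obtain ⟨n, hn⟩ := (t3.eventually (gt_mem_nhds hε)).exists
    exact ⟨_, _, hH0 n, hn⟩
  -- Uniqueness of the weak gradient identifies the limit with the product rule gradient and removes
  -- the indicator.
  exact hlim.congr EventuallyEq.rfl (hlim.1.unique hW hpW)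

theorem eLpNorm_mul_le_of_bound {E : Type*} [NormedAddCommGroup E] [NormedSpace ℝ E]
    {μ : Measure (Pt d)} {ψ : Pt d → ℝ} {f : Pt d → E} {C : ℝ}
    (hC : ∀ᵐ x ∂μ, |ψ x| ≤ C) :
    eLpNorm (fun x => ψ x • f x) 2 μ ≤ ENNReal.ofReal C * eLpNorm f 2 μ := by
  refine eLpNorm_le_mul_eLpNorm_of_ae_le_mul ?_ 2
  filter_upwards [hC] with x hx
  rw [norm_smul, Real.norm_eq_abs]
  gcongr

theorem eLpNorm_smul_le_of_bound_right {E : Type*} [NormedAddCommGroup E] [NormedSpace ℝ E]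
    {μ : Measure (Pt d)} {f : Pt d → ℝ} {g : Pt d → E} {C : ℝ}
    (hC : ∀ᵐ x ∂μ, ‖g x‖ ≤ C) :
    eLpNorm (fun x => f x • g x) 2 μ ≤ ENNReal.ofReal C * eLpNorm f 2 μ := by
  refine eLpNorm_le_mul_eLpNorm_of_ae_le_mul ?_ 2
  filter_upwards [hC] with x hx
  rw [norm_smul, mul_comm]
  gcongr

/-- Multiplication by a Lipschitz function is continuous in `H¹`. -/
theorem pairDist_mul_le {U : Set (Pt d)} {ψ z v : Pt d → ℝ} {g Z H : Pt d → Pt d}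
    (hψ : HG U ψ g) {C : ℝ}
    (hC : ∀ᵐ x ∂(volume.restrict U), |ψ x| ≤ C) (hC' : ∀ᵐ x ∂(volume.restrict U), ‖g x‖ ≤ C)
    (hz : HG U z Z) (hv : HG U v H) :
    pairDist U (fun x => ψ x * z x) (fun x => ψ x • Z x + z x • g x)
      (fun x => ψ x * v x) (fun x => ψ x • H x + v x • g x) ≤
      ENNReal.ofReal (2 * C) * pairDist U z Z v H := by
  have hd := hz.sub hv
  have e1 : ((fun x => ψ x * z x) - fun x => ψ x * v x) = fun x => ψ x • (z - v) x := by
    funext x; simp [mul_sub]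
  have e2 : ((fun x => ψ x • Z x + z x • g x) - fun x => ψ x • H x + v x • g x) =
      (fun x => ψ x • (Z - H) x) + fun x => (z - v) x • g x := by
    funext x
    simp only [Pi.sub_apply, Pi.add_apply, smul_sub, sub_smul]
    abel
  have m1 := memLp_mul_of_bound hd.2.1 hψ.1.1 hC
  have m2 := memLp_smul_of_bound_right hd.1 hψ.2.1.1 hC'
  have h1 := eLpNorm_mul_le_of_bound (f := z - v) hC
  have h2 := eLpNorm_mul_le_of_bound (f := Z - H) hC
  have h3 := eLpNorm_smul_le_of_bound_right (f := z - v) hC'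
  have h4 := eLpNorm_add_le m1.1 m2.1 one_le_two
  rw [pairDist, e1, e2]
  have h2C : ENNReal.ofReal (2 * C) = 2 * ENNReal.ofReal C := by
    rw [ENNReal.ofReal_mul zero_le_two]; simp
  calc _ ≤ ENNReal.ofReal C * eLpNorm (z - v) 2 (volume.restrict U) +
        (ENNReal.ofReal C * eLpNorm (Z - H) 2 (volume.restrict U) +
          ENNReal.ofReal C * eLpNorm (z - v) 2 (volume.restrict U)) :=
        add_le_add h1 (h4.trans (add_le_add h2 h3))
    _ ≤ ENNReal.ofReal C * eLpNorm (z - v) 2 (volume.restrict U) +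
        (ENNReal.ofReal C * eLpNorm (Z - H) 2 (volume.restrict U) +
          ENNReal.ofReal C * eLpNorm (z - v) 2 (volume.restrict U)) +
          ENNReal.ofReal C * eLpNorm (Z - H) 2 (volume.restrict U) := le_self_add
    _ = _ := by rw [pairDist, h2C]; ring

/-- Multiplying a function that vanishes on `Γ` by a cut-off function gives a function in
`H¹₀`. -/
theorem HV.h0_mul_cutoff {U W Γ : Set (Pt d)} (hU : IsOpen U) (hW : IsOpen W) (hWU : W ⊆ U)
    {ψ z : Pt d → ℝ} {g Z : Pt d → Pt d} (hψ : HG U ψ g) {C : ℝ}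
    (hC : ∀ᵐ x ∂(volume.restrict U), |ψ x| ≤ C) (hC' : ∀ᵐ x ∂(volume.restrict U), ‖g x‖ ≤ C)
    (hz : HV U Γ z Z)
    (hK : ∀ ε : ℝ, 0 < ε → ∀ N, IsOpen N → Γ ⊆ N → ∃ K, IsCompact K ∧ K ⊆ W ∧
      ∀ x ∈ U, x ∉ K → |ψ x| ≤ ε ∨ x ∈ N) :
    H0 W (fun x => ψ x * z x) (fun x => ψ x • Z x + z x • g x) := by
  have hpW := (hz.1.mul_of_bound hU hψ hC hC').mono hWU
  refine H0.of_approx hpW.1 hpW.2.1 fun ε hε => ?_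
  -- First approximate `z` by functions vanishing near `Γ`, so closely that multiplication by `ψ`,
  -- which costs the factor `2 * C`, keeps the error below `ε`.
  obtain ⟨ε', hε', hlt⟩ : ∃ ε' : ℝ≥0∞, 0 < ε' ∧ ENNReal.ofReal (2 * C) * ε' < ε := by
    have ht : Tendsto (fun s : ℝ≥0∞ => ENNReal.ofReal (2 * C) * s) (𝓝[>] 0) (𝓝 0) := by
      have := (ENNReal.continuous_const_mul (a := ENNReal.ofReal (2 * C))
        ENNReal.ofReal_ne_top).tendsto 0
      rw [mul_zero] at this
      exact this.mono_left nhdsWithin_le_nhds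
    obtain ⟨s, hs1, hs2⟩ := ((ht.eventually (gt_mem_nhds hε)).and self_mem_nhdsWithin).exists
    exact ⟨s, hs2, hs1⟩
  obtain ⟨v, H, hv, ⟨N, hN, hΓN, hvN⟩, hd⟩ := hz.2 ε' hε'
  refine ⟨_, _, H0.mul_cutoff_of_ae hU hW hWU hψ hC hC' hv fun δ hδ => ?_, ?_⟩
  · obtain ⟨K, hKc, hKW, hKx⟩ := hK δ hδ N hN hΓN
    refine ⟨K, hKc, hKW, ?_⟩
    filter_upwards [hvN, ae_restrict_mem hU.measurableSet] with x hx hxU hxK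
    exact (hKx x hxU hxK).imp_right hx
  · refine lt_of_le_of_lt ?_ (lt_of_le_of_lt (pairDist_mul_le hψ hC hC' hz.1 hv)
      (lt_of_le_of_lt (by gcongr) hlt))
    exact add_le_add (eLpNorm_mono_measure _ (Measure.restrict_mono_set _ hWU))
      (eLpNorm_mono_measure _ (Measure.restrict_mono_set _ hWU))

/-! ### Extension by zero and restriction -/

theorem pairDist_indicator {U W : Set (Pt d)} (hW : MeasurableSet W) (hWU : W ⊆ U)
    {f φ : Pt d → ℝ} {G H : Pt d → Pt d} (hφ : ∀ x, x ∉ W → φ x = 0)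
    (hH : ∀ x, x ∉ W → H x = 0) :
    pairDist U (W.indicator f) (W.indicator G) φ H = pairDist W f G φ H := by
  have e1 : W.indicator f - φ = W.indicator (f - φ) := by
    funext x; by_cases hx : x ∈ W <;> simp [hx, hφ]
  have e2 : W.indicator G - H = W.indicator (G - H) := by
    funext x; by_cases hx : x ∈ W <;> simp [hx, hH]
  rw [pairDist, pairDist, e1, e2, eLpNorm_indicator_eq_eLpNorm_restrict hW,
    eLpNorm_indicator_eq_eLpNorm_restrict hW, Measure.restrict_restrict hW,
    inter_eq_self_of_subset_left hWU]

/-- Extension by zero of a function in `H¹₀`. -/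
theorem H0.indicator {U W : Set (Pt d)} (hW : MeasurableSet W) (hWU : W ⊆ U)
    {f : Pt d → ℝ} {G : Pt d → Pt d} (h : H0 W f G) :
    H0 U (W.indicator f) (W.indicator G) := by
  refine H0.of_approx ((memLp_indicator_iff_restrict hW).2 ?_)
    ((memLp_indicator_iff_restrict hW).2 ?_) fun ε hε => ?_
  · rw [Measure.restrict_restrict hW, inter_eq_self_of_subset_left hWU]; exact h.1.1
  · rw [Measure.restrict_restrict hW, inter_eq_self_of_subset_left hWU]; exact h.1.2.1
  obtain ⟨φ, hφ, hd⟩ := h.2 ε hε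
  refine ⟨φ, gradient φ, (hφ.mono hWU).h0, ?_⟩
  rwa [pairDist_indicator hW hWU
    (fun x hx => image_eq_zero_of_notMem_tsupport fun h => hx (hφ.2.2 h))
    (fun x hx => ?_)]
  rw [gradient, fderiv_of_notMem_tsupport (𝕜 := ℝ) (fun h => hx (hφ.2.2 h)), map_zero]

theorem pairDist_mono {U W : Set (Pt d)} (hWU : W ⊆ U) (f g : Pt d → ℝ) (G H : Pt d → Pt d) :
    pairDist W f G g H ≤ pairDist U f G g H :=
  add_le_add (eLpNorm_mono_measure _ (Measure.restrict_mono_set _ hWU))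
    (eLpNorm_mono_measure _ (Measure.restrict_mono_set _ hWU))

theorem HV.mono {U W Γ Γ' : Set (Pt d)} (hWU : W ⊆ U) (hΓ : Γ' ⊆ Γ) {z : Pt d → ℝ}
    {Z : Pt d → Pt d} (h : HV U Γ z Z) : HV W Γ' z Z := by
  refine ⟨h.1.mono hWU, fun ε hε => ?_⟩
  obtain ⟨v, H, hv, ⟨N, hN, hΓN, hvN⟩, hd⟩ := h.2 ε hε
  exact ⟨v, H, hv.mono hWU, ⟨N, hN, hΓ.trans hΓN,
    ae_restrict_of_ae_restrict_of_subset hWU hvN⟩, (pairDist_mono hWU _ _ _ _).trans_lt hd⟩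

/-- An empty boundary part imposes no condition; through this fact interior subdomains are treated
as boundary subdomains. -/
theorem HG.hv_empty {U : Set (Pt d)} {z : Pt d → ℝ} {Z : Pt d → Pt d} (h : HG U z Z) :
    HV U ∅ z Z :=
  ⟨h, fun ε hε => ⟨z, Z, h, ⟨∅, isOpen_empty, subset_rfl, by simp⟩, by simpa [pairDist] using hε⟩⟩

/-! ### Differences of translates -/

theorem lintegral_translate_le {K K' : Set (Pt d)} (hK : MeasurableSet K)
    (hK' : MeasurableSet K') {h : Pt d} (hKK : ∀ x ∈ K, x + h ∈ K') (f : Pt d → ℝ≥0∞) :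
    ∫⁻ x in K, f (x + h) ≤ ∫⁻ x in K', f x := by
  rw [← lintegral_indicator hK, ← lintegral_indicator hK',
    ← lintegral_add_right_eq_self (fun x => K'.indicator f x) h]
  refine lintegral_mono fun x => ?_
  by_cases hx : x ∈ K
  · simp [hx, hKK x hx]
  · simp [hx]

/-- The fundamental theorem of calculus along the segment from `x` to `x + h`, followed by Jensen's
inequality on `[0, 1]`. -/
theorem enorm_sub_sq_le_of_contDiff {v : Pt d → ℝ} (hv : ContDiff ℝ (⊤ : ℕ∞) v) (x h : Pt d) :
    ‖v (x + h) - v x‖ₑ ^ 2 ≤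
      ‖h‖ₑ ^ 2 * ∫⁻ s in Icc (0 : ℝ) 1, ‖gradient v (x + s • h)‖ₑ ^ 2 := by
  have hc : Continuous fun s : ℝ => gradient v (x + s • h) :=
    (continuous_gradient_of_contDiff hv).comp (by fun_prop)
  have hprob : IsProbabilityMeasure (volume.restrict (Icc (0 : ℝ) 1)) := ⟨by simp⟩
  have hd : ∀ s : ℝ, HasDerivAt (fun s : ℝ => v (x + s • h)) (inner ℝ (gradient v (x + s • h)) h)
      s := fun s => by
    have h1 : HasFDerivAt v (fderiv ℝ v (x + s • h)) (x + s • h) :=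
      (hv.differentiable (by simp)).differentiableAt.hasFDerivAt
    have h2 : HasDerivAt (fun s : ℝ => x + s • h) h s := by
      simpa using ((hasDerivAt_id s).smul_const h).const_add x
    rw [inner_gradient_left]
    exact h1.comp_hasDerivAt s h2
  have hint : v (x + h) - v x = ∫ s in Icc (0 : ℝ) 1, inner ℝ (gradient v (x + s • h)) h := by
    have := intervalIntegral.integral_eq_sub_of_hasDerivAt (a := 0) (b := 1) (fun s _ => hd s)
      ((hc.inner continuous_const).intervalIntegrable _ _)
    rw [integral_Icc_eq_integral_Ioc, ← intervalIntegral.integral_of_le zero_le_one, this]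
    simp
  have h1 : ‖v (x + h) - v x‖ₑ ≤ ∫⁻ s in Icc (0 : ℝ) 1, ‖h‖ₑ * ‖gradient v (x + s • h)‖ₑ := by
    rw [hint]
    refine (enorm_integral_le_lintegral_enorm _).trans (lintegral_mono fun s => ?_)
    rw [mul_comm, ← enorm_norm h, ← enorm_norm (gradient v _), ← enorm_mul, enorm_le_iff_norm_le]
    simpa using abs_real_inner_le_norm (gradient v (x + s • h)) h
  calc _ ≤ (∫⁻ s in Icc (0 : ℝ) 1, ‖h‖ₑ * ‖gradient v (x + s • h)‖ₑ) ^ 2 := by gcongr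
    _ ≤ ∫⁻ s in Icc (0 : ℝ) 1, (‖h‖ₑ * ‖gradient v (x + s • h)‖ₑ) ^ 2 :=
      sq_lintegral_le_of_isProbabilityMeasure (hc.enorm.measurable.const_mul _).aemeasurable
    _ = _ := by
      simp only [mul_pow]
      rw [lintegral_const_mul _ (hc.enorm.measurable.pow_const 2)]

theorem eLpNorm_translate_sub_le_of_contDiff {K K' : Set (Pt d)} (hK : MeasurableSet K)
    (hK' : MeasurableSet K') {h : Pt d} (hKK : ∀ x ∈ K, ∀ s ∈ Icc (0 : ℝ) 1, x + s • h ∈ K')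
    {v : Pt d → ℝ} (hv : ContDiff ℝ (⊤ : ℕ∞) v) :
    eLpNorm (fun x => v (x + h) - v x) 2 (volume.restrict K) ≤
      ‖h‖ₑ * eLpNorm (gradient v) 2 (volume.restrict K') := by
  rw [← ENNReal.pow_le_pow_left_iff two_ne_zero, mul_pow, eLpNorm_two_sq, eLpNorm_two_sq]
  have hc : Continuous fun p : Pt d × ℝ => ‖gradient v (p.1 + p.2 • h)‖ₑ ^ 2 :=
    (ENNReal.continuous_pow 2).comp
      ((continuous_gradient_of_contDiff hv).comp (by fun_prop)).enorm
  calc _ ≤ ∫⁻ x in K, ‖h‖ₑ ^ 2 * ∫⁻ s in Icc (0 : ℝ) 1, ‖gradient v (x + s • h)‖ₑ ^ 2 :=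
        lintegral_mono fun x => enorm_sub_sq_le_of_contDiff hv x h
    _ = ‖h‖ₑ ^ 2 * ∫⁻ x in K, ∫⁻ s in Icc (0 : ℝ) 1, ‖gradient v (x + s • h)‖ₑ ^ 2 :=
        lintegral_const_mul _ hc.measurable.lintegral_prod_right'
    _ = ‖h‖ₑ ^ 2 * ∫⁻ s in Icc (0 : ℝ) 1, ∫⁻ x in K, ‖gradient v (x + s • h)‖ₑ ^ 2 := by
        rw [lintegral_lintegral_swap hc.measurable.aemeasurable]
    _ ≤ ‖h‖ₑ ^ 2 * ∫⁻ s in Icc (0 : ℝ) 1, ∫⁻ x in K', ‖gradient v x‖ₑ ^ 2 := by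
        refine mul_le_mul' le_rfl (setLIntegral_mono' measurableSet_Icc fun s hs => ?_)
        exact lintegral_translate_le hK hK' (fun x hx => hKK x hx s hs)
          fun x => ‖gradient v x‖ₑ ^ 2
    _ = _ := by simp

theorem eLpNorm_translate_le {E : Type*} [NormedAddCommGroup E] {K K' : Set (Pt d)}
    (hK : MeasurableSet K) (hK' : MeasurableSet K') {h : Pt d} (hKK : ∀ x ∈ K, x + h ∈ K')
    (f : Pt d → E) :
    eLpNorm (fun x => f (x + h)) 2 (volume.restrict K) ≤ eLpNorm f 2 (volume.restrict K') := by
  rw [← ENNReal.pow_le_pow_left_iff two_ne_zero, eLpNorm_two_sq, eLpNorm_two_sq]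
  exact lintegral_translate_le hK hK' hKK fun x => ‖f x‖ₑ ^ 2

/-- The segments issuing from `K` sweep out a compact subset `K'` of `U`, on which `u` is
approximated by test functions; the smooth estimate passes to the limit. -/
theorem HG.eLpNorm_translate_sub_le_of_isCompact {U K : Set (Pt d)} (hU : IsOpen U)
    (hK : IsCompact K) {h : Pt d} (hKU : ∀ x ∈ K, ∀ s ∈ Icc (0 : ℝ) 1, x + s • h ∈ U)
    {u : Pt d → ℝ} {G : Pt d → Pt d} (hu : HG U u G) (hum : StronglyMeasurable u) :
    eLpNorm (fun x => u (x + h) - u x) 2 (volume.restrict K) ≤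
      ‖h‖ₑ * eLpNorm G 2 (volume.restrict U) := by
  set K' : Set (Pt d) := (fun p : Pt d × ℝ => p.1 + p.2 • h) '' (K ×ˢ Icc (0 : ℝ) 1) with hK'def
  have hK' : IsCompact K' := (hK.prod isCompact_Icc).image (by fun_prop)
  have hK'U : K' ⊆ U := by
    rintro _ ⟨⟨x, s⟩, ⟨hx, hs⟩, rfl⟩
    exact hKU x hx s hs
  have hKs : ∀ x ∈ K, ∀ s ∈ Icc (0 : ℝ) 1, x + s • h ∈ K' := fun x hx s hs =>
    ⟨(x, s), ⟨hx, hs⟩, rfl⟩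
  have hK0 : K ⊆ K' := fun x hx => by simpa using hKs x hx 0 (by simp)
  have hK1 : ∀ x ∈ K, x + h ∈ K' := fun x hx => by simpa using hKs x hx 1 (by simp)
  refine ENNReal.le_of_forall_pos_le_add fun ε hε _ => ?_
  -- The approximation error enters three times: in the translated function, in the function itself,
  -- and in the gradient with the factor `‖h‖ₑ`.
  set c : ℝ≥0∞ := 1 + 1 + ‖h‖ₑ with hc
  have hc0 : c ≠ 0 := by simp [hc]
  have hct : c ≠ ⊤ := by simp [hc]
  obtain ⟨v, hv, hd⟩ := hu.exists_test_approx hU hK' hK'U (ε := ε / c)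
    (ENNReal.div_pos (by simpa using hε.ne') hct)
  have hd1 : eLpNorm (u - v) 2 (volume.restrict K') ≤ ε / c := le_self_add.trans hd.le
  have hd2 : eLpNorm (G - gradient v) 2 (volume.restrict K') ≤ ε / c := le_add_self.trans hd.le
  have hvc := hv.1.continuous
  have m1 : AEStronglyMeasurable (fun x => (u - v) (x + h)) (volume.restrict K) :=
    ((hum.sub hvc.stronglyMeasurable).comp_measurable
      (measurable_id.add_const h)).aestronglyMeasurable
  have m2 : AEStronglyMeasurable (fun x => v (x + h) - v x) (volume.restrict K) :=
    ((hvc.comp (continuous_id.add continuous_const)).sub hvc).aestronglyMeasurable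
  have m3 : AEStronglyMeasurable (v - u) (volume.restrict K) :=
    (hvc.stronglyMeasurable.sub hum).aestronglyMeasurable
  have e : (fun x => u (x + h) - u x) =
      ((fun x => (u - v) (x + h)) + fun x => v (x + h) - v x) + (v - u) := by
    funext x; simp
  have b1 := (eLpNorm_translate_le hK.measurableSet hK'.measurableSet hK1 (u - v)).trans hd1
  have b2 := eLpNorm_translate_sub_le_of_contDiff hK.measurableSet hK'.measurableSet hKs hv.1
  have b3 : eLpNorm (v - u) 2 (volume.restrict K) ≤ ε / c := by
    rw [eLpNorm_sub_comm]
    exact (eLpNorm_mono_measure _ (Measure.restrict_mono_set _ hK0)).trans hd1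
  have b4 : eLpNorm (gradient v) 2 (volume.restrict K') ≤
      eLpNorm G 2 (volume.restrict U) + ε / c := by
    have hG := memLp_restrict_mono hK'U hu.2.1
    have e : gradient v = G - (G - gradient v) := by abel
    rw [e]
    refine (eLpNorm_sub_le hG.1 (hG.1.sub (hv.memLp_gradient (p := 2)).1) one_le_two).trans ?_
    exact add_le_add (eLpNorm_mono_measure _ (Measure.restrict_mono_set _ hK'U)) hd2
  rw [e]
  refine (eLpNorm_add_le (m1.add m2) m3 one_le_two).trans ?_
  refine (add_le_add (eLpNorm_add_le m1 m2 one_le_two) le_rfl).trans ?_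
  calc _ ≤ ε / c + ‖h‖ₑ * (eLpNorm G 2 (volume.restrict U) + ε / c) + ε / c := by
        gcongr
        exact b2.trans (by gcongr)
    _ = ‖h‖ₑ * eLpNorm G 2 (volume.restrict U) + c * (ε / c) := by rw [hc]; ring
    _ = _ := by rw [ENNReal.mul_div_cancel hc0 hct]

/-- An `H¹` function and its translate differ in `L²` by at most the length of the translation
times the norm of the gradient. -/
theorem HG.lintegral_translate_sub_le {U W : Set (Pt d)} (hU : IsOpen U)
    (hW : MeasurableSet W) {h : Pt d} (hWU : ∀ x ∈ W, ∀ s ∈ Icc (0 : ℝ) 1, x + s • h ∈ U)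
    {u : Pt d → ℝ} {G : Pt d → Pt d} (hu : HG U u G) (hum : StronglyMeasurable u) :
    ∫⁻ x in W, ‖u (x + h) - u x‖ₑ ^ 2 ≤ ‖h‖ₑ ^ 2 * ∫⁻ x in U, ‖G x‖ₑ ^ 2 := by
  have hm : StronglyMeasurable fun x => u (x + h) - u x :=
    (hum.comp_measurable (measurable_id.add_const h)).sub hum
  -- The squared difference is the density of a finite measure, so inner regularity reduces the
  -- estimate on `W` to its compact subsets.
  set ν := (volume.restrict W).withDensity fun x => ‖u (x + h) - u x‖ₑ ^ 2 with hν
  have hW0 : W ⊆ U := fun x hx => by simpa using hWU x hx 0 (by simp)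
  have hfin : ∫⁻ x in W, ‖u (x + h) - u x‖ₑ ^ 2 ≠ ⊤ := by
    rw [← eLpNorm_two_sq]
    refine ENNReal.pow_ne_top (ne_top_of_le_ne_top ?_ (eLpNorm_sub_le
      (hum.comp_measurable (measurable_id.add_const h)).aestronglyMeasurable
      hum.aestronglyMeasurable one_le_two))
    refine ENNReal.add_ne_top.2 ⟨ne_top_of_le_ne_top hu.1.eLpNorm_ne_top
      (eLpNorm_translate_le hW hU.measurableSet (fun x hx => ?_) u),
      (memLp_restrict_mono hW0 hu.1).eLpNorm_ne_top⟩
    simpa using hWU x hx 1 (by simp)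
  have hfm : IsFiniteMeasure ν := isFiniteMeasure_withDensity hfin
  have hνW : ν W = ∫⁻ x in W, ‖u (x + h) - u x‖ₑ ^ 2 := by
    rw [hν, withDensity_apply _ hW, Measure.restrict_restrict hW, inter_self]
  rw [← hνW, hW.measure_eq_iSup_isCompact_of_ne_top (measure_ne_top ν W)]
  refine iSup_le fun K => iSup_le fun hKW => iSup_le fun hK => ?_
  have := hu.eLpNorm_translate_sub_le_of_isCompact hU hK (fun x hx => hWU x (hKW hx)) hum
  rw [← ENNReal.pow_le_pow_left_iff two_ne_zero, mul_pow, eLpNorm_two_sq, eLpNorm_two_sq] at this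
  rwa [hν, withDensity_apply _ hK.measurableSet, Measure.restrict_restrict hK.measurableSet,
    inter_eq_self_of_subset_left hKW]

/-! ### Compactness of the embedding into `L²` -/

/-- The distance to the mean over a ball is an average of `u x - u y`; Jensen's inequality and the
substitution `y = x + h` give the right side, with `‖h‖ < 2 * δ` because both points lie in the
ball. -/
theorem lintegral_sub_average_le {x₀ : Pt d} {δ : ℝ} (hδ : 0 < δ) {Q : Set (Pt d)}
    (hQ : Q ⊆ Metric.ball x₀ δ) (hQm : MeasurableSet Q) {u : Pt d → ℝ}
    (hum : StronglyMeasurable u) (hu : IntegrableOn u (Metric.ball x₀ δ)) :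
    ∫⁻ x in Q, ‖u x - (volume.real (Metric.ball x₀ δ))⁻¹ * ∫ y in Metric.ball x₀ δ, u y‖ₑ ^ 2 ≤
      (volume (Metric.ball x₀ δ))⁻¹ *
        ∫⁻ h in Metric.ball (0 : Pt d) (2 * δ), ∫⁻ x in Q, ‖u (x + h) - u x‖ₑ ^ 2 := by
  set B := Metric.ball x₀ δ with hB
  have hB0 : volume B ≠ 0 := (Metric.measure_ball_pos volume x₀ hδ).ne'
  have hBt : volume B ≠ ⊤ := measure_ball_lt_top.ne
  set ν : Measure (Pt d) := (volume B)⁻¹ • volume.restrict B with hν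
  have hprob : IsProbabilityMeasure ν := ⟨by
    rw [hν]; simp [ENNReal.inv_mul_cancel hB0 hBt]⟩
  have hjm : Measurable fun p : Pt d × Pt d => ‖u (p.1 + p.2) - u p.1‖ₑ ^ 2 :=
    (((hum.comp_measurable (measurable_fst.add measurable_snd)).sub
      (hum.comp_measurable measurable_fst)).enorm).pow_const 2
  have huν : Integrable u ν := Integrable.smul_measure hu (ENNReal.inv_ne_top.2 hB0)
  have hpt : ∀ x ∈ Q, ‖u x - (volume.real B)⁻¹ * ∫ y in B, u y‖ₑ ^ 2 ≤
      (volume B)⁻¹ * ∫⁻ h in Metric.ball (0 : Pt d) (2 * δ), ‖u (x + h) - u x‖ₑ ^ 2 := by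
    intro x hx
    have e1 : u x - (volume.real B)⁻¹ * ∫ y in B, u y = ∫ y, (u x - u y) ∂ν := by
      rw [integral_sub (integrable_const _) huν, integral_const]
      simp [hν, integral_smul_measure, Measure.real, ENNReal.toReal_inv]
    rw [e1]
    have hmx : Measurable fun y => ‖u x - u y‖ₑ :=
      (stronglyMeasurable_const.sub hum).enorm
    calc _ ≤ (∫⁻ y, ‖u x - u y‖ₑ ∂ν) ^ 2 := by
          gcongr; exact enorm_integral_le_lintegral_enorm _
      _ ≤ ∫⁻ y, ‖u x - u y‖ₑ ^ 2 ∂ν :=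
          sq_lintegral_le_of_isProbabilityMeasure hmx.aemeasurable
      _ = (volume B)⁻¹ * ∫⁻ y in B, ‖u x - u y‖ₑ ^ 2 := by
          rw [hν, lintegral_smul_measure, smul_eq_mul]
      _ ≤ _ := by
          gcongr (volume B)⁻¹ * ?_
          rw [← lintegral_indicator Metric.isOpen_ball.measurableSet,
            ← lintegral_indicator Metric.isOpen_ball.measurableSet,
            ← lintegral_add_left_eq_self _ x]
          refine lintegral_mono fun h => ?_
          by_cases hh : x + h ∈ B
          · rw [hB] at hh
            have h1 : h ∈ Metric.ball (0 : Pt d) (2 * δ) := by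
              have a1 := hQ hx
              rw [hB, Metric.mem_ball] at a1
              rw [Metric.mem_ball] at hh
              rw [mem_ball_zero_iff]
              have : dist (x + h) x ≤ dist (x + h) x₀ + dist x₀ x := dist_triangle _ _ _
              rw [dist_comm x₀ x, dist_eq_norm, add_sub_cancel_left] at this
              linarith
            simp only [indicator_of_mem hh, indicator_of_mem h1]
            rw [← enorm_neg, neg_sub]
          · rw [indicator_of_notMem hh]
            exact zero_le
  calc _ ≤ ∫⁻ x in Q, (volume B)⁻¹ *
          ∫⁻ h in Metric.ball (0 : Pt d) (2 * δ), ‖u (x + h) - u x‖ₑ ^ 2 :=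
        setLIntegral_mono' hQm hpt
    _ = (volume B)⁻¹ * ∫⁻ x in Q,
          ∫⁻ h in Metric.ball (0 : Pt d) (2 * δ), ‖u (x + h) - u x‖ₑ ^ 2 :=
        lintegral_const_mul _ hjm.lintegral_prod_right'
    _ = _ := by rw [lintegral_lintegral_swap hjm.aemeasurable]

theorem HG.exists_stronglyMeasurable {U : Set (Pt d)} {u : Pt d → ℝ}
    {G : Pt d → Pt d} (h : HG U u G) :
    ∃ v, StronglyMeasurable v ∧ u =ᵐ[volume.restrict U] v ∧ HG U v G :=
  ⟨h.1.1.mk u, h.1.1.stronglyMeasurable_mk, h.1.1.ae_eq_mk,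
    h.congr h.1.1.ae_eq_mk EventuallyEq.rfl⟩

theorem IntegrableOn.of_memLp_ball {U : Set (Pt d)} {u : Pt d → ℝ}
    (hu : MemLp u 2 (volume.restrict U)) {x₀ : Pt d} {δ : ℝ} (h : Metric.ball x₀ δ ⊆ U) :
    IntegrableOn u (Metric.ball x₀ δ) := by
  have : IsFiniteMeasure (volume.restrict (Metric.ball x₀ δ)) :=
    ⟨by simpa using measure_ball_lt_top⟩
  exact (memLp_restrict_mono h hu).integrable one_le_two

theorem lintegral_enorm_sq_congr {E : Type*} [NormedAddCommGroup E] {O U : Set (Pt d)}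
    (hO : O ⊆ U) {u v : Pt d → E} (h : u =ᵐ[volume.restrict U] v) :
    ∫⁻ x in O, ‖u x‖ₑ ^ 2 = ∫⁻ x in O, ‖v x‖ₑ ^ 2 :=
  lintegral_congr_ae (by
    filter_upwards [ae_restrict_of_ae_restrict_of_subset hO h] with x hx
    rw [hx])

theorem add_enorm_sq_le {E : Type*} [NormedAddCommGroup E] (a b : E) :
    ‖a + b‖ₑ ^ 2 ≤ 2 * ‖a‖ₑ ^ 2 + 2 * ‖b‖ₑ ^ 2 := by
  have h : ‖a + b‖ ^ 2 ≤ 2 * ‖a‖ ^ 2 + 2 * ‖b‖ ^ 2 := by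
    have := norm_add_le a b
    nlinarith [sq_nonneg (‖a‖ - ‖b‖), norm_nonneg (a + b), norm_nonneg a, norm_nonneg b]
  rw [← ofReal_norm, ← ofReal_norm, ← ofReal_norm, ← ENNReal.ofReal_pow (norm_nonneg _),
    ← ENNReal.ofReal_pow (norm_nonneg _), ← ENNReal.ofReal_pow (norm_nonneg _)]
  have h2 : (2 : ℝ≥0∞) = ENNReal.ofReal 2 := by simp
  rw [h2, ← ENNReal.ofReal_mul zero_le_two, ← ENNReal.ofReal_mul zero_le_two,
    ← ENNReal.ofReal_add (by positivity) (by positivity)]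
  exact ENNReal.ofReal_le_ofReal h

/-- Up to a small multiple of the `H¹(U)` norm, the `L²(O)` norm is controlled by finitely many
linear functionals. -/
def CompactlyEmbedded (U O : Set (Pt d)) : Prop :=
  ∀ ε : ℝ, 0 < ε → ∃ (m : ℕ) (p : Fin m → Pt d → ℝ),
    (∀ i, MemLp (p i) 2 (volume.restrict U)) ∧ ∀ u G, HG U u G →
      ∫⁻ x in O, ‖u x‖ₑ ^ 2 ≤
        ENNReal.ofReal ε * ((∫⁻ x in U, ‖u x‖ₑ ^ 2) + ∫⁻ x in U, ‖G x‖ₑ ^ 2) +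
          ∑ i, ‖∫ x in U, p i x * u x‖ₑ ^ 2

theorem CompactlyEmbedded.mono {U O O' : Set (Pt d)} (h : CompactlyEmbedded U O) (hO : O' ⊆ O) :
    CompactlyEmbedded U O' := fun ε hε => by
  obtain ⟨m, p, hp, h1⟩ := h ε hε
  exact ⟨m, p, hp, fun u G hu => (lintegral_mono_set hO).trans (h1 u G hu)⟩

theorem CompactlyEmbedded.union {U O O' : Set (Pt d)} (h : CompactlyEmbedded U O)
    (h' : CompactlyEmbedded U O') : CompactlyEmbedded U (O ∪ O') := fun ε hε => by
  obtain ⟨m, p, hp, h1⟩ := h (ε / 2) (by positivity)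
  obtain ⟨m', p', hp', h1'⟩ := h' (ε / 2) (by positivity)
  refine ⟨m + m', Fin.append p p', fun i => ?_, fun u G hu => ?_⟩
  · refine Fin.addCases (fun i => ?_) (fun i => ?_) i
    · rw [Fin.append_left]; exact hp i
    · rw [Fin.append_right]; exact hp' i
  · rw [Fin.sum_univ_add]
    simp only [Fin.append_left, Fin.append_right]
    refine (lintegral_union_le _ _ _).trans ((add_le_add (h1 u G hu) (h1' u G hu)).trans ?_)
    have : ENNReal.ofReal ε = ENNReal.ofReal (ε / 2) + ENNReal.ofReal (ε / 2) := by
      rw [← ENNReal.ofReal_add (by positivity) (by positivity), add_halves]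
    rw [this, add_mul]
    exact le_of_eq (by ring)

/-- Cover `K` by finitely many small balls and cut it into disjoint pieces, one in each ball. On
each piece `u` differs from its mean over the ball by translation differences, which are of the
order of the radius times the gradient. The means are the finitely many functionals. -/
theorem compactlyEmbedded_of_isCompact {U K : Set (Pt d)} (hU : IsOpen U) (hK : IsCompact K)
    (hKU : K ⊆ U) : CompactlyEmbedded U K := by
  intro ε hε
  obtain ⟨r, hr, hrU⟩ := hK.exists_cthickening_subset_open hU hKU
  -- The outer `2` comes from splitting `u` into its mean and the rest, `2 ^ d` is the volume ratio
  -- of balls of radii `2 * δ` and `δ`, and `(2 * δ) ^ 2` is the squared bound on the shifts. The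
  -- condition `2 * δ ≤ r` keeps all shifted points in `U`.
  obtain ⟨δ, hδ, hδr, hδε⟩ : ∃ δ : ℝ, 0 < δ ∧ 2 * δ ≤ r ∧
      2 * (2 ^ d * (2 * δ) ^ 2) ≤ ε := by
    have ht : Tendsto (fun δ : ℝ => 2 * (2 ^ d * (2 * δ) ^ 2)) (𝓝[>] 0)
        (𝓝 (2 * (2 ^ d * (2 * 0) ^ 2))) :=
      (Continuous.tendsto (by fun_prop) 0).mono_left nhdsWithin_le_nhds
    have ht2 : Tendsto (fun δ : ℝ => 2 * δ) (𝓝[>] 0) (𝓝 (2 * 0)) :=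
      (Continuous.tendsto (by fun_prop) 0).mono_left nhdsWithin_le_nhds
    obtain ⟨δ, h1, h2, h3⟩ := ((ht.eventually (gt_mem_nhds (by simpa using hε))).and
      ((ht2.eventually (gt_mem_nhds (by simpa using hr))).and self_mem_nhdsWithin)).exists
    exact ⟨δ, h3, h2.le, h1.le⟩
  obtain ⟨t, htK, htf, htc⟩ := hK.elim_finite_subcover_image (b := K)
    (c := fun x => Metric.ball x δ) (fun x _ => Metric.isOpen_ball)
    (fun x hx => mem_iUnion₂.2 ⟨x, hx, Metric.mem_ball_self hδ⟩)
  obtain ⟨m, e, he⟩ : ∃ (m : ℕ) (e : Fin m → Pt d), range e = t := by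
    have := htf.fintype
    refine ⟨Fintype.card t, fun i => ((Fintype.equivFin t).symm i : Pt d), ?_⟩
    rw [show (fun i => ((Fintype.equivFin t).symm i : Pt d)) =
      Subtype.val ∘ (Fintype.equivFin t).symm from rfl, range_comp,
      (Fintype.equivFin t).symm.surjective.range_eq]
    simp
  let B : Fin m → Set (Pt d) := fun i => Metric.ball (e i) δ
  let Q : Fin m → Set (Pt d) := fun i => K ∩ disjointed B i
  have hBm : ∀ i, MeasurableSet (B i) := fun i => Metric.isOpen_ball.measurableSet
  have hQm : ∀ i, MeasurableSet (Q i) := fun i =>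
    hK.measurableSet.inter (disjointedRec (fun _ _ ht => ht.diff (hBm _)) (hBm i))
  have hQB : ∀ i, Q i ⊆ B i := fun i => inter_subset_right.trans (disjointed_le B i)
  have hQd : Pairwise (Function.onFun Disjoint Q) := fun i j hij =>
    (disjoint_disjointed B hij).mono inter_subset_right inter_subset_right
  have hQK : ⋃ i, Q i = K := by
    rw [← inter_iUnion, iUnion_disjointed]
    refine inter_eq_left.2 fun x hx => ?_
    obtain ⟨y, hy, hxy⟩ := mem_iUnion₂.1 (htc hx)
    rw [← he] at hy
    obtain ⟨i, rfl⟩ := hy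
    exact mem_iUnion.2 ⟨i, hxy⟩
  have heK : ∀ i, e i ∈ K := fun i => htK (by rw [← he]; exact mem_range_self i)
  have hball : ∀ x ∈ K, ∀ y, dist y x ≤ r → y ∈ U := fun x hx y hy =>
    hrU (Metric.mem_cthickening_of_dist_le y x r K hx hy)
  have hBU : ∀ i, B i ⊆ U := fun i y hy =>
    hball _ (heK i) y ((Metric.mem_ball.1 hy).le.trans (by linarith))
  let M : Fin m → (Pt d → ℝ) → ℝ := fun i u => (volume.real (B i))⁻¹ * ∫ y in B i, u y
  -- Scaled so that the squared functional is `2 * volume (Q i)` times the squared mean.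
  let c : Fin m → ℝ := fun i => √(2 * volume.real (Q i)) * (volume.real (B i))⁻¹
  have hQt : ∀ i, volume (Q i) ≠ ⊤ := fun i =>
    ((measure_mono (hQB i)).trans_lt measure_ball_lt_top).ne
  refine ⟨m, fun i => (B i).indicator fun _ => c i, fun i => ?_, ?_⟩
  · exact memLp_indicator_const 2 (hBm i) _ (Or.inr
      ((Measure.restrict_apply_le _ _).trans_lt measure_ball_lt_top).ne)
  suffices H : ∀ u G, HG U u G → StronglyMeasurable u → ∫⁻ x in K, ‖u x‖ₑ ^ 2 ≤
      ENNReal.ofReal ε * ((∫⁻ x in U, ‖u x‖ₑ ^ 2) + ∫⁻ x in U, ‖G x‖ₑ ^ 2) +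
        ∑ i, ‖∫ x in U, (B i).indicator (fun _ => c i) x * u x‖ₑ ^ 2 by
    intro u G hu
    obtain ⟨v, hvm, huv, hv⟩ := hu.exists_stronglyMeasurable
    have := H v G hv hvm
    rw [← lintegral_enorm_sq_congr hKU huv, ← lintegral_enorm_sq_congr subset_rfl huv] at this
    refine this.trans (le_of_eq ?_)
    congr 1
    refine Finset.sum_congr rfl fun i _ => ?_
    congr 2
    exact integral_congr_ae (by filter_upwards [huv] with x hx; rw [hx])
  intro u G hu hum
  have hp : ∀ i, ‖∫ x in U, (B i).indicator (fun _ => c i) x * u x‖ₑ ^ 2 =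
      2 * volume (Q i) * ‖M i u‖ₑ ^ 2 := fun i => by
    have e1 : (fun x => (B i).indicator (fun _ => c i) x * u x) =
        (B i).indicator fun x => c i * u x := by
      funext x; by_cases hx : x ∈ B i <;> simp [hx]
    rw [e1, integral_indicator (hBm i), Measure.restrict_restrict (hBm i),
      inter_eq_self_of_subset_left (hBU i), integral_const_mul]
    have e2 : c i * ∫ x in B i, u x = √(2 * volume.real (Q i)) * M i u := by
      simp only [c, M]; ring
    rw [e2, enorm_mul, mul_pow]
    congr 1
    rw [← ofReal_norm, ← ENNReal.ofReal_pow (norm_nonneg _), Real.norm_eq_abs, sq_abs,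
      Real.sq_sqrt (by positivity), ENNReal.ofReal_mul zero_le_two, Measure.real,
      ENNReal.ofReal_toReal (hQt i)]
    simp
  have hBv : ∀ i, volume (B i) = volume (Metric.ball (0 : Pt d) δ) := fun i =>
    Measure.addHaar_ball_center volume _ _
  have hv0 : volume (Metric.ball (0 : Pt d) δ) ≠ 0 := (Metric.measure_ball_pos volume 0 hδ).ne'
  have hvt : volume (Metric.ball (0 : Pt d) δ) ≠ ⊤ := measure_ball_lt_top.ne
  have hjm : Measurable fun p : Pt d × Pt d => ‖u (p.1 + p.2) - u p.1‖ₑ ^ 2 :=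
    (((hum.comp_measurable (measurable_fst.add measurable_snd)).sub
      (hum.comp_measurable measurable_fst)).enorm).pow_const 2
  have hsum : ∑ i, ∫⁻ x in Q i, ‖u x - M i u‖ₑ ^ 2 ≤
      ENNReal.ofReal (2 ^ d * (2 * δ) ^ 2) * ∫⁻ x in U, ‖G x‖ₑ ^ 2 := by
    calc _ ≤ ∑ i, (volume (Metric.ball (0 : Pt d) δ))⁻¹ *
          ∫⁻ h in Metric.ball (0 : Pt d) (2 * δ), ∫⁻ x in Q i, ‖u (x + h) - u x‖ₑ ^ 2 := by
          refine Finset.sum_le_sum fun i _ => ?_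
          rw [← hBv i]
          exact lintegral_sub_average_le hδ (hQB i) (hQm i) hum
            (IntegrableOn.of_memLp_ball hu.1 (hBU i))
      _ = (volume (Metric.ball (0 : Pt d) δ))⁻¹ *
          ∫⁻ h in Metric.ball (0 : Pt d) (2 * δ), ∫⁻ x in K, ‖u (x + h) - u x‖ₑ ^ 2 := by
          rw [← Finset.mul_sum, ← lintegral_finsetSum]
          · congr 1
            refine lintegral_congr fun h => ?_
            rw [← hQK, lintegral_iUnion hQm hQd, tsum_fintype]
          · intro i _
            exact hjm.lintegral_prod_left'
      _ ≤ (volume (Metric.ball (0 : Pt d) δ))⁻¹ *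
          ∫⁻ _ in Metric.ball (0 : Pt d) (2 * δ),
            ENNReal.ofReal ((2 * δ) ^ 2) * ∫⁻ x in U, ‖G x‖ₑ ^ 2 := by
          refine mul_le_mul' le_rfl (setLIntegral_mono' Metric.isOpen_ball.measurableSet
            fun h hh => ?_)
          rw [mem_ball_zero_iff] at hh
          refine (hu.lintegral_translate_sub_le hU hK.measurableSet (fun x hx s hs => ?_)
            hum).trans ?_
          · refine hball x hx _ ?_
            rw [dist_eq_norm, add_sub_cancel_left, norm_smul, Real.norm_eq_abs,
              abs_of_nonneg hs.1]
            nlinarith [hs.1, hs.2, norm_nonneg h]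
          · gcongr
            rw [← ofReal_norm, ← ENNReal.ofReal_pow (norm_nonneg _)]
            exact ENNReal.ofReal_le_ofReal (by gcongr)
      _ = _ := by
          rw [setLIntegral_const, Measure.addHaar_ball_mul_of_pos volume 0 two_pos δ,
            finrank_euclideanSpace_fin, ENNReal.ofReal_mul (by positivity)]
          rw [show ∀ a b c d e : ℝ≥0∞, a * (b * c * (d * e)) = (a * e) * (d * b * c) from
            fun a b c d e => by ring, ENNReal.inv_mul_cancel hv0 hvt, one_mul]
  calc ∫⁻ x in K, ‖u x‖ₑ ^ 2 = ∑ i, ∫⁻ x in Q i, ‖u x‖ₑ ^ 2 := by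
        conv_lhs => rw [← hQK]
        rw [lintegral_iUnion hQm hQd, tsum_fintype]
    _ ≤ ∑ i, (2 * (∫⁻ x in Q i, ‖u x - M i u‖ₑ ^ 2) + 2 * volume (Q i) * ‖M i u‖ₑ ^ 2) := by
        refine Finset.sum_le_sum fun i _ => ?_
        have hm1 : Measurable fun x => ‖u x - M i u‖ₑ ^ 2 :=
          (hum.sub stronglyMeasurable_const).enorm.pow_const 2
        calc _ ≤ ∫⁻ x in Q i, (2 * ‖u x - M i u‖ₑ ^ 2 + 2 * ‖M i u‖ₑ ^ 2) :=
              lintegral_mono fun x => by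
                simpa using add_enorm_sq_le (u x - M i u) (M i u)
          _ = _ := by
              rw [lintegral_add_left (hm1.const_mul 2), lintegral_const_mul _ hm1,
                setLIntegral_const]
              ring
    _ = 2 * (∑ i, ∫⁻ x in Q i, ‖u x - M i u‖ₑ ^ 2) +
          ∑ i, ‖∫ x in U, (B i).indicator (fun _ => c i) x * u x‖ₑ ^ 2 := by
        rw [Finset.sum_add_distrib, Finset.mul_sum]
        simp only [hp]
    _ ≤ _ := by
        refine add_le_add ?_ le_rfl
        calc _ ≤ 2 * (ENNReal.ofReal (2 ^ d * (2 * δ) ^ 2) * ∫⁻ x in U, ‖G x‖ₑ ^ 2) :=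
              mul_le_mul' le_rfl hsum
          _ = ENNReal.ofReal (2 * (2 ^ d * (2 * δ) ^ 2)) * ∫⁻ x in U, ‖G x‖ₑ ^ 2 := by
              rw [ENNReal.ofReal_mul zero_le_two]; simp [mul_assoc]
          _ ≤ _ := by
              refine mul_le_mul' (ENNReal.ofReal_le_ofReal hδε) le_add_self

/-- A small shift along `e` moves the part of `closure U` in the closed ball onto a compact subset
of `U`, where the interior result applies. Undoing the shift costs only `t * ‖e‖` times the gradient
norm, since the connecting segments stay in `U`. -/
theorem compactlyEmbedded_of_segment {U : Set (Pt d)} (hU : IsOpen U) {x₀ : Pt d} {r : ℝ}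
    {e : Pt d} (he : ∀ y ∈ closure U ∩ Metric.closedBall x₀ r, ∀ t : ℝ, 0 < t → t < 1 →
      y + t • e ∈ U) : CompactlyEmbedded U (U ∩ Metric.ball x₀ r) := by
  intro ε hε
  obtain ⟨t, ht0, ht1, htε⟩ : ∃ t : ℝ, 0 < t ∧ t < 1 ∧ 2 * (t * ‖e‖) ^ 2 ≤ ε / 2 := by
    have ht : Tendsto (fun t : ℝ => 2 * (t * ‖e‖) ^ 2) (𝓝[>] 0) (𝓝 (2 * (0 * ‖e‖) ^ 2)) :=
      (Continuous.tendsto (by fun_prop) 0).mono_left nhdsWithin_le_nhds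
    have ht2 : Tendsto (fun t : ℝ => t) (𝓝[>] 0) (𝓝 0) :=
      nhdsWithin_le_nhds
    obtain ⟨t, h1, h2, h3⟩ := ((ht.eventually (gt_mem_nhds
      (show 2 * (0 * ‖e‖) ^ 2 < ε / 2 by simpa using hε))).and
      ((ht2.eventually (gt_mem_nhds one_pos)).and self_mem_nhdsWithin)).exists
    exact ⟨t, h3, h2, h1.le⟩
  set h : Pt d := t • e with hh
  set C : Set (Pt d) := closure U ∩ Metric.closedBall x₀ r with hC
  have hCc : IsCompact C := (isCompact_closedBall x₀ r).inter_left isClosed_closure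
  set K : Set (Pt d) := (fun y => y + h) '' C with hK
  have hKc : IsCompact K := hCc.image (by fun_prop)
  have hKU : K ⊆ U := by
    rintro _ ⟨y, hy, rfl⟩
    exact he y hy t ht0 ht1
  -- The splitting into shifted function and difference doubles `ε / 4` to `ε / 2`; the other half
  -- of `ε` pays for the shift. The same doubling explains the factor `√2` in the functionals.
  obtain ⟨m, p, hp, hpK⟩ := compactlyEmbedded_of_isCompact hU hKc hKU (ε / 4) (by positivity)
  have hOm : MeasurableSet (U ∩ Metric.ball x₀ r) :=
    (hU.inter Metric.isOpen_ball).measurableSet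
  refine ⟨m, fun i => √2 • p i, fun i => (hp i).const_smul _, fun u G hu => ?_⟩
  obtain ⟨v, hvm, huv, hv⟩ := hu.exists_stronglyMeasurable
  have hvK := hpK u G hu
  rw [lintegral_enorm_sq_congr hKU huv] at hvK
  have hOC : ∀ x ∈ U ∩ Metric.ball x₀ r, x ∈ C := fun x hx =>
    ⟨subset_closure hx.1, Metric.ball_subset_closedBall hx.2⟩
  have h1 : ∫⁻ x in U ∩ Metric.ball x₀ r, ‖v (x + h)‖ₑ ^ 2 ≤ ∫⁻ x in K, ‖v x‖ₑ ^ 2 :=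
    lintegral_translate_le hOm hKc.measurableSet (fun x hx => ⟨x, hOC x hx, rfl⟩)
      fun x => ‖v x‖ₑ ^ 2
  have h2 : ∫⁻ x in U ∩ Metric.ball x₀ r, ‖v (x + h) - v x‖ₑ ^ 2 ≤
      ‖h‖ₑ ^ 2 * ∫⁻ x in U, ‖G x‖ₑ ^ 2 := by
    refine hv.lintegral_translate_sub_le hU hOm (fun x hx s hs => ?_) hvm
    rcases hs.1.eq_or_lt with rfl | hs0
    · simpa using hx.1
    · rw [hh, smul_smul]
      exact he x (hOC x hx) _ (by positivity) (by nlinarith [hs.2])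
  have hm1 : Measurable fun x => ‖v (x + h)‖ₑ ^ 2 :=
    (hvm.comp_measurable (measurable_id.add_const h)).enorm.pow_const 2
  have hm2 : Measurable fun x => ‖v (x + h) - v x‖ₑ ^ 2 :=
    ((hvm.comp_measurable (measurable_id.add_const h)).sub hvm).enorm.pow_const 2
  have hhε : 2 * ‖h‖ₑ ^ 2 ≤ ENNReal.ofReal (ε / 2) := by
    rw [← ofReal_norm, ← ENNReal.ofReal_pow (norm_nonneg _), hh, norm_smul, Real.norm_eq_abs,
      abs_of_pos ht0]
    calc 2 * ENNReal.ofReal ((t * ‖e‖) ^ 2) = ENNReal.ofReal (2 * (t * ‖e‖) ^ 2) := by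
          rw [ENNReal.ofReal_mul zero_le_two]; simp
      _ ≤ _ := ENNReal.ofReal_le_ofReal htε
  have hε2 : 2 * ENNReal.ofReal (ε / 4) = ENNReal.ofReal (ε / 2) := by
    rw [show ε / 2 = 2 * (ε / 4) by ring, ENNReal.ofReal_mul zero_le_two]; simp
  have hεε : ENNReal.ofReal ε = ENNReal.ofReal (ε / 2) + ENNReal.ofReal (ε / 2) := by
    rw [← ENNReal.ofReal_add (by positivity) (by positivity), add_halves]
  have hpi : ∀ i, ‖∫ x in U, (√2 • p i) x * u x‖ₑ ^ 2 = 2 * ‖∫ x in U, p i x * u x‖ₑ ^ 2 := by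
    intro i
    simp only [Pi.smul_apply, smul_eq_mul, mul_assoc, integral_const_mul]
    rw [enorm_mul, mul_pow]
    congr 1
    rw [← ofReal_norm, ← ENNReal.ofReal_pow (norm_nonneg _), Real.norm_eq_abs, sq_abs,
      Real.sq_sqrt zero_le_two]
    simp
  rw [lintegral_enorm_sq_congr inter_subset_left huv]
  simp only [hpi]
  set NU := ∫⁻ x in U, ‖u x‖ₑ ^ 2
  set NG := ∫⁻ x in U, ‖G x‖ₑ ^ 2
  calc ∫⁻ x in U ∩ Metric.ball x₀ r, ‖v x‖ₑ ^ 2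
      ≤ ∫⁻ x in U ∩ Metric.ball x₀ r, (2 * ‖v (x + h)‖ₑ ^ 2 + 2 * ‖v (x + h) - v x‖ₑ ^ 2) := by
        refine lintegral_mono fun x => ?_
        have := add_enorm_sq_le (v (x + h)) (-(v (x + h) - v x))
        rwa [enorm_neg, show v (x + h) + -(v (x + h) - v x) = v x by ring] at this
    _ = 2 * (∫⁻ x in U ∩ Metric.ball x₀ r, ‖v (x + h)‖ₑ ^ 2) +
        2 * ∫⁻ x in U ∩ Metric.ball x₀ r, ‖v (x + h) - v x‖ₑ ^ 2 := by
        rw [lintegral_add_left (hm1.const_mul 2), lintegral_const_mul _ hm1,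
          lintegral_const_mul _ hm2]
    _ ≤ 2 * (ENNReal.ofReal (ε / 4) * (NU + NG) + ∑ i, ‖∫ x in U, p i x * u x‖ₑ ^ 2) +
        2 * (‖h‖ₑ ^ 2 * NG) :=
        add_le_add (mul_le_mul' le_rfl (h1.trans hvK)) (mul_le_mul' le_rfl h2)
    _ = ENNReal.ofReal (ε / 2) * (NU + NG) + 2 * ‖h‖ₑ ^ 2 * NG +
        ∑ i, 2 * ‖∫ x in U, p i x * u x‖ₑ ^ 2 := by
        rw [← hε2, ← Finset.mul_sum]; ring
    _ ≤ ENNReal.ofReal (ε / 2) * (NU + NG) + ENNReal.ofReal (ε / 2) * (NU + NG) +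
        ∑ i, 2 * ‖∫ x in U, p i x * u x‖ₑ ^ 2 := by
        refine add_le_add (add_le_add le_rfl (mul_le_mul' hhε le_add_self)) le_rfl
    _ = _ := by rw [hεε]; ring

/-- Rellich's theorem for bounded domains with the segment property. -/
theorem SegmentProperty.compactlyEmbedded {U : Set (Pt d)} (hU : IsOpen U)
    (hb : Bornology.IsBounded U) (hs : SegmentProperty U) : CompactlyEmbedded U U := by
  have hc : IsCompact (closure U) := hb.isCompact_closure
  have key : CompactlyEmbedded U (closure U ∩ U) := by
    -- The property of `s ∩ U` passes to subsets and finite unions, so by compactness of the closure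
    -- it need only hold near each point: a closed ball inside `U`, or the segment case at the
    -- frontier.
    refine hc.induction_on (p := fun s => CompactlyEmbedded U (s ∩ U)) ?_ ?_ ?_ ?_
    · exact fun ε hε => ⟨0, fun i => i.elim0, fun i => i.elim0, fun u G _ => by simp⟩
    · exact fun s t hst h => h.mono (inter_subset_inter_left U hst)
    · intro s t h h'
      rw [union_inter_distrib_right]
      exact h.union h'
    · intro x hx
      by_cases hxU : x ∈ U
      · obtain ⟨r, hr, hrU⟩ := Metric.nhds_basis_closedBall.mem_iff.1 (hU.mem_nhds hxU)
        exact ⟨Metric.closedBall x r, mem_nhdsWithin_of_mem_nhds (Metric.closedBall_mem_nhds x hr),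
          (compactlyEmbedded_of_isCompact hU (isCompact_closedBall x r) hrU).mono
            inter_subset_left⟩
      · obtain ⟨V, hV, e, he⟩ := hs x ⟨hx, by rwa [hU.interior_eq]⟩
        obtain ⟨r, hr, hrV⟩ := Metric.nhds_basis_closedBall.mem_iff.1 hV
        refine ⟨Metric.ball x r, mem_nhdsWithin_of_mem_nhds (Metric.ball_mem_nhds x hr), ?_⟩
        rw [inter_comm]
        exact compactlyEmbedded_of_segment hU fun y hy => he y ⟨hy.1, hrV hy.2⟩
  rwa [inter_eq_self_of_subset_right subset_closure] at key

theorem lintegral_enorm_sq_sub_le {E : Type*} [NormedAddCommGroup E] {U : Set (Pt d)}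
    {u v : Pt d → E} (hu : AEStronglyMeasurable u (volume.restrict U)) :
    ∫⁻ x in U, ‖u x - v x‖ₑ ^ 2 ≤
      2 * (∫⁻ x in U, ‖u x‖ₑ ^ 2) + 2 * ∫⁻ x in U, ‖v x‖ₑ ^ 2 := by
  calc _ ≤ ∫⁻ x in U, (2 * ‖u x‖ₑ ^ 2 + 2 * ‖v x‖ₑ ^ 2) := lintegral_mono fun x => by
        have := add_enorm_sq_le (u x) (-v x)
        rwa [enorm_neg, ← sub_eq_add_neg] at this
    _ = _ := by
        rw [lintegral_add_left' ((hu.enorm.pow_const 2).const_mul 2),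
          lintegral_const_mul' _ _ (by simp), lintegral_const_mul' _ _ (by simp)]

/-- Collect the functionals for all tolerances `1 / (k + 1)`. Their values lie in a countable
product of compact intervals, so along a subsequence they all converge; the defining estimate
applied to differences then gives a Cauchy sequence in `L²`. -/
theorem CompactlyEmbedded.exists_subseq {U : Set (Pt d)} (hU : CompactlyEmbedded U U)
    {u : ℕ → Pt d → ℝ} {G : ℕ → Pt d → Pt d} (hu : ∀ n, HG U (u n) (G n)) {B : ℝ}
    (hB : ∀ n, (∫⁻ x in U, ‖u n x‖ₑ ^ 2) + ∫⁻ x in U, ‖G n x‖ₑ ^ 2 ≤ ENNReal.ofReal B) :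
    ∃ φ : ℕ → ℕ, StrictMono φ ∧ ∀ ε : ℝ≥0∞, 0 < ε → ∃ N, ∀ i ≥ N, ∀ j ≥ N,
      ∫⁻ x in U, ‖u (φ i) x - u (φ j) x‖ₑ ^ 2 ≤ ε := by
  wlog hB0 : 0 < B generalizing B
  · exact this (B := 1) (fun n => (hB n).trans (ENNReal.ofReal_le_ofReal (by linarith))) one_pos
  choose m p hp hpu using fun k : ℕ => hU (1 / ((k : ℝ) + 1)) (by positivity)
  let y : ℕ → (Σ k, Fin (m k)) → ℝ := fun n i => ∫ x in U, p i.1 i.2 x * u n x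
  let C : (Σ k, Fin (m k)) → ℝ := fun i =>
    (eLpNorm (p i.1 i.2) 2 (volume.restrict U)).toReal * √B
  have hy : ∀ n, y n ∈ Set.pi univ fun i => Icc (-C i) (C i) := fun n i _ => by
    have h1 := abs_integral_mul_le (hp i.1 i.2) (hu n).1
    refine abs_le.1 (h1.trans ?_)
    refine mul_le_mul_of_nonneg_left ?_ ENNReal.toReal_nonneg
    refine Real.le_sqrt_of_sq_le ?_
    rw [← ENNReal.toReal_pow, eLpNorm_two_sq]
    exact ENNReal.toReal_le_of_le_ofReal hB0.le (le_self_add.trans (hB n))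
  obtain ⟨a, -, φ, hφ, hlim⟩ := (isCompact_univ_pi fun i =>
    isCompact_Icc (a := -C i) (b := C i)).tendsto_subseq hy
  refine ⟨φ, hφ, fun ε hε => ?_⟩
  rcases eq_or_ne ε ⊤ with rfl | hεt
  · exact ⟨0, fun _ _ _ _ => le_top⟩
  have hε0 := ENNReal.toReal_pos hε.ne' hεt
  set η := ε.toReal with hη
  -- Differences have squared `H¹` norm at most `4 * B`; this `k` makes tolerance times `4 * B` at
  -- most half of the target.
  obtain ⟨k, hk⟩ := exists_nat_gt (8 * B / η)
  have hkη : 1 / ((k : ℝ) + 1) * (4 * B) ≤ η / 2 := by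
    rw [div_lt_iff₀ hε0] at hk
    rw [div_mul_eq_mul_div, one_mul, div_le_iff₀ (by positivity)]
    nlinarith
  have hsum : Tendsto (fun q : ℕ × ℕ => ∑ i, ‖y (φ q.1) ⟨k, i⟩ - y (φ q.2) ⟨k, i⟩‖ₑ ^ 2)
      (atTop ×ˢ atTop) (𝓝 0) := by
    have h0 : (0 : ℝ≥0∞) = ∑ i : Fin (m k), ‖a ⟨k, i⟩ - a ⟨k, i⟩‖ₑ ^ 2 := by simp
    rw [h0]
    refine tendsto_finsetSum _ fun i _ => ?_
    have hi : Tendsto (fun n => y (φ n) ⟨k, i⟩) atTop (𝓝 (a ⟨k, i⟩)) :=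
      ((continuous_apply (⟨k, i⟩ : Σ k, Fin (m k))).tendsto a).comp hlim
    have h2 := (hi.comp (tendsto_fst (f := atTop) (g := (atTop : Filter ℕ)))).sub
      (hi.comp (tendsto_snd (f := (atTop : Filter ℕ)) (g := atTop)))
    exact ((ENNReal.continuous_pow 2).tendsto _).comp ((continuous_enorm.tendsto _).comp h2)
  have hev := hsum.eventually (gt_mem_nhds (show (0 : ℝ≥0∞) < ENNReal.ofReal (η / 2) by
    simpa using hε0))
  rw [prod_atTop_atTop_eq, eventually_atTop] at hev
  obtain ⟨⟨N₁, N₂⟩, hN⟩ := hev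
  refine ⟨max N₁ N₂, fun i hi j hj => ?_⟩
  have h1 := (hN (i, j) ⟨(le_max_left _ _).trans hi, (le_max_right _ _).trans hj⟩).le
  have h2 := hpu k _ _ ((hu (φ i)).sub (hu (φ j)))
  have h3 : ∀ l, ∫ x in U, p k l x * (u (φ i) - u (φ j)) x = y (φ i) ⟨k, l⟩ - y (φ j) ⟨k, l⟩ := by
    intro l
    simp only [y]
    rw [← integral_sub (integrable_mul_of_memLp_two (hp k l) (hu _).1)
      (integrable_mul_of_memLp_two (hp k l) (hu _).1)]
    simp [mul_sub]
  simp only [h3] at h2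
  refine h2.trans ?_
  have h4 : (∫⁻ x in U, ‖(u (φ i) - u (φ j)) x‖ₑ ^ 2) +
      ∫⁻ x in U, ‖(G (φ i) - G (φ j)) x‖ₑ ^ 2 ≤ ENNReal.ofReal (4 * B) := by
    calc _ ≤ (2 * (∫⁻ x in U, ‖u (φ i) x‖ₑ ^ 2) + 2 * ∫⁻ x in U, ‖u (φ j) x‖ₑ ^ 2) +
          (2 * (∫⁻ x in U, ‖G (φ i) x‖ₑ ^ 2) + 2 * ∫⁻ x in U, ‖G (φ j) x‖ₑ ^ 2) :=
          add_le_add (lintegral_enorm_sq_sub_le (hu _).1.1)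
            (lintegral_enorm_sq_sub_le (hu _).2.1.1)
      _ = 2 * ((∫⁻ x in U, ‖u (φ i) x‖ₑ ^ 2) + ∫⁻ x in U, ‖G (φ i) x‖ₑ ^ 2) +
          2 * ((∫⁻ x in U, ‖u (φ j) x‖ₑ ^ 2) + ∫⁻ x in U, ‖G (φ j) x‖ₑ ^ 2) := by ring
      _ ≤ 2 * ENNReal.ofReal B + 2 * ENNReal.ofReal B :=
          add_le_add (mul_le_mul' le_rfl (hB _)) (mul_le_mul' le_rfl (hB _))
      _ = _ := by
          rw [ENNReal.ofReal_mul (by norm_num)]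
          rw [show ENNReal.ofReal 4 = 4 by simp]
          ring
  calc _ ≤ ENNReal.ofReal (1 / ((k : ℝ) + 1)) * ENNReal.ofReal (4 * B) +
        ENNReal.ofReal (η / 2) := add_le_add (mul_le_mul' le_rfl h4) h1
    _ ≤ ENNReal.ofReal (η / 2) + ENNReal.ofReal (η / 2) := by
        rw [← ENNReal.ofReal_mul (by positivity)]
        exact add_le_add (ENNReal.ofReal_le_ofReal hkη) le_rfl
    _ = ε := by
        rw [← ENNReal.ofReal_add (by positivity) (by positivity), add_halves, hη,
          ENNReal.ofReal_toReal hεt]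

/-! ### Functions with vanishing gradient -/

/-- Without gradient there are no translation differences, so the function agrees with its mean over
the ball. -/
theorem ae_eq_const_of_gradient_zero_ball {U : Set (Pt d)} (hU : IsOpen U) {v : Pt d → ℝ}
    (hv : HG U v 0) {x₀ : Pt d} (hx₀ : x₀ ∈ U) :
    ∃ c δ : ℝ, 0 < δ ∧ Metric.ball x₀ δ ⊆ U ∧ v =ᵐ[volume.restrict (Metric.ball x₀ δ)] fun _ => c := by
  obtain ⟨r, hr, hrU⟩ := Metric.isOpen_iff.1 hU x₀ hx₀
  obtain ⟨w, hwm, hvw, hw⟩ := hv.exists_stronglyMeasurable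
  -- Shifts by less than `2 * δ` then keep the ball of radius `δ` inside the ball of radius `r = 3 *
  -- δ`.
  set δ := r / 3 with hδ
  have hδ0 : 0 < δ := by positivity
  have hBU : Metric.ball x₀ δ ⊆ U := (Metric.ball_subset_ball (by linarith)).trans hrU
  have h1 := lintegral_sub_average_le hδ0 (subset_refl _) Metric.isOpen_ball.measurableSet hwm
    (IntegrableOn.of_memLp_ball hw.1 hBU)
  have h2 : ∫⁻ h in Metric.ball (0 : Pt d) (2 * δ), ∫⁻ x in Metric.ball x₀ δ,
      ‖w (x + h) - w x‖ₑ ^ 2 = 0 := by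
    refine le_antisymm ((setLIntegral_mono' Metric.isOpen_ball.measurableSet
      (g := fun _ => 0) fun h hh => ?_).trans (by simp)) zero_le
    rw [mem_ball_zero_iff] at hh
    refine (hw.lintegral_translate_sub_le hU Metric.isOpen_ball.measurableSet
      (fun x hx s hs => hrU ?_) hwm).trans (by simp)
    rw [Metric.mem_ball] at hx ⊢
    have h3 : dist (x + s • h) x ≤ ‖h‖ := by
      rw [dist_eq_norm, add_sub_cancel_left, norm_smul, Real.norm_eq_abs, abs_of_nonneg hs.1]
      nlinarith [hs.2, norm_nonneg h]
    linarith [dist_triangle (x + s • h) x x₀]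
  rw [h2, mul_zero, nonpos_iff_eq_zero] at h1
  have h4 := (lintegral_eq_zero_iff
    ((hwm.sub stronglyMeasurable_const).enorm.pow_const 2)).1 h1
  refine ⟨(volume.real (Metric.ball x₀ δ))⁻¹ * ∫ y in Metric.ball x₀ δ, w y, δ, hδ0, hBU, ?_⟩
  filter_upwards [h4, ae_restrict_of_ae_restrict_of_subset hBU hvw] with x hx hx'
  rw [hx']
  simpa [sub_eq_zero] using hx

/-- A function with vanishing gradient on a connected open set is constant. -/
theorem ae_eq_const_of_gradient_zero {U : Set (Pt d)} (hU : IsOpen U) (hc : IsConnected U)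
    {v : Pt d → ℝ} (hv : HG U v 0) : ∃ c : ℝ, v =ᵐ[volume.restrict U] fun _ => c := by
  obtain ⟨x₀, hx₀⟩ := hc.nonempty
  obtain ⟨c₀, δ₀, hδ₀, hB₀, hv₀⟩ := ae_eq_const_of_gradient_zero_ball hU hv hx₀
  -- The sets of points near which `v` is almost everywhere `c₀`, or some other constant, are open
  -- and disjoint and cover `U`; connectedness leaves only the first.
  let P : ℝ → Pt d → Prop := fun c x => ∃ δ : ℝ, 0 < δ ∧
    v =ᵐ[volume.restrict (Metric.ball x δ)] fun _ => c
  have hopen : ∀ c x, P c x → ∃ δ > 0, ∀ y ∈ Metric.ball x δ, P c y := by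
    rintro c x ⟨δ, hδ, h⟩
    refine ⟨δ, hδ, fun y hy => ⟨δ - dist y x, by simpa using hy, ?_⟩⟩
    exact ae_restrict_of_ae_restrict_of_subset (Metric.ball_subset_ball' (by linarith)) h
  have huniq : ∀ c c' x, P c x → P c' x → c = c' := by
    rintro c c' x ⟨δ, hδ, h⟩ ⟨δ', hδ', h'⟩
    by_contra hne
    have h1 : ∀ᵐ _ ∂(volume.restrict (Metric.ball x (min δ δ'))), False := by
      filter_upwards [ae_restrict_of_ae_restrict_of_subset
        (Metric.ball_subset_ball (min_le_left δ δ')) h, ae_restrict_of_ae_restrict_of_subset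
        (Metric.ball_subset_ball (min_le_right δ δ')) h'] with y hy hy'
      exact hne (hy.symm.trans hy')
    rw [ae_iff] at h1
    simp only [not_false_eq_true, ofPred_true, Measure.restrict_apply_univ] at h1
    exact (Metric.measure_ball_pos volume x (lt_min hδ hδ')).ne' h1
  have hA : IsOpen {x | P c₀ x} := Metric.isOpen_iff.2 fun x hx => hopen c₀ x hx
  have hB : IsOpen {x | ∃ c, c ≠ c₀ ∧ P c x} := Metric.isOpen_iff.2 fun x ⟨c, hne, hx⟩ => by
    obtain ⟨δ, hδ, h⟩ := hopen c x hx
    exact ⟨δ, hδ, fun y hy => ⟨c, hne, h y hy⟩⟩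
  have hsub : U ⊆ {x | P c₀ x} := by
    refine hc.isPreconnected.subset_left_of_subset_union hA hB ?_ ?_
      ⟨x₀, hx₀, δ₀, hδ₀, hv₀⟩
    · rw [Set.disjoint_left]
      rintro x hx ⟨c, hne, hx'⟩
      exact hne (huniq c c₀ x hx' hx)
    · intro x hx
      obtain ⟨c, δ, hδ, -, h⟩ := ae_eq_const_of_gradient_zero_ball hU hv hx
      by_cases hcc : c = c₀
      · exact Or.inl ⟨δ, hδ, hcc ▸ h⟩
      · exact Or.inr ⟨c, hcc, δ, hδ, h⟩
  refine ⟨c₀, ?_⟩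
  rw [EventuallyEq, ae_restrict_iff' hU.measurableSet, ae_iff]
  refine measure_null_of_locally_null _ fun x hx => ?_
  simp only [Classical.not_imp, mem_ofPred_eq] at hx
  obtain ⟨δ, hδ, h⟩ := hsub hx.1
  refine ⟨_, inter_mem_nhdsWithin _ (Metric.ball_mem_nhds x hδ), ?_⟩
  rw [EventuallyEq, ae_restrict_iff' Metric.isOpen_ball.measurableSet, ae_iff] at h
  refine measure_mono_null ?_ h
  rintro y ⟨hy1, hy2⟩
  simp only [Classical.not_imp, mem_ofPred_eq] at hy1 ⊢
  exact ⟨hy2, hy1.2⟩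

/-- A function with vanishing gradient on the whole space and bounded support vanishes. -/
theorem ae_eq_zero_of_gradient_zero_of_bounded [Nonempty (Fin d)] {R : Set (Pt d)}
    (hR : MeasurableSet R)
    (hb : Bornology.IsBounded R) {v : Pt d → ℝ} (hv : HG univ v 0) (hv0 : ∀ x, x ∉ R → v x = 0) :
    v =ᵐ[volume.restrict R] 0 := by
  obtain ⟨w, hwm, hvw, hw⟩ := hv.exists_stronglyMeasurable
  rw [Measure.restrict_univ] at hvw
  obtain ⟨C, hC⟩ := hb.exists_norm_le
  -- A long enough shift moves the bounded set off itself. There the shifted function vanishes,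
  -- while a zero gradient makes it equal to the function itself.
  obtain ⟨h, hh⟩ : ∃ h : Pt d, ∀ x ∈ R, x + h ∉ R := by
    obtain ⟨h, hh⟩ := NormedSpace.exists_lt_norm ℝ (Pt d) (2 * C)
    refine ⟨h, fun x hx hx' => ?_⟩
    have h1 := hC x hx
    have h2 := hC _ hx'
    have h3 : ‖h‖ ≤ ‖x + h‖ + ‖x‖ := by
      have := norm_sub_le (x + h) x
      rwa [add_sub_cancel_left] at this
    linarith
  have h1 := hw.lintegral_translate_sub_le isOpen_univ hR (h := h) (fun x _ s _ => mem_univ _) hwm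
  simp only [Pi.zero_apply, enorm_zero, ne_eq, OfNat.ofNat_ne_zero, not_false_eq_true, zero_pow,
    lintegral_const, zero_mul, mul_zero, nonpos_iff_eq_zero] at h1
  have h4 := (lintegral_eq_zero_iff
    (((hwm.comp_measurable (measurable_id.add_const h)).sub hwm).enorm.pow_const 2)).1 h1
  have h2 : (fun x => v (x + h)) =ᵐ[volume] fun x => w (x + h) :=
    (measurePreserving_add_right volume h).quasiMeasurePreserving.ae_eq_comp hvw
  filter_upwards [h4, ae_restrict_of_ae h2, ae_restrict_of_ae hvw, ae_restrict_mem hR]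
    with x hx hx2 hx3 hxR
  have : w (x + h) - w x = 0 := by simpa using hx
  rw [← hx2, ← hx3, hv0 _ (hh x hxR), zero_sub, neg_eq_zero] at this
  exact this

/-! ### Abstract spectral theory for a pair of symmetric nonnegative forms -/

theorem sq_apply_le_of_nonneg {V : Type*} [AddCommGroup V] [Module ℝ V]
    (a : V →ₗ[ℝ] V →ₗ[ℝ] ℝ) (hs : ∀ x y, a x y = a y x) (h0 : ∀ x, 0 ≤ a x x) (x y : V) :
    a x y ^ 2 ≤ a x x * a y y := by
  have := LinearMap.BilinForm.apply_mul_apply_le_of_forall_zero_le a h0 x y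
  rwa [hs y x, ← sq] at this

theorem apply_eq_zero_of_self_eq_zero {V : Type*} [AddCommGroup V] [Module ℝ V]
    (a : V →ₗ[ℝ] V →ₗ[ℝ] ℝ) (hs : ∀ x y, a x y = a y x) (h0 : ∀ x, 0 ≤ a x x) {x : V}
    (hx : a x x = 0) (y : V) : a x y = 0 := by
  have := sq_apply_le_of_nonneg a hs h0 x y
  rw [hx, zero_mul] at this
  exact pow_eq_zero_iff two_ne_zero |>.1 (le_antisymm this (sq_nonneg _))

theorem parallelogram {V : Type*} [AddCommGroup V] [Module ℝ V]
    (a : V →ₗ[ℝ] V →ₗ[ℝ] ℝ) (hs : ∀ x y, a x y = a y x) (x y : V) :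
    a (x + y) (x + y) = 2 * a x x + 2 * a y y - a (x - y) (x - y) := by
  simp only [map_add, map_sub, LinearMap.add_apply, LinearMap.sub_apply, hs y x]
  ring

/-- Convergence in a seminorm coming from a form implies convergence of the values of a smaller
form. -/
theorem tendsto_apply_self {V : Type*} [AddCommGroup V] [Module ℝ V]
    (a b : V →ₗ[ℝ] V →ₗ[ℝ] ℝ) (hb : ∀ x y, b x y = b y x) (hb0 : ∀ x, 0 ≤ b x x) {C : ℝ}
    (hba : ∀ x, b x x ≤ C * a x x) {u : ℕ → V} {w : V}
    (hu : Tendsto (fun i => a (u i - w) (u i - w)) atTop (𝓝 0)) :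
    Tendsto (fun i => b (u i) (u i)) atTop (𝓝 (b w w)) := by
  have h1 : Tendsto (fun i => b (u i - w) (u i - w)) atTop (𝓝 0) :=
    squeeze_zero (fun i => hb0 _) (fun i => hba _) (by simpa using hu.const_mul C)
  have h2 : Tendsto (fun i => b (u i - w) w) atTop (𝓝 0) := by
    have h3 : Tendsto (fun i => b (u i - w) w ^ 2) atTop (𝓝 0) :=
      squeeze_zero (fun i => sq_nonneg _) (fun i => sq_apply_le_of_nonneg b hb hb0 _ _)
        (by simpa using h1.mul_const (b w w))
    have h4 := (Real.continuous_sqrt.tendsto _).comp h3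
    rw [Real.sqrt_zero] at h4
    exact (tendsto_zero_iff_abs_tendsto_zero _).2
      (h4.congr fun i => by simp [Real.sqrt_sq_eq_abs])
  have h5 := (h1.add (h2.const_mul 2)).add_const (b w w)
  simp only [mul_zero, add_zero, zero_add] at h5
  refine h5.congr fun i => ?_
  simp only [map_sub, LinearMap.sub_apply, hb w (u i)]
  ring

/-- Orthogonal projection onto a finite linearly independent family. -/
theorem exists_sub_sum_orthogonal {V : Type*} [AddCommGroup V] [Module ℝ V]
    (a : V →ₗ[ℝ] V →ₗ[ℝ] ℝ) (hs : ∀ x y, a x y = a y x) {n : ℕ} {v : Fin n → V}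
    (hv : ∀ c : Fin n → ℝ, a (∑ k, c k • v k) (∑ k, c k • v k) = 0 → c = 0) (u : V) :
    ∃ c : Fin n → ℝ, ∀ k, a (v k) (u - ∑ l, c l • v l) = 0 := by
  -- This is the Gram matrix of the family: definiteness on the span makes it injective, hence
  -- surjective, and the coefficients solve the normal equations.
  let T : (Fin n → ℝ) →ₗ[ℝ] (Fin n → ℝ) :=
    (LinearMap.pi fun k => a (v k)).comp (Fintype.linearCombination ℝ v)
  have hT : ∀ c k, T c k = a (v k) (∑ l, c l • v l) := fun c k => by
    simp [T, Fintype.linearCombination_apply]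
  have hinj : Function.Injective T := by
    rw [← LinearMap.ker_eq_bot, LinearMap.ker_eq_bot']
    intro c hc
    refine hv c ?_
    rw [map_sum]
    refine Finset.sum_eq_zero fun k _ => ?_
    rw [map_smul, hs, ← hT, hc]
    simp
  obtain ⟨c, hc⟩ := LinearMap.surjective_of_injective hinj fun k => a (v k) u
  refine ⟨c, fun k => ?_⟩
  rw [map_sub, ← hT, hc, sub_self]

/-- On the span of eigenvectors of `a v = λ b v` with `λ ≤ 1 / M`, the form `M a` is bounded by
`b`. -/
theorem mul_apply_sum_le {V : Type*} [AddCommGroup V] [Module ℝ V]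
    (a b : V →ₗ[ℝ] V →ₗ[ℝ] ℝ) (ha : ∀ x y, a x y = a y x) (ha0 : ∀ x, 0 ≤ a x x)
    (hb : ∀ x y, b x y = b y x) {n : ℕ} {v : Fin n → V} {lam : Fin n → ℝ} {M : ℝ}
    (hlam : ∀ k, 0 < lam k) (hM : ∀ k, M ≤ (lam k)⁻¹)
    (heig : ∀ k l, a (v k) (v l) = lam k * b (v k) (v l)) (c : Fin n → ℝ) :
    M * a (∑ k, c k • v k) (∑ k, c k • v k) ≤ b (∑ k, c k • v k) (∑ k, c k • v k) := by
  -- Weighting the coefficients by `√((lam k)⁻¹ - M)` makes the nonnegative value of `a` at the new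
  -- combination equal to `b - M * a` at the old one.
  have h1 := ha0 (∑ k, (√((lam k)⁻¹ - M) * c k) • v k)
  have key : ∀ k l, √((lam k)⁻¹ - M) * √((lam l)⁻¹ - M) * a (v k) (v l) =
      b (v k) (v l) - M * a (v k) (v l) := by
    intro k l
    have hk := heig k l
    have hl := heig l k
    rw [ha, hb] at hl
    -- By symmetry of both forms, eigenvectors with different eigenvalues are orthogonal for both;
    -- otherwise the two square roots are equal and multiply to the weight.
    by_cases h : b (v k) (v l) = 0
    · rw [hk, h]; simp
    · have hkl : lam k = lam l := mul_right_cancel₀ h (hk.symm.trans hl)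
      rw [hkl, Real.mul_self_sqrt (sub_nonneg.2 (hM l)), hl]
      have := (hlam l).ne'
      field_simp
  have h2 : a (∑ k, (√((lam k)⁻¹ - M) * c k) • v k) (∑ k, (√((lam k)⁻¹ - M) * c k) • v k) =
      b (∑ k, c k • v k) (∑ k, c k • v k) -
        M * a (∑ k, c k • v k) (∑ k, c k • v k) := by
    simp only [map_sum, LinearMap.sum_apply, map_smul, LinearMap.smul_apply, smul_eq_mul,
      Finset.mul_sum, ← Finset.sum_sub_distrib]
    refine Finset.sum_congr rfl fun k _ => Finset.sum_congr rfl fun l _ => ?_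
    linear_combination (c k * c l) * key l k
  linarith

/-- The maximum of `b` on the `a`-unit ball of a closed subspace is attained. -/
theorem exists_maximizer {V : Type*} [AddCommGroup V] [Module ℝ V]
    (a b : V →ₗ[ℝ] V →ₗ[ℝ] ℝ) (ha : ∀ x y, a x y = a y x) (ha0 : ∀ x, 0 ≤ a x x)
    (hb : ∀ x y, b x y = b y x) (hb0 : ∀ x, 0 ≤ b x x) {C : ℝ} (hba : ∀ x, b x x ≤ C * a x x)
    (hcomplete : ∀ u : ℕ → V,
      (∀ ε > 0, ∃ N, ∀ i ≥ N, ∀ j ≥ N, a (u i - u j) (u i - u j) ≤ ε) →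
      ∃ w, Tendsto (fun i => a (u i - w) (u i - w)) atTop (𝓝 0))
    (hcompact : ∀ u : ℕ → V, (∀ i, a (u i) (u i) ≤ 1) → ∃ φ : ℕ → ℕ, StrictMono φ ∧
      ∀ ε > 0, ∃ N, ∀ i ≥ N, ∀ j ≥ N,
        b (u (φ i) - u (φ j)) (u (φ i) - u (φ j)) ≤ ε)
    {n : ℕ} (v : Fin n → V) :
    ∃ M : ℝ, 0 ≤ M ∧ (∀ x, (∀ k, a (v k) x = 0) → b x x ≤ M * a x x) ∧
      (0 < M → ∃ w, (∀ k, a (v k) w = 0) ∧ a w w ≤ 1 ∧ b w w = M) := by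
  let T : Set ℝ := {t | ∃ x, (∀ k, a (v k) x = 0) ∧ a x x ≤ 1 ∧ b x x = t}
  have hT0 : (0 : ℝ) ∈ T := ⟨0, by simp, by simp, by simp⟩
  have hTb : BddAbove T := by
    refine ⟨max C 0, ?_⟩
    rintro _ ⟨x, -, hx, rfl⟩
    nlinarith [hba x, le_max_left C 0, le_max_right C 0, ha0 x]
  set M := sSup T with hM
  have hM0 : 0 ≤ M := le_csSup hTb hT0
  have hle : ∀ x, (∀ k, a (v k) x = 0) → b x x ≤ M * a x x := by
    intro x hx
    rcases (ha0 x).eq_or_lt with h | h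
    · have := hba x
      rw [← h, mul_zero] at this ⊢
      exact this
    · have hs : √(a x x) ≠ 0 := (Real.sqrt_pos.2 h).ne'
      have hss : √(a x x) * √(a x x) = a x x := Real.mul_self_sqrt h.le
      have h1 : b ((√(a x x))⁻¹ • x) ((√(a x x))⁻¹ • x) ≤ M := by
        refine le_csSup hTb ⟨_, fun k => by simp [hx k], ?_, rfl⟩
        simp only [map_smul, LinearMap.smul_apply, smul_eq_mul]
        rw [← mul_assoc, ← mul_inv, hss, inv_mul_cancel₀ h.ne']
      simp only [map_smul, LinearMap.smul_apply, smul_eq_mul] at h1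
      rw [← mul_assoc, ← mul_inv, hss, inv_mul_le_iff₀ h] at h1
      linarith
  refine ⟨M, hM0, hle, fun hMpos => ?_⟩
  obtain ⟨t, -, htM, htT⟩ := exists_seq_tendsto_sSup ⟨0, hT0⟩ hTb
  choose u hu hu1 hut using htT
  obtain ⟨φ, hφ, hφc⟩ := hcompact u hu1
  have htφ : Tendsto (fun i => b (u (φ i)) (u (φ i))) atTop (𝓝 M) := by
    simp only [hut]
    exact htM.comp hφ.tendsto_atTop
  -- A maximizing sequence that is Cauchy for `b` is Cauchy for `a`. By the bound for `u i + u j`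
  -- and the parallelogram law, `M * a (u i - u j) (u i - u j)` is at most `4 * M - 2 * b (u i) (u
  -- i) - 2 * b (u j) (u j)` plus the `b`-value of the difference. The tolerances `M * ε / 2` and `M
  -- * ε / 8` add up to `M * ε`.
  obtain ⟨w, hw⟩ := hcomplete (u ∘ φ) (by
    intro ε hε
    obtain ⟨N₁, hN₁⟩ := hφc (M * ε / 2) (by positivity)
    obtain ⟨N₂, hN₂⟩ := eventually_atTop.1
      (htφ.eventually (lt_mem_nhds (show M - M * ε / 8 < M by nlinarith [mul_pos hMpos hε])))
    refine ⟨max N₁ N₂, fun i hi j hj => ?_⟩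
    have h1 := hN₁ i (le_of_max_le_left hi) j (le_of_max_le_left hj)
    have h2 := hN₂ i (le_of_max_le_right hi)
    have h3 := hN₂ j (le_of_max_le_right hj)
    have h4 := hle (u (φ i) + u (φ j)) fun k => by simp [hu]
    rw [parallelogram a ha, parallelogram b hb] at h4
    have h5 := hu1 (φ i)
    have h6 := hu1 (φ j)
    simp only [Function.comp]
    have h7 : M * a (u (φ i) - u (φ j)) (u (φ i) - u (φ j)) ≤ M * ε := by nlinarith
    exact le_of_mul_le_mul_left h7 hMpos)
  refine ⟨w, fun k => ?_, ?_, ?_⟩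
  · have h1 : Tendsto (fun i => a (u (φ i) - w) (u (φ i) - w) * a (v k) (v k)) atTop (𝓝 0) := by
      simpa using hw.mul_const (a (v k) (v k))
    have h2 : a w (v k) ^ 2 ≤ 0 := by
      refine ge_of_tendsto h1 (Eventually.of_forall fun i => ?_)
      have h3 := sq_apply_le_of_nonneg a ha ha0 (u (φ i) - w) (v k)
      have h4 : a (u (φ i) - w) (v k) = -a w (v k) := by
        rw [map_sub, LinearMap.sub_apply, ha (u (φ i)), hu, zero_sub]
      rwa [h4, neg_sq] at h3
    rw [ha]
    exact pow_eq_zero_iff two_ne_zero |>.1 (le_antisymm h2 (sq_nonneg _))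
  · exact le_of_tendsto (tendsto_apply_self a a ha ha0 (C := 1) (by simp) hw)
      (Eventually.of_forall fun i => hu1 _)
  · exact tendsto_nhds_unique (tendsto_apply_self a b hb hb0 hba hw) htφ

/-- Given the first `n` eigenpairs of `a v = λ b v`, the quotient `b / a` is bounded on the
orthogonal complement by a constant `M`, which is attained from below on some subspace of dimension
`n + 1`. -/
theorem exists_spectral_gap {V : Type*} [AddCommGroup V] [Module ℝ V]
    (a b : V →ₗ[ℝ] V →ₗ[ℝ] ℝ) (ha : ∀ x y, a x y = a y x) (ha0 : ∀ x, 0 ≤ a x x)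
    (hb : ∀ x y, b x y = b y x) (hb0 : ∀ x, 0 ≤ b x x) {C : ℝ} (hba : ∀ x, b x x ≤ C * a x x)
    (hcomplete : ∀ u : ℕ → V,
      (∀ ε > 0, ∃ N, ∀ i ≥ N, ∀ j ≥ N, a (u i - u j) (u i - u j) ≤ ε) →
      ∃ w, Tendsto (fun i => a (u i - w) (u i - w)) atTop (𝓝 0))
    (hcompact : ∀ u : ℕ → V, (∀ i, a (u i) (u i) ≤ 1) → ∃ φ : ℕ → ℕ, StrictMono φ ∧
      ∀ ε > 0, ∃ N, ∀ i ≥ N, ∀ j ≥ N,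
        b (u (φ i) - u (φ j)) (u (φ i) - u (φ j)) ≤ ε)
    {n : ℕ} (v : Fin n → V) (lam : Fin n → ℝ)
    (heig : ∀ k x, a (v k) x = lam k * b (v k) x)
    (hind : ∀ c : Fin n → ℝ, a (∑ k, c k • v k) (∑ k, c k • v k) = 0 → c = 0)
    (hfirst : ∀ w μ, 0 < a w w → (∀ x, a w x = μ * b w x) →
      (∀ c : Fin n → ℝ, a (w - ∑ k, c k • v k) (w - ∑ k, c k • v k) ≠ 0) → ∀ k, lam k ≤ μ) :
    ∃ M : ℝ, 0 ≤ M ∧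
      (∀ u, ∃ c : Fin n → ℝ,
        b (u - ∑ k, c k • v k) (u - ∑ k, c k • v k) ≤ M * a u u) ∧
      (M = 0 ∨ ∃ x : Fin (n + 1) → V, ∀ c : Fin (n + 1) → ℝ, c ≠ 0 →
        0 < a (∑ k, c k • x k) (∑ k, c k • x k) ∧
        M * a (∑ k, c k • x k) (∑ k, c k • x k) ≤ b (∑ k, c k • x k) (∑ k, c k • x k)) := by
  obtain ⟨M, hM0, hle, hmax⟩ := exists_maximizer a b ha ha0 hb hb0 hba hcomplete hcompact v
  have horth : ∀ {x}, (∀ k, a (v k) x = 0) → ∀ c : Fin n → ℝ, a x (∑ k, c k • v k) = 0 := by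
    intro x hx c
    rw [map_sum]
    refine Finset.sum_eq_zero fun k _ => ?_
    rw [map_smul, ha, hx, smul_zero]
  have hvpos : ∀ k, 0 < a (v k) (v k) := by
    intro k
    refine (ha0 _).lt_of_ne' fun h => ?_
    have h1 : ∑ l, (Pi.single k (1 : ℝ) : Fin n → ℝ) l • v l = v k := by
      simp [Pi.single_apply, ite_smul]
    have h2 := congrFun (hind (Pi.single k 1) (by rwa [h1])) k
    simp at h2
  -- Definiteness of `a` on the span and `b ≥ 0` exclude nonpositive eigenvalues.
  have hlam : ∀ k, 0 < lam k := by
    intro k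
    have h1 := hvpos k
    rw [heig] at h1
    exact pos_of_mul_pos_left h1 (hb0 _)
  refine ⟨M, hM0, fun u => ?_, ?_⟩
  · obtain ⟨c, hc⟩ := exists_sub_sum_orthogonal a ha hind u
    refine ⟨c, (hle _ hc).trans (mul_le_mul_of_nonneg_left ?_ hM0)⟩
    have h1 := horth hc c
    set s := ∑ k, c k • v k
    have h2 := ha0 s
    simp only [map_sub, LinearMap.sub_apply] at h1 ⊢
    rw [ha s u] at *
    linarith
  -- If `M = 0` no lower bound is needed, and there may be no further eigenvector with positive
  -- `b`-value.
  rcases hM0.eq_or_lt with h | hMpos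
  · exact Or.inl h.symm
  right
  obtain ⟨w, hwv, hw1, hbw⟩ := hmax hMpos
  have haw : 0 < a w w := (ha0 w).lt_of_ne' fun h => by
    have := hba w
    rw [h, hbw, mul_zero] at this
    linarith
  have hweig : ∀ x, a w x = M⁻¹ * b w x := by
    intro x
    obtain ⟨c, hc⟩ := exists_sub_sum_orthogonal a ha hind x
    set z := x - ∑ k, c k • v k with hz
    have hxz : x = z + ∑ k, c k • v k := by rw [hz, sub_add_cancel]
    -- The eigenvalue equation turns `a`-orthogonality to `v k` into `b`-orthogonality, as `lam k ≠
    -- 0`. So the Euler equation for the maximizer need only be tested on the orthogonal complement.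
    have hbs : b w (∑ k, c k • v k) = 0 := by
      rw [map_sum]
      refine Finset.sum_eq_zero fun k _ => ?_
      have h1 := heig k w
      rw [hwv k] at h1
      rw [map_smul, hb, (mul_eq_zero.1 h1.symm).resolve_left (hlam k).ne', smul_zero]
    -- This polynomial is `M * a - b` at `w + t • z`. It is nonnegative and vanishes at `t = 0`,
    -- because `w` is a maximizer, so the discriminant forces its linear coefficient to be zero.
    have h2 : ∀ t : ℝ, 0 ≤ (M * a z z - b z z) * (t * t) +
        2 * (M * a w z - b w z) * t + (M * a w w - b w w) := by
      intro t
      have h3 := hle (w + t • z) fun k => by simp [hwv, hc]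
      simp only [map_add, map_smul, LinearMap.add_apply, LinearMap.smul_apply, smul_eq_mul,
        ha z w, hb z w] at h3
      linarith
    have h4 := discrim_le_zero h2
    rw [discrim] at h4
    have h5 : M * a w w - b w w = 0 :=
      le_antisymm (by rw [hbw]; nlinarith) (by linarith [hle w hwv])
    rw [h5] at h4
    have h6 : M * a w z - b w z = 0 := by nlinarith
    rw [hxz, map_add, map_add, horth hwv, hbs, add_zero, add_zero, eq_inv_mul_iff_mul_eq₀ hMpos.ne']
    linarith
  -- Being `a`-orthogonal to the `v k` with `a w w > 0`, `w` is not in their span, so its eigenvalue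
  -- `M⁻¹` is at least each `lam k`.
  have hlamM : ∀ k, lam k ≤ M⁻¹ := by
    refine hfirst w M⁻¹ haw hweig fun c hc => haw.ne' ?_
    have h1 := apply_eq_zero_of_self_eq_zero a ha ha0 hc w
    rw [map_sub, LinearMap.sub_apply, ha (∑ k, c k • v k), horth hwv, sub_zero] at h1
    exact h1
  -- The `n + 1` vectors are the maximizer and the given eigenvectors; all their reciprocal
  -- eigenvalues are at least `M`.
  refine ⟨Fin.cons w v, fun c hc => ⟨(ha0 _).lt_of_ne' fun h => hc ?_, ?_⟩⟩
  · have h1 := apply_eq_zero_of_self_eq_zero a ha ha0 h w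
    simp only [Fin.sum_univ_succ, Fin.cons_zero, Fin.cons_succ] at h h1
    rw [ha, map_add, horth hwv fun k => c k.succ, map_smul, add_zero, smul_eq_mul] at h1
    have hc0 := (mul_eq_zero.1 h1).resolve_right haw.ne'
    rw [hc0, zero_smul, zero_add] at h
    have h2 := hind _ h
    funext k
    refine Fin.cases hc0 (fun k => ?_) k
    exact congrFun h2 k
  · refine mul_apply_sum_le a b ha ha0 hb (lam := Fin.cons M⁻¹ lam) (fun k => ?_) (fun k => ?_)
      (fun k l => ?_) c
    · refine Fin.cases ?_ (fun k => ?_) k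
      · simpa using hMpos
      · simpa using hlam k
    · refine Fin.cases ?_ (fun k => ?_) k
      · simp
      · simpa using (le_inv_comm₀ hMpos (hlam k)).2 (hlamM k)
    · refine Fin.cases ?_ (fun k => ?_) k
      · simpa using hweig _
      · simpa using heig k _

/-! ### Elliptic coefficients and the energy form -/

/-- Measurable, symmetric, uniformly elliptic and bounded coefficients. -/
def IsElliptic (U : Set (Pt d)) (A : Pt d → Matrix (Fin d) (Fin d) ℝ) (α β : ℝ) : Prop :=
  0 < α ∧ (∀ i j, AEMeasurable (fun x => A x i j) (volume.restrict U)) ∧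
    ∀ᵐ x ∂(volume.restrict U), (A x).IsSymm ∧ ∀ ξ : Pt d,
      α * ‖ξ‖ ^ 2 ≤ inner ℝ (Matrix.toEuclideanLin (A x) ξ) ξ ∧
      inner ℝ (Matrix.toEuclideanLin (A x) ξ) ξ ≤ β * ‖ξ‖ ^ 2

/-- `∫_U A G · H`. -/
def form (A : Pt d → Matrix (Fin d) (Fin d) ℝ) (U : Set (Pt d)) (G H : Pt d → Pt d) : ℝ :=
  ∫ x in U, inner ℝ (Matrix.toEuclideanLin (A x) (G x)) (H x)

theorem inner_toEuclideanLin_comm {B : Matrix (Fin d) (Fin d) ℝ} (hB : B.IsSymm) (ξ η : Pt d) :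
    inner ℝ (Matrix.toEuclideanLin B ξ) η = inner ℝ (Matrix.toEuclideanLin B η) ξ := by
  have h : B.IsHermitian := by
    rw [Matrix.IsHermitian, Matrix.conjTranspose_eq_transpose_of_trivial]
    exact hB
  rw [Matrix.isSymmetric_toEuclideanLin_iff.2 h ξ η, real_inner_comm]

/-- The hypotheses bound only the quadratic form. Cauchy–Schwarz for this form, applied to `ξ` and
`B ξ`, turns the bound into one on the operator norm. The absolute value appears because no sign of
`β` is assumed. -/
theorem norm_toEuclideanLin_le {B : Matrix (Fin d) (Fin d) ℝ} {β : ℝ} (hB : B.IsSymm)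
    (h0 : ∀ ξ : Pt d, 0 ≤ inner ℝ (Matrix.toEuclideanLin B ξ) ξ)
    (h1 : ∀ ξ : Pt d, inner ℝ (Matrix.toEuclideanLin B ξ) ξ ≤ β * ‖ξ‖ ^ 2) (ξ : Pt d) :
    ‖Matrix.toEuclideanLin B ξ‖ ≤ |β| * ‖ξ‖ := by
  set η := Matrix.toEuclideanLin B ξ with hη
  have h2 := sq_apply_le_of_nonneg ((innerₗ (Pt d)).comp (Matrix.toEuclideanLin B))
    (fun x y => by simpa using inner_toEuclideanLin_comm hB x y) (fun x => by simpa using h0 x) ξ η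
  simp only [LinearMap.comp_apply, innerₗ_apply_apply, ← hη, real_inner_self_eq_norm_sq] at h2
  have h3 : (‖η‖ ^ 2) ^ 2 ≤ (|β| * ‖ξ‖) ^ 2 * ‖η‖ ^ 2 := by
    refine h2.trans ?_
    have h4 := (h1 ξ).trans (mul_le_mul_of_nonneg_right (le_abs_self β) (sq_nonneg _))
    have h5 := (h1 η).trans (mul_le_mul_of_nonneg_right (le_abs_self β) (sq_nonneg _))
    rw [← hη] at h4
    calc _ ≤ (|β| * ‖ξ‖ ^ 2) * (|β| * ‖η‖ ^ 2) :=
          mul_le_mul h4 h5 (h0 η) (by positivity)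
      _ = _ := by ring
  rcases (norm_nonneg η).eq_or_lt with h | h
  · rw [← h]; positivity
  · refine le_of_sq_le_sq ?_ (by positivity)
    nlinarith [pow_pos h 2]

theorem IsElliptic.mono {U W : Set (Pt d)} {A : Pt d → Matrix (Fin d) (Fin d) ℝ} {α β : ℝ}
    (hA : IsElliptic U A α β) (hW : W ⊆ U) : IsElliptic W A α β :=
  ⟨hA.1, fun i j => (hA.2.1 i j).mono_measure (Measure.restrict_mono hW le_rfl),
    ae_restrict_of_ae_restrict_of_subset hW hA.2.2⟩

theorem IsElliptic.memLp {U : Set (Pt d)} {A : Pt d → Matrix (Fin d) (Fin d) ℝ} {α β : ℝ}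
    (hA : IsElliptic U A α β) {G : Pt d → Pt d} (hG : MemLp G 2 (volume.restrict U)) :
    MemLp (fun x => Matrix.toEuclideanLin (A x) (G x)) 2 (volume.restrict U) := by
  obtain ⟨hα, hm, hell⟩ := hA
  refine (hG.norm.const_mul |β|).of_le ?_ ?_
  · have h1 : AEMeasurable (fun x => fun i => ∑ j, A x i j * G x j) (volume.restrict U) := by
      refine aemeasurable_pi_lambda _ fun i => Finset.aemeasurable_fun_sum _ fun j _ => ?_
      refine (hm i j).mul ?_
      exact (EuclideanSpace.proj (𝕜 := ℝ) j).continuous.measurable.comp_aemeasurable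
        hG.1.aemeasurable
    have h2 := (PiLp.continuous_toLp 2 (fun _ : Fin d => ℝ)).comp_aestronglyMeasurable
      h1.aestronglyMeasurable
    refine h2.congr (Eventually.of_forall fun x => ?_)
    ext i
    simp [Matrix.toEuclideanLin, Matrix.mulVec, dotProduct]
  · filter_upwards [hell] with x hx
    refine (norm_toEuclideanLin_le hx.1 (fun ξ => ?_) (fun ξ => (hx.2 ξ).2) (G x)).trans
      (le_abs_self _)
    exact (mul_nonneg hα.le (sq_nonneg _)).trans (hx.2 ξ).1

section form

variable {U : Set (Pt d)} {A : Pt d → Matrix (Fin d) (Fin d) ℝ} {α β : ℝ}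

theorem IsElliptic.integrable (hA : IsElliptic U A α β) {G H : Pt d → Pt d}
    (hG : MemLp G 2 (volume.restrict U)) (hH : MemLp H 2 (volume.restrict U)) :
    IntegrableOn (fun x => inner ℝ (Matrix.toEuclideanLin (A x) (G x)) (H x)) U :=
  integrable_inner_of_memLp_two (hA.memLp hG) hH

theorem IsElliptic.form_comm (hA : IsElliptic U A α β) (G H : Pt d → Pt d) :
    form A U G H = form A U H G := by
  refine integral_congr_ae ?_
  filter_upwards [hA.2.2] with x hx using inner_toEuclideanLin_comm hx.1 _ _

theorem form_congr {G G' H H' : Pt d → Pt d} (hG : G =ᵐ[volume.restrict U] G')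
    (hH : H =ᵐ[volume.restrict U] H') : form A U G H = form A U G' H' := by
  refine integral_congr_ae ?_
  filter_upwards [hG, hH] with x h1 h2
  rw [h1, h2]

theorem IsElliptic.form_add_left (hA : IsElliptic U A α β) {G G' H : Pt d → Pt d}
    (hG : MemLp G 2 (volume.restrict U)) (hG' : MemLp G' 2 (volume.restrict U))
    (hH : MemLp H 2 (volume.restrict U)) :
    form A U (G + G') H = form A U G H + form A U G' H := by
  rw [form, form, form, ← integral_add (hA.integrable hG hH) (hA.integrable hG' hH)]
  simp [inner_add_left]

theorem form_smul_left (c : ℝ) (G H : Pt d → Pt d) :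
    form A U (c • G) H = c * form A U G H := by
  rw [form, form, ← integral_const_mul]
  simp [inner_smul_left]

theorem IsElliptic.form_self_nonneg (hA : IsElliptic U A α β) (G : Pt d → Pt d) :
    0 ≤ form A U G G := by
  refine integral_nonneg_of_ae ?_
  filter_upwards [hA.2.2] with x hx
  exact (mul_nonneg hA.1.le (sq_nonneg _)).trans (hx.2 _).1

theorem IsElliptic.le_form_self (hA : IsElliptic U A α β) {G : Pt d → Pt d}
    (hG : MemLp G 2 (volume.restrict U)) : α * ∫ x in U, ‖G x‖ ^ 2 ≤ form A U G G := by
  rw [← integral_const_mul]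
  refine integral_mono_ae (hG.norm.integrable_sq.const_mul α) (hA.integrable hG hG) ?_
  filter_upwards [hA.2.2] with x hx using (hx.2 _).1

theorem IsElliptic.form_self_le (hA : IsElliptic U A α β) {G : Pt d → Pt d}
    (hG : MemLp G 2 (volume.restrict U)) : form A U G G ≤ β * ∫ x in U, ‖G x‖ ^ 2 := by
  rw [← integral_const_mul]
  refine integral_mono_ae (hA.integrable hG hG) (hG.norm.integrable_sq.const_mul β) ?_
  filter_upwards [hA.2.2] with x hx using (hx.2 _).2

theorem IsElliptic.form_self_mono (hA : IsElliptic U A α β) {W : Set (Pt d)} (hW : W ⊆ U)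
    {G : Pt d → Pt d} (hG : MemLp G 2 (volume.restrict U)) : form A W G G ≤ form A U G G := by
  refine setIntegral_mono_set (hA.integrable hG hG) ?_ (LE.le.eventuallyLE hW)
  filter_upwards [hA.2.2] with x hx
  exact (mul_nonneg hA.1.le (sq_nonneg _)).trans (hx.2 _).1

theorem HG.energy_eq (hU : IsOpen U) {u v : Pt d → ℝ} {G H : Pt d → Pt d} (hu : HG U u G)
    (hv : HG U v H) : energy A U u v = form A U G H :=
  form_congr (hu.weakGrad_ae hU) (hv.weakGrad_ae hU)

theorem energy_congr (hU : IsOpen U) {u u' v v' : Pt d → ℝ} (hu : MemH1 U u) (hv : MemH1 U v)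
    (huu : u =ᵐ[volume.restrict U] u') (hvv : v =ᵐ[volume.restrict U] v') :
    energy A U u v = energy A U u' v' :=
  (((hu.hg hU).congr huu EventuallyEq.rfl).energy_eq hU
    ((hv.hg hU).congr hvv EventuallyEq.rfl)).symm

theorem IsElliptic.energy_comm (hA : IsElliptic U A α β) (u v : Pt d → ℝ) :
    energy A U u v = energy A U v u :=
  hA.form_comm _ _

theorem IsElliptic.energy_self_nonneg (hA : IsElliptic U A α β) (u : Pt d → ℝ) :
    0 ≤ energy A U u u :=
  hA.form_self_nonneg _

theorem IsElliptic.energy_add_left (hA : IsElliptic U A α β) (hU : IsOpen U) {u u' v : Pt d → ℝ}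
    (hu : MemH1 U u) (hu' : MemH1 U u') (hv : MemH1 U v) :
    energy A U (u + u') v = energy A U u v + energy A U u' v := by
  rw [((hu.hg hU).add (hu'.hg hU)).energy_eq hU (hv.hg hU),
    hA.form_add_left (hu.hg hU).2.1 (hu'.hg hU).2.1 (hv.hg hU).2.1]
  rfl

theorem energy_smul_left (hU : IsOpen U) (c : ℝ) {u v : Pt d → ℝ} (hu : MemH1 U u)
    (hv : MemH1 U v) : energy A U (c • u) v = c * energy A U u v := by
  rw [((hu.hg hU).smul c).energy_eq hU (hv.hg hU), form_smul_left]
  rfl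

theorem IsElliptic.energy_add_right (hA : IsElliptic U A α β) (hU : IsOpen U) {u v v' : Pt d → ℝ}
    (hu : MemH1 U u) (hv : MemH1 U v) (hv' : MemH1 U v') :
    energy A U u (v + v') = energy A U u v + energy A U u v' := by
  rw [hA.energy_comm, hA.energy_add_left hU hv hv' hu, hA.energy_comm v, hA.energy_comm v']

theorem IsElliptic.energy_smul_right (hA : IsElliptic U A α β) (hU : IsOpen U) (c : ℝ)
    {u v : Pt d → ℝ} (hu : MemH1 U u) (hv : MemH1 U v) :
    energy A U u (c • v) = c * energy A U u v := by
  rw [hA.energy_comm, energy_smul_left hU c hv hu, hA.energy_comm v]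

/-- The bilinear form `(u, v) ↦ a_U(T u, T v)` on a space of functions `u` with `T u ∈ H¹(U)`. -/
def energyForm (hU : IsOpen U) (hA : IsElliptic U A α β) (V : Submodule ℝ (Pt d → ℝ))
    (T : (Pt d → ℝ) →ₗ[ℝ] (Pt d → ℝ)) (hT : ∀ v ∈ V, MemH1 U (T v)) : V →ₗ[ℝ] V →ₗ[ℝ] ℝ :=
  LinearMap.mk₂ ℝ (fun u v => energy A U (T u) (T v))
    (fun u u' v => by
      simp only [Submodule.coe_add, map_add]
      exact hA.energy_add_left hU (hT _ u.2) (hT _ u'.2) (hT _ v.2))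
    (fun c u v => by
      simp only [Submodule.coe_smul, map_smul, smul_eq_mul]
      exact energy_smul_left hU c (hT _ u.2) (hT _ v.2))
    (fun u v v' => by
      simp only [Submodule.coe_add, map_add]
      exact hA.energy_add_right hU (hT _ u.2) (hT _ v.2) (hT _ v'.2))
    (fun c u v => by
      simp only [Submodule.coe_smul, map_smul, smul_eq_mul]
      exact hA.energy_smul_right hU c (hT _ u.2) (hT _ v.2))

end form

/-! ### Limits in L² and in H¹ -/

section L2

variable {X E : Type*} [MeasurableSpace X] {μ : Measure X} [NormedAddCommGroup E]
  [InnerProductSpace ℝ E]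

theorem eLpNorm_two_eq_ofReal_sqrt {F : X → E} (hF : MemLp F 2 μ) :
    eLpNorm F 2 μ = ENNReal.ofReal √(∫ x, ‖F x‖ ^ 2 ∂μ) := by
  rw [← sq_eLpNorm_two hF, Real.sqrt_sq ENNReal.toReal_nonneg, ENNReal.ofReal_toReal hF.2.ne]

theorem lintegral_enorm_sq_eq_ofReal {F : X → E} (hF : MemLp F 2 μ) :
    ∫⁻ x, ‖F x‖ₑ ^ 2 ∂μ = ENNReal.ofReal (∫ x, ‖F x‖ ^ 2 ∂μ) := by
  rw [← eLpNorm_two_sq, eLpNorm_two_eq_ofReal_sqrt hF, ← ENNReal.ofReal_pow (Real.sqrt_nonneg _),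
    Real.sq_sqrt (integral_nonneg fun x => sq_nonneg _)]

theorem exists_memLp_two_limit [CompleteSpace E] {f : ℕ → X → E} (hf : ∀ i, MemLp (f i) 2 μ)
    (hC : ∀ ε > 0, ∃ N, ∀ i ≥ N, ∀ j ≥ N, ∫ x, ‖f i x - f j x‖ ^ 2 ∂μ ≤ ε) :
    ∃ w, MemLp w 2 μ ∧ Tendsto (fun i => ∫ x, ‖f i x - w x‖ ^ 2 ∂μ) atTop (𝓝 0) := by
  have hdist : ∀ i (w : Lp E 2 μ), dist (hf i).toLp w ^ 2 = ∫ x, ‖f i x - w x‖ ^ 2 ∂μ := by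
    intro i w
    have h := sq_eLpNorm_two ((hf i).sub (Lp.memLp w))
    have h2 : edist (hf i).toLp w = eLpNorm (f i - ⇑w) 2 μ :=
      (congrArg (edist (hf i).toLp) (Lp.toLp_coeFn w (Lp.memLp w)).symm).trans
        (Lp.edist_toLp_toLp _ _ _ _)
    rw [dist_edist, h2, h]
    rfl
  have hdist' : ∀ i j, dist (hf i).toLp (hf j).toLp ^ 2 = ∫ x, ‖f i x - f j x‖ ^ 2 ∂μ := by
    intro i j
    rw [hdist]
    refine integral_congr_ae ?_
    filter_upwards [(hf j).coeFn_toLp] with x hx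
    rw [hx]
  have hcau : CauchySeq fun i => (hf i).toLp := by
    rw [Metric.cauchySeq_iff]
    intro ε hε
    obtain ⟨N, hN⟩ := hC ((ε / 2) ^ 2) (by positivity)
    refine ⟨N, fun i hi j hj => ?_⟩
    have h1 := hN i hi j hj
    rw [← hdist'] at h1
    have h2 := le_of_sq_le_sq h1 (by positivity)
    linarith
  obtain ⟨w, hw⟩ := cauchySeq_tendsto_of_complete hcau
  refine ⟨w, Lp.memLp w, ?_⟩
  have h1 := (tendsto_iff_dist_tendsto_zero.1 hw).pow 2
  rw [zero_pow two_ne_zero] at h1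
  exact h1.congr fun i => hdist i w

end L2

theorem eventually_pairDist_lt {U : Set (Pt d)} {u : ℕ → Pt d → ℝ} {G : ℕ → Pt d → Pt d}
    {w : Pt d → ℝ} {W : Pt d → Pt d} (hu : ∀ i, HG U (u i) (G i))
    (hw : MemLp w 2 (volume.restrict U)) (hW : MemLp W 2 (volume.restrict U))
    (h1 : Tendsto (fun i => ∫ x in U, ‖u i x - w x‖ ^ 2) atTop (𝓝 0))
    (h2 : Tendsto (fun i => ∫ x in U, ‖G i x - W x‖ ^ 2) atTop (𝓝 0)) {ε : ℝ≥0∞} (hε : 0 < ε) :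
    ∀ᶠ i in atTop, pairDist U w W (u i) (G i) < ε := by
  have h3 : Tendsto (fun i => pairDist U w W (u i) (G i)) atTop (𝓝 0) := by
    have h4 := (ENNReal.tendsto_ofReal ((Real.continuous_sqrt.tendsto _).comp h1)).add
      (ENNReal.tendsto_ofReal ((Real.continuous_sqrt.tendsto _).comp h2))
    rw [Real.sqrt_zero, ENNReal.ofReal_zero, add_zero] at h4
    refine h4.congr fun i => ?_
    rw [pairDist_comm, pairDist, eLpNorm_two_eq_ofReal_sqrt ((hu i).1.sub hw),
      eLpNorm_two_eq_ofReal_sqrt ((hu i).2.1.sub hW)]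
    rfl
  exact h3.eventually (gt_mem_nhds hε)

/-! ### Poincaré inequality, completeness and compactness for closed subspaces of H¹ -/

/-- `∫_U |∇u|²`. -/
def dirichlet (U : Set (Pt d)) (u : Pt d → ℝ) : ℝ := ∫ x in U, ‖weakGrad U u x‖ ^ 2

theorem HG.dirichlet_eq {U : Set (Pt d)} (hU : IsOpen U) {u : Pt d → ℝ} {G : Pt d → Pt d}
    (h : HG U u G) : dirichlet U u = ∫ x in U, ‖G x‖ ^ 2 := by
  refine integral_congr_ae ?_
  filter_upwards [h.weakGrad_ae hU] with x hx
  rw [hx]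

theorem dirichlet_nonneg (U : Set (Pt d)) (u : Pt d → ℝ) : 0 ≤ dirichlet U u :=
  integral_nonneg fun _ => sq_nonneg _

/-- `V` contains all limits in `H¹(U)` of its elements. -/
def IsClosedH1 (U : Set (Pt d)) (V : Set (Pt d → ℝ)) : Prop :=
  ∀ z Z, HG U z Z → (∀ ε : ℝ≥0∞, 0 < ε → ∃ v ∈ V, pairDist U z Z v (weakGrad U v) < ε) → z ∈ V

section closed

variable {U : Set (Pt d)} {V : Submodule ℝ (Pt d → ℝ)}

/-- Otherwise there are elements of `V` with `L²` norm one and gradients tending to zero.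
Compactness gives an `L²` limit; it has zero gradient and lies in `V` by closedness, so it vanishes
by `hdef`, contradicting the norm. -/
theorem exists_poincare (hU : IsOpen U) (hc : CompactlyEmbedded U U) (hV : ∀ v ∈ V, MemH1 U v)
    (hcl : IsClosedH1 U (V : Set (Pt d → ℝ)))
    (hdef : ∀ v ∈ V, weakGrad U v =ᵐ[volume.restrict U] 0 → v =ᵐ[volume.restrict U] 0) :
    ∃ K : ℝ, 0 < K ∧ ∀ v ∈ V, ∫ x in U, ‖v x‖ ^ 2 ≤ K * dirichlet U v := by
  by_contra! hcon
  choose v hvV hv using fun k : ℕ => hcon ((k : ℝ) + 1) (by positivity)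
  set I : ℕ → ℝ := fun k => ∫ x in U, ‖v k x‖ ^ 2 with hI
  have hIpos : ∀ k, 0 < I k := fun k =>
    (mul_nonneg (by positivity) (dirichlet_nonneg U (v k))).trans_lt (hv k)
  have hsq : ∀ k, (√(I k))⁻¹ ^ 2 = (I k)⁻¹ := fun k => by
    rw [inv_pow, Real.sq_sqrt (hIpos k).le]
  let w : ℕ → Pt d → ℝ := fun k => (√(I k))⁻¹ • v k
  let W : ℕ → Pt d → Pt d := fun k => (√(I k))⁻¹ • weakGrad U (v k)
  have hwV : ∀ k, w k ∈ V := fun k => V.smul_mem _ (hvV k)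
  have hw : ∀ k, HG U (w k) (W k) := fun k => ((hV _ (hvV k)).hg hU).smul _
  have hw1 : ∀ k, ∫ x in U, ‖w k x‖ ^ 2 = 1 := by
    intro k
    simp only [w, Pi.smul_apply, norm_smul, mul_pow, norm_inv, Real.norm_eq_abs, inv_pow, sq_abs,
      Real.sq_sqrt (hIpos k).le, integral_const_mul]
    have : ∫ x in U, v k x ^ 2 = I k := by simp [hI]
    rw [this, inv_mul_cancel₀ (hIpos k).ne']
  have hW1 : ∀ k : ℕ, ∫ x in U, ‖W k x‖ ^ 2 ≤ 1 / ((k : ℝ) + 1) := by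
    intro k
    simp only [W, Pi.smul_apply, norm_smul, mul_pow, norm_inv, Real.norm_eq_abs, inv_pow, sq_abs,
      Real.sq_sqrt (hIpos k).le, integral_const_mul]
    rw [inv_mul_le_iff₀ (hIpos k), mul_one_div, le_div_iff₀ (by positivity), mul_comm]
    exact (hv k).le
  -- The squared norm of each function is one and that of its gradient at most one.
  obtain ⟨φ, hφ, hφC⟩ := hc.exists_subseq hw (B := 2) fun k => by
    rw [lintegral_enorm_sq_eq_ofReal (hw k).1, lintegral_enorm_sq_eq_ofReal (hw k).2.1,
      ← ENNReal.ofReal_add (by rw [hw1]; norm_num) (integral_nonneg fun _ => sq_nonneg _), hw1]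
    refine ENNReal.ofReal_le_ofReal ?_
    have h1 : 1 / ((k : ℝ) + 1) ≤ 1 := by
      rw [div_le_one (by positivity)]
      linarith [Nat.cast_nonneg (α := ℝ) k]
    linarith [hW1 k]
  obtain ⟨f, hf, hflim⟩ := exists_memLp_two_limit (fun i => (hw (φ i)).1) (by
    intro ε hε
    obtain ⟨N, hN⟩ := hφC (ENNReal.ofReal ε) (by simpa using hε)
    refine ⟨N, fun i hi j hj => ?_⟩
    have h1 := hN i hi j hj
    have h2 := lintegral_enorm_sq_eq_ofReal ((hw (φ i)).1.sub (hw (φ j)).1)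
    simp only [Pi.sub_apply] at h2
    rw [h2] at h1
    exact (ENNReal.ofReal_le_ofReal_iff hε.le).1 h1)
  have hWlim : Tendsto (fun i => ∫ x in U, ‖W (φ i) x - (0 : Pt d → Pt d) x‖ ^ 2) atTop (𝓝 0) := by
    simp only [Pi.zero_apply, sub_zero]
    exact squeeze_zero (fun i => integral_nonneg fun _ => sq_nonneg _) (fun i => hW1 _)
      (tendsto_one_div_add_atTop_nhds_zero_nat.comp hφ.tendsto_atTop)
  have hd := fun {ε : ℝ≥0∞} (hε : 0 < ε) => (eventually_pairDist_lt (fun i => hw (φ i)) hf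
    MemLp.zero hflim hWlim hε).exists
  have hf0 : HG U f 0 := HG.of_approx hf MemLp.zero fun ε hε => by
    obtain ⟨i, hi⟩ := hd hε
    exact ⟨_, _, hw _, hi⟩
  have hfV : f ∈ V := hcl f 0 hf0 fun ε hε => by
    obtain ⟨i, hi⟩ := hd hε
    refine ⟨_, hwV (φ i), ?_⟩
    rwa [pairDist_congr EventuallyEq.rfl EventuallyEq.rfl EventuallyEq.rfl
      ((hw (φ i)).weakGrad_ae hU)]
  have hfz := hdef f hfV (hf0.weakGrad_ae hU)
  have h1 : ∀ i, ∫ x in U, ‖w (φ i) x - f x‖ ^ 2 = 1 := by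
    intro i
    rw [← hw1 (φ i)]
    refine integral_congr_ae ?_
    filter_upwards [hfz] with x hx
    rw [hx, Pi.zero_apply, sub_zero]
  simp only [h1] at hflim
  exact one_ne_zero (tendsto_nhds_unique tendsto_const_nhds hflim)

/-- By the Poincaré inequality a sequence that is Cauchy in the Dirichlet norm is Cauchy in `H¹`,
and closedness keeps the limit in `V`. This supplies completeness for the spectral argument. -/
theorem exists_dirichlet_limit (hU : IsOpen U) (hV : ∀ v ∈ V, MemH1 U v)
    (hcl : IsClosedH1 U (V : Set (Pt d → ℝ))) {K : ℝ} (hK : 0 < K)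
    (hP : ∀ v ∈ V, ∫ x in U, ‖v x‖ ^ 2 ≤ K * dirichlet U v) {u : ℕ → Pt d → ℝ} (hu : ∀ i, u i ∈ V)
    (hC : ∀ ε > 0, ∃ N, ∀ i ≥ N, ∀ j ≥ N, dirichlet U (u i - u j) ≤ ε) :
    ∃ w ∈ V, Tendsto (fun i => dirichlet U (u i - w)) atTop (𝓝 0) := by
  have hg := fun i => (hV _ (hu i)).hg hU
  obtain ⟨W, hW, hWlim⟩ := exists_memLp_two_limit (fun i => (hg i).2.1) (by
    intro ε hε
    obtain ⟨N, hN⟩ := hC ε hε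
    refine ⟨N, fun i hi j hj => ?_⟩
    have h1 := hN i hi j hj
    rwa [((hg i).sub (hg j)).dirichlet_eq hU] at h1)
  obtain ⟨w, hw, hwlim⟩ := exists_memLp_two_limit (fun i => (hg i).1) (by
    intro ε hε
    obtain ⟨N, hN⟩ := hC (ε / K) (by positivity)
    refine ⟨N, fun i hi j hj => (hP _ (V.sub_mem (hu i) (hu j))).trans ?_⟩
    rw [mul_comm, ← le_div_iff₀ hK]
    exact hN i hi j hj)
  have hd := fun {ε : ℝ≥0∞} (hε : 0 < ε) =>
    (eventually_pairDist_lt hg hw hW hwlim hWlim hε).exists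
  have hwW : HG U w W := HG.of_approx hw hW fun ε hε => by
    obtain ⟨i, hi⟩ := hd hε
    exact ⟨_, _, hg i, hi⟩
  refine ⟨w, hcl w W hwW fun ε hε => ?_, hWlim.congr fun i => ?_⟩
  · obtain ⟨i, hi⟩ := hd hε
    exact ⟨_, hu i, hi⟩
  · rw [((hg i).sub hwW).dirichlet_eq hU]
    rfl

theorem exists_subseq_cauchy_of_dirichlet_le (hU : IsOpen U) (hc : CompactlyEmbedded U U)
    (hV : ∀ v ∈ V, MemH1 U v) {K : ℝ} (hK : 0 < K)
    (hP : ∀ v ∈ V, ∫ x in U, ‖v x‖ ^ 2 ≤ K * dirichlet U v) {u : ℕ → Pt d → ℝ} (hu : ∀ i, u i ∈ V)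
    {B : ℝ} (hB : ∀ i, dirichlet U (u i) ≤ B) :
    ∃ φ : ℕ → ℕ, StrictMono φ ∧ ∀ ε > 0, ∃ N, ∀ i ≥ N, ∀ j ≥ N,
      ∫ x in U, ‖u (φ i) x - u (φ j) x‖ ^ 2 ≤ ε := by
  have hg := fun i => (hV _ (hu i)).hg hU
  obtain ⟨φ, hφ, hφC⟩ := hc.exists_subseq hg (B := K * B + B) fun k => by
    rw [lintegral_enorm_sq_eq_ofReal (hg k).1, lintegral_enorm_sq_eq_ofReal (hg k).2.1,
      ← ENNReal.ofReal_add (integral_nonneg fun _ => sq_nonneg _)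
        (integral_nonneg fun _ => sq_nonneg _)]
    refine ENNReal.ofReal_le_ofReal (add_le_add ((hP _ (hu k)).trans ?_) (hB k))
    exact mul_le_mul_of_nonneg_left (hB k) hK.le
  refine ⟨φ, hφ, fun ε hε => ?_⟩
  obtain ⟨N, hN⟩ := hφC (ENNReal.ofReal ε) (by simpa using hε)
  refine ⟨N, fun i hi j hj => ?_⟩
  have h1 := hN i hi j hj
  have h2 := lintegral_enorm_sq_eq_ofReal ((hg (φ i)).1.sub (hg (φ j)).1)
  simp only [Pi.sub_apply] at h2
  rw [h2] at h1
  exact (ENNReal.ofReal_le_ofReal_iff hε.le).1 h1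

end closed

theorem MemW1Infty.exists_hg {U : Set (Pt d)} {f : Pt d → ℝ} (hU : IsOpen U)
    (hb : Bornology.IsBounded U) (h : MemW1Infty U f) :
    ∃ g C, HG U f g ∧ (∀ᵐ x ∂(volume.restrict U), |f x| ≤ C) ∧
      ∀ᵐ x ∂(volume.restrict U), ‖g x‖ ≤ C := by
  obtain ⟨hf, ⟨C, hC⟩, g, hg, hg'⟩ := h
  have hfin : IsFiniteMeasure (volume.restrict U) := ⟨by
    rw [Measure.restrict_apply_univ]; exact hb.measure_lt_top⟩
  have hC1 : ∀ᵐ x ∂(volume.restrict U), |f x| ≤ C := by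
    filter_upwards [ae_restrict_mem hU.measurableSet] with x hx using hC x hx
  have hfm : AEStronglyMeasurable f (volume.restrict U) :=
    hf.aestronglyMeasurable hU.measurableSet
  refine ⟨g, max C (eLpNorm g ∞ (volume.restrict U)).toReal,
    ⟨MemLp.of_bound hfm C (by simpa using hC1), hg'.mono_exponent le_top, hg.2.2⟩, ?_, ?_⟩
  · filter_upwards [hC1] with x hx using hx.trans (le_max_left _ _)
  · have h1 := ae_le_eLpNormEssSup (f := g) (μ := volume.restrict U)
    filter_upwards [h1] with x hx
    refine le_trans ?_ (le_max_right _ _)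
    rw [← eLpNorm_exponent_top] at hx
    have h2 := ENNReal.toReal_mono hg'.2.ne hx
    simpa using h2

theorem form_indicator_right {A : Pt d → Matrix (Fin d) (Fin d) ℝ} {U W : Set (Pt d)}
    (hW : MeasurableSet W) (hWU : W ⊆ U) (G H : Pt d → Pt d) :
    form A U G (W.indicator H) = form A W G H := by
  have h1 : ∀ x, inner ℝ (Matrix.toEuclideanLin (A x) (G x)) (W.indicator H x) =
      W.indicator (fun x => inner ℝ (Matrix.toEuclideanLin (A x) (G x)) (H x)) x := by
    intro x
    by_cases hx : x ∈ W <;> simp [hx]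
  rw [form, form]
  simp only [h1]
  rw [setIntegral_indicator hW, inter_eq_self_of_subset_right hWU]

/-- Extension by zero maps `H¹₀(W)` into `H¹₀(U)`, so every test function on the smaller set is
admissible on the larger one. -/
theorem harmonicSpace_mono {A : Pt d → Matrix (Fin d) (Fin d) ℝ} {U W : Set (Pt d)}
    (hU : IsOpen U) (hW : IsOpen W) (hWU : W ⊆ U) {v : Pt d → ℝ} (hv : v ∈ harmonicSpace A U) :
    v ∈ harmonicSpace A W := by
  refine ⟨hv.1.mono hU hWU, fun φ hφ => ?_⟩
  have h1 := (hφ.h0 hW).indicator hW.measurableSet hWU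
  have h2 := hv.2 _ (h1.memH10 hU)
  rw [(hv.1.hg hU).energy_eq hU h1.1, form_indicator_right hW.measurableSet hWU] at h2
  rwa [((hv.1.hg hU).mono hWU).energy_eq hW (hφ.1.hg hW)]

theorem frontier_inter_frontier_subset {U W Ω : Set (Pt d)} (hU : IsOpen U) (hΩ : IsOpen Ω)
    (hWU : W ⊆ U) (hUΩ : U ⊆ Ω) : frontier W ∩ frontier Ω ⊆ frontier U ∩ frontier Ω := by
  rintro x ⟨hx, hxΩ⟩
  refine ⟨⟨closure_mono hWU hx.1, fun h => ?_⟩, hxΩ⟩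
  rw [hU.interior_eq] at h
  rw [hΩ.frontier_eq] at hxΩ
  exact hxΩ.2 (hUΩ h)

/-! ### The cut-off functions of the ring and Caccioppoli's inequality -/

namespace RingSetup

variable (S : RingSetup d)

theorem Rs_subset_Ω : S.Rs ⊆ S.Ω := S.Rs_subset.trans S.oms_subset

theorem R_subset_oms : S.R ⊆ S.oms := S.R_subset_Rs.trans S.Rs_subset

theorem om_subset_Ω : S.om ⊆ S.Ω := S.om_subset.trans S.oms_subset

theorem omt_subset_om : S.omt ⊆ S.om := by
  rw [← S.omt_union_R]
  exact subset_union_left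

theorem omt_subset_oms : S.omt ⊆ S.oms := S.omt_subset_om.trans S.om_subset

theorem exists_isElliptic : ∃ α β, IsElliptic S.Ω S.A α β := by
  obtain ⟨α, β, hα, h⟩ := S.elliptic_A
  refine ⟨α, β, hα, S.measurable_A, ?_⟩
  filter_upwards [S.symm_A, h] with x h1 h2 using ⟨h1, h2⟩

variable {S}

/-- Inside `Ω` the boundary of `omt` lies in `R ⊆ om`, so `omt` cannot accumulate at a point of `Ω`
outside `om`. -/
theorem notMem_closure_omt {x : Pt d} (hx : x ∈ S.Ω) (hxom : x ∉ S.om) :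
    x ∉ closure S.omt := by
  intro h
  refine hxom (S.R_subset_om (S.frontier_omt ⟨⟨h, fun h' => ?_⟩, hx⟩))
  exact hxom (S.omt_subset_om (interior_subset h'))

theorem χR_eq_zero {x : Pt d} (hx : x ∈ S.oms) (hxR : x ∉ S.R) : S.χR x = 0 := by
  by_cases h : x ∈ S.om
  · have h1 : x ∈ S.omt := by
      rw [← S.omt_union_R] at h
      exact h.resolve_right hxR
    simp [χR, S.η_eq_one x ⟨h, hxR⟩, S.χ_eq_one x h1]
  · simp [χR, S.χ_support x ⟨S.oms_subset hx, h⟩,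
      S.η_eq_zero x ⟨hx, fun h' => h (S.omt_subset_om h')⟩]

theorem abs_χR_le {x : Pt d} (hx : x ∈ S.oms) : |S.χR x| ≤ 1 := by
  have h1 := S.χ_mem x (S.oms_subset hx)
  have h2 := S.η_mem x hx
  rw [abs_le, χR, Pi.sub_apply]
  constructor <;> linarith

theorem continuousOn_χR : ContinuousOn S.χR S.oms :=
  (S.χ_w1infty.1.mono S.oms_subset).sub S.η_w1infty.1

theorem eventually_abs_lt {ψ : Pt d → ℝ} {U : Set (Pt d)} (hU : IsOpen U) (hψ : ContinuousOn ψ U)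
    {x : Pt d} (hx : x ∈ U) (h0 : ψ x = 0) {ε : ℝ} (hε : 0 < ε) : ∀ᶠ y in 𝓝 x, |ψ y| < ε := by
  have h1 := ((hψ.continuousAt (hU.mem_nhds hx)).abs).tendsto
  rw [h0, abs_zero] at h1
  exact h1.eventually (gt_mem_nhds hε)

theorem eventually_η_eq_zero {x : Pt d} (hx : x ∈ S.Ω) (hxom : x ∉ S.om) :
    ∀ᶠ y in 𝓝 x, y ∈ S.oms → S.η y = 0 := by
  filter_upwards [isClosed_closure.isOpen_compl.mem_nhds (notMem_closure_omt hx hxom)] with y hy hy'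
  exact S.η_eq_zero y ⟨hy', fun h => hy (subset_closure h)⟩

/-- The point may lie on the boundary of `oms`, where `η` need not be continuous. There `χ` is still
continuous and vanishes, and `η` is zero nearby because `omt` stays away. -/
theorem eventually_abs_χR_lt {x : Pt d} (hx : x ∈ S.Ω) (hxR : x ∉ S.R) {ε : ℝ} (hε : 0 < ε) :
    ∀ᶠ y in 𝓝 x, y ∈ S.oms → |S.χR y| < ε := by
  by_cases h : x ∈ S.om
  · filter_upwards [eventually_abs_lt S.isOpen_oms continuousOn_χR (S.om_subset h)
      (χR_eq_zero (S.om_subset h) hxR) hε] with y hy _ using hy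
  · filter_upwards [eventually_abs_lt S.isOpen_Ω S.χ_w1infty.1 hx (S.χ_support x ⟨hx, h⟩) hε,
      eventually_η_eq_zero hx h] with y hy hy' hyo
    rwa [χR, Pi.sub_apply, hy' hyo, sub_zero]

theorem eventually_abs_η_lt {x : Pt d} (hx : x ∈ S.Ω) (hxo : x ∉ S.omt) {ε : ℝ} (hε : 0 < ε) :
    ∀ᶠ y in 𝓝 x, y ∈ S.oms → |S.η y| < ε := by
  by_cases h : x ∈ S.om
  · filter_upwards [eventually_abs_lt S.isOpen_oms S.η_w1infty.1 (S.om_subset h)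
      (S.η_eq_zero x ⟨S.om_subset h, hxo⟩) hε] with y hy _ using hy
  · filter_upwards [eventually_η_eq_zero hx h] with y hy hyo
    rwa [hy hyo, abs_zero]

/-- Take the closure of the set where `|ψ| ≥ ε` outside `N`. A point of this closure outside `Ω`
would lie on `∂U ∩ ∂Ω ⊆ N`, and one in `Ω \ W` is excluded by the smallness of `ψ` near it. This is
the geometric hypothesis of `HV.h0_mul_cutoff`. -/
theorem exists_isCompact_cutoff {U W : Set (Pt d)} {ψ : Pt d → ℝ} (hU : IsOpen U)
    (hUo : U ⊆ S.oms)
    (h : ∀ x ∈ S.Ω, x ∉ W → ∀ ε : ℝ, 0 < ε → ∀ᶠ y in 𝓝 x, y ∈ S.oms → |ψ y| < ε)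
    (ε : ℝ) (hε : 0 < ε) (N : Set (Pt d)) (hN : IsOpen N)
    (hΓ : frontier U ∩ frontier S.Ω ⊆ N) :
    ∃ K, IsCompact K ∧ K ⊆ W ∧ ∀ x ∈ U, x ∉ K → |ψ x| ≤ ε ∨ x ∈ N := by
  have hUΩ := hUo.trans S.oms_subset
  let T : Set (Pt d) := {x | x ∈ U ∧ ε ≤ |ψ x| ∧ x ∉ N}
  have hTU : T ⊆ U := fun x hx => hx.1
  refine ⟨closure T, ?_, fun x hx => ?_, fun x hx hxK => ?_⟩
  · exact (S.isBounded_Ω.subset (hTU.trans hUΩ)).isCompact_closure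
  · have hxN : x ∉ N := by
      have : closure T ⊆ Nᶜ := closure_minimal (fun y hy => hy.2.2) hN.isClosed_compl
      exact this hx
    by_contra hxW
    have hxΩ : x ∈ S.Ω := by
      by_contra hxΩ
      have hxU : x ∈ closure U := closure_mono hTU hx
      refine hxN (hΓ ⟨?_, ?_⟩)
      · rw [hU.frontier_eq]
        exact ⟨hxU, fun h' => hxΩ (hUΩ h')⟩
      · rw [S.isOpen_Ω.frontier_eq]
        exact ⟨closure_mono hUΩ hxU, hxΩ⟩
    obtain ⟨y, hy, hyT⟩ := ((mem_closure_iff_frequently.1 hx).and_eventually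
      (h x hxΩ hxW ε hε)).exists
    exact absurd (hyT (hUo hy.1)) (not_lt.2 hy.2.1)
  · by_contra! hcon
    exact hxK (subset_closure ⟨hx, hcon.1.le, hcon.2⟩)

variable (S) in
theorem exists_hg_χR : ∃ g C, HG S.oms S.χR g ∧ (∀ᵐ x ∂(volume.restrict S.oms), |S.χR x| ≤ C) ∧
    ∀ᵐ x ∂(volume.restrict S.oms), ‖g x‖ ≤ C := by
  obtain ⟨g, C, hg, -, hgC⟩ := S.χ_w1infty.exists_hg S.isOpen_Ω S.isBounded_Ω
  obtain ⟨g', C', hg', -, hgC'⟩ := S.η_w1infty.exists_hg S.isOpen_oms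
    (S.isBounded_Ω.subset S.oms_subset)
  refine ⟨g - g', max 1 (C + C'), (hg.mono S.oms_subset).sub hg', ?_, ?_⟩
  · filter_upwards [ae_restrict_mem S.isOpen_oms.measurableSet] with x hx
    exact (abs_χR_le hx).trans (le_max_left _ _)
  · filter_upwards [ae_restrict_of_ae_restrict_of_subset S.oms_subset hgC, hgC'] with x h1 h2
    exact (norm_sub_le _ _).trans ((add_le_add h1 h2).trans (le_max_right _ _))

variable (S) in
/-- The part of the boundary of `U` on `∂Ω`. -/
def bdry (U : Set (Pt d)) : Set (Pt d) := frontier U ∩ frontier S.Ω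

section cutoff

variable {g : Pt d → Pt d} {C : ℝ} {z : Pt d → ℝ} {Z : Pt d → Pt d}

theorem h0_χR_mul (hg : HG S.oms S.χR g) (hC : ∀ᵐ x ∂(volume.restrict S.oms), |S.χR x| ≤ C)
    (hC' : ∀ᵐ x ∂(volume.restrict S.oms), ‖g x‖ ≤ C) (hz : HV S.Rs (S.bdry S.Rs) z Z) :
    H0 S.R (fun x => S.χR x * z x) (fun x => S.χR x • Z x + z x • g x) :=
  hz.h0_mul_cutoff S.isOpen_Rs S.isOpen_R S.R_subset_Rs (hg.mono S.Rs_subset)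
    (ae_restrict_of_ae_restrict_of_subset S.Rs_subset hC)
    (ae_restrict_of_ae_restrict_of_subset S.Rs_subset hC')
    (exists_isCompact_cutoff S.isOpen_Rs S.Rs_subset
      fun _ hx hxR _ hε => eventually_abs_χR_lt hx hxR hε)

/-- Provides the test function `(χ^R)² z` for Caccioppoli's inequality, together with its gradient.
-/
theorem memH10_χR_sq_mul (hg : HG S.oms S.χR g)
    (hC : ∀ᵐ x ∂(volume.restrict S.oms), |S.χR x| ≤ C)
    (hC' : ∀ᵐ x ∂(volume.restrict S.oms), ‖g x‖ ≤ C) (hz : HV S.Rs (S.bdry S.Rs) z Z) :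
    MemH10 S.Rs (fun x => S.χR x * S.χR x * z x) ∧
    HG S.Rs (fun x => S.χR x * S.χR x * z x)
      (fun x => (S.χR x * S.χR x) • Z x + z x • (S.χR x • g x + S.χR x • g x)) := by
  have hg2 : HG S.Rs (fun x => S.χR x * S.χR x) (fun x => S.χR x • g x + S.χR x • g x) :=
    (hg.mul_of_bound S.isOpen_oms hg hC hC').mono S.Rs_subset
  have hb : ∀ᵐ x ∂(volume.restrict S.Rs), |S.χR x * S.χR x| ≤ max 1 (2 * C) := by
    filter_upwards [ae_restrict_mem S.isOpen_Rs.measurableSet] with x hx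
    rw [abs_mul]
    exact (mul_le_one₀ (abs_χR_le (S.Rs_subset hx)) (abs_nonneg _)
      (abs_χR_le (S.Rs_subset hx))).trans (le_max_left _ _)
  have hb' : ∀ᵐ x ∂(volume.restrict S.Rs), ‖S.χR x • g x + S.χR x • g x‖ ≤ max 1 (2 * C) := by
    filter_upwards [ae_restrict_mem S.isOpen_Rs.measurableSet,
      ae_restrict_of_ae_restrict_of_subset S.Rs_subset hC'] with x hx hx'
    refine le_trans ?_ (le_max_right _ _)
    have h1 : ‖S.χR x • g x‖ ≤ C := by
      rw [norm_smul, Real.norm_eq_abs]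
      exact (mul_le_of_le_one_left (norm_nonneg _) (abs_χR_le (S.Rs_subset hx))).trans hx'
    linarith [norm_add_le (S.χR x • g x) (S.χR x • g x)]
  have h1 := hz.h0_mul_cutoff S.isOpen_Rs S.isOpen_R S.R_subset_Rs hg2 hb hb'
    (exists_isCompact_cutoff S.isOpen_Rs S.Rs_subset fun x hx hxR ε hε => by
      filter_upwards [eventually_abs_χR_lt hx hxR hε] with y hy hyo
      rw [abs_mul]
      exact (mul_le_of_le_one_left (abs_nonneg _) (abs_χR_le hyo)).trans_lt (hy hyo))
  have h2 := hz.1.mul_of_bound S.isOpen_Rs hg2 hb hb'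
  refine ⟨?_, h2⟩
  have h3 := h1.indicator S.isOpen_R.measurableSet S.R_subset_Rs
  refine (h3.congr (v := fun x => S.χR x * S.χR x * z x) ?_ EventuallyEq.rfl).memH10 S.isOpen_Rs
  filter_upwards [ae_restrict_mem S.isOpen_Rs.measurableSet] with x hx
  by_cases hxR : x ∈ S.R
  · rw [indicator_of_mem hxR]
  · rw [indicator_of_notMem hxR, χR_eq_zero (S.Rs_subset hx) hxR]
    ring

theorem memH10_η_mul (hz : HV S.oms (S.bdry S.oms) z Z) : MemH10 S.omt (S.η * z) := by
  obtain ⟨g, C, hg, hC, hC'⟩ := S.η_w1infty.exists_hg S.isOpen_oms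
    (S.isBounded_Ω.subset S.oms_subset)
  exact (hz.h0_mul_cutoff S.isOpen_oms S.isOpen_omt S.omt_subset_oms hg hC hC'
    (exists_isCompact_cutoff S.isOpen_oms subset_rfl
      fun _ hx hxR _ hε => eventually_abs_η_lt hx hxR hε)).memH10 S.isOpen_omt

/-- Caccioppoli's inequality. -/
theorem exists_caccioppoli : ∃ K : ℝ, 0 ≤ K ∧ ∀ z ∈ S.boundarySpace S.Rs,
    energy S.A S.R (S.χR * z) (S.χR * z) ≤ K * ∫ x in S.Rs, ‖z x‖ ^ 2 := by
  obtain ⟨α, β, hell⟩ := S.exists_isElliptic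
  obtain ⟨g, C, hg, hC, hC'⟩ := S.exists_hg_χR
  have hA := hell.mono S.Rs_subset_Ω
  refine ⟨|β| * C ^ 2, by positivity, fun z hz => ?_⟩
  have hzv := hz.2.hv S.isOpen_Rs
  set Z := weakGrad S.Rs z
  have h0 := h0_χR_mul hg hC hC' hzv
  obtain ⟨hm, hsq⟩ := memH10_χR_sq_mul hg hC hC' hzv
  have hCR := ae_restrict_of_ae_restrict_of_subset S.Rs_subset hC
  have hCR' := ae_restrict_of_ae_restrict_of_subset S.Rs_subset hC'
  have hF := (hzv.1.mul_of_bound S.isOpen_Rs (hg.mono S.Rs_subset) hCR hCR').2.1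
  have hzg : MemLp (fun x => z x • g x) 2 (volume.restrict S.Rs) :=
    memLp_smul_of_bound_right hzv.1.1 (hg.mono S.Rs_subset).2.1.1 hCR'
  -- Operator-harmonicity of `z`, tested with `(χ^R)² z`.
  have h1 : form S.A S.Rs Z (fun x => (S.χR x * S.χR x) • Z x +
      z x • (S.χR x • g x + S.χR x • g x)) = 0 := by
    rw [← hzv.1.energy_eq S.isOpen_Rs hsq]
    exact hz.1.2 _ hm
  have h2 : energy S.A S.R (S.χR * z) (S.χR * z) =
      form S.A S.R (fun x => S.χR x • Z x + z x • g x) (fun x => S.χR x • Z x + z x • g x) :=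
    h0.1.energy_eq S.isOpen_R h0.1
  rw [h2]
  refine (hA.form_self_mono S.R_subset_Rs hF).trans ?_
  -- Expanding the square and using the symmetry of `A`, every term containing `Z` is absorbed into
  -- the vanishing pairing; only the term with `z g` remains, and it is controlled by the `L²` norm
  -- of `z`.
  have h3 : form S.A S.Rs (fun x => S.χR x • Z x + z x • g x)
      (fun x => S.χR x • Z x + z x • g x) =
      form S.A S.Rs Z (fun x => (S.χR x * S.χR x) • Z x +
        z x • (S.χR x • g x + S.χR x • g x)) +
      form S.A S.Rs (fun x => z x • g x) (fun x => z x • g x) := by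
    rw [form, form, form, ← integral_add (hA.integrable hzv.1.2.1 hsq.2.1)
      (hA.integrable hzg hzg)]
    refine integral_congr_ae ?_
    filter_upwards [hA.2.2] with x hx
    have hs := inner_toEuclideanLin_comm hx.1 (g x) (Z x)
    simp only [map_add, map_smul, inner_add_left, inner_add_right, inner_smul_left,
      inner_smul_right, RCLike.conj_to_real, hs]
    ring
  rw [h3, h1, zero_add]
  refine (hA.form_self_le hzg).trans ?_
  rw [mul_assoc]
  refine (mul_le_mul_of_nonneg_right (le_abs_self β)
    (integral_nonneg fun _ => sq_nonneg _)).trans (mul_le_mul_of_nonneg_left ?_ (abs_nonneg _))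
  rw [← integral_const_mul]
  refine integral_mono_ae hzg.norm.integrable_sq (hzv.1.1.norm.integrable_sq.const_mul _) ?_
  filter_upwards [hCR'] with x hx
  simp only [norm_smul, mul_pow]
  rw [mul_comm]
  exact mul_le_mul_of_nonneg_right (pow_le_pow_left₀ (norm_nonneg _) hx 2) (sq_nonneg _)

end cutoff

end RingSetup

/-! ### Linear structure and closedness of the function spaces -/

section submodules

variable {U Γ : Set (Pt d)} {u v : Pt d → ℝ} {G H : Pt d → Pt d}

theorem pairDist_add_le {u' v' : Pt d → ℝ} {G' H' : Pt d → Pt d} (hu : HG U u G) (hv : HG U v H)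
    (hu' : HG U u' G') (hv' : HG U v' H') :
    pairDist U (u + v) (G + H) (u' + v') (G' + H') ≤ pairDist U u G u' G' + pairDist U v H v' H' := by
  rw [pairDist, pairDist, pairDist, add_sub_add_comm, add_sub_add_comm, add_add_add_comm]
  exact add_le_add (eLpNorm_add_le (hu.1.sub hu'.1).1 (hv.1.sub hv'.1).1 one_le_two)
    (eLpNorm_add_le (hu.2.1.sub hu'.2.1).1 (hv.2.1.sub hv'.2.1).1 one_le_two)

theorem pairDist_smul (c : ℝ) (u v : Pt d → ℝ) (G H : Pt d → Pt d) :
    pairDist U (c • u) (c • G) (c • v) (c • H) = ‖c‖ₑ * pairDist U u G v H := by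
  rw [pairDist, pairDist, ← smul_sub, ← smul_sub, eLpNorm_const_smul, eLpNorm_const_smul, mul_add]

theorem exists_pos_enorm_mul_lt (c : ℝ) {ε : ℝ≥0∞} (hε : 0 < ε) :
    ∃ δ : ℝ≥0∞, 0 < δ ∧ ∀ t < δ, ‖c‖ₑ * t < ε := by
  obtain ⟨r, hr, h⟩ := ENNReal.exists_nnreal_pos_mul_lt (a := ‖c‖ₑ) enorm_ne_top hε.ne'
  refine ⟨r, by simpa using hr, fun t ht => lt_of_le_of_lt ?_ h⟩
  rw [mul_comm]
  exact mul_le_mul_left ht.le _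

theorem HV.zero (U Γ : Set (Pt d)) : HV U Γ 0 0 :=
  ⟨HG.zero U, fun ε hε => ⟨0, 0, HG.zero U, ⟨univ, isOpen_univ, subset_univ _, by simp⟩,
    by simpa [pairDist] using hε⟩⟩

theorem HV.add (hu : HV U Γ u G) (hv : HV U Γ v H) : HV U Γ (u + v) (G + H) := by
  refine ⟨hu.1.add hv.1, fun ε hε => ?_⟩
  obtain ⟨u', G', hu', ⟨N, hN, hΓN, hN0⟩, hd⟩ := hu.2 (ε / 2) (ENNReal.half_pos hε.ne')
  obtain ⟨v', H', hv', ⟨N', hN', hΓN', hN0'⟩, hd'⟩ := hv.2 (ε / 2) (ENNReal.half_pos hε.ne')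
  refine ⟨u' + v', G' + H', hu'.add hv', ⟨N ∩ N', hN.inter hN', subset_inter hΓN hΓN', ?_⟩,
    (pairDist_add_le hu.1 hv.1 hu' hv').trans_lt ?_⟩
  · filter_upwards [hN0, hN0'] with x h1 h2 hx
    simp [h1 hx.1, h2 hx.2]
  · rw [← ENNReal.add_halves ε]
    exact ENNReal.add_lt_add hd hd'

theorem HV.smul (hu : HV U Γ u G) (c : ℝ) : HV U Γ (c • u) (c • G) := by
  refine ⟨hu.1.smul c, fun ε hε => ?_⟩
  obtain ⟨δ, hδ, hδε⟩ := exists_pos_enorm_mul_lt c hε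
  obtain ⟨u', G', hu', ⟨N, hN, hΓN, hN0⟩, hd⟩ := hu.2 δ hδ
  refine ⟨c • u', c • G', hu'.smul c, ⟨N, hN, hΓN, ?_⟩, ?_⟩
  · filter_upwards [hN0] with x h1 hx
    simp [h1 hx]
  · rw [pairDist_smul]
    exact hδε _ hd

theorem HV.of_approx (hu : HG U u G)
    (h : ∀ ε : ℝ≥0∞, 0 < ε → ∃ v H, HV U Γ v H ∧ pairDist U u G v H < ε) : HV U Γ u G := by
  refine ⟨hu, fun ε hε => ?_⟩
  obtain ⟨v, H, hv, hd⟩ := h (ε / 2) (ENNReal.half_pos hε.ne')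
  obtain ⟨v', H', hv', hN, hd'⟩ := hv.2 (ε / 2) (ENNReal.half_pos hε.ne')
  refine ⟨v', H', hv', hN, (pairDist_triangle hu hv.1 hv').trans_lt ?_⟩
  rw [← ENNReal.add_halves ε]
  exact ENNReal.add_lt_add hd hd'

theorem IsTestFunction.add {φ ψ : Pt d → ℝ} (hφ : IsTestFunction U φ) (hψ : IsTestFunction U ψ) :
    IsTestFunction U (φ + ψ) :=
  ⟨hφ.1.add hψ.1, hφ.2.1.add hψ.2.1,
    (tsupport_add φ ψ).trans (union_subset hφ.2.2 hψ.2.2)⟩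

theorem IsTestFunction.smul {φ : Pt d → ℝ} (hφ : IsTestFunction U φ) (c : ℝ) :
    IsTestFunction U (c • φ) :=
  ⟨hφ.1.const_smul c, hφ.2.1.smul_left (f := fun _ => c),
    (tsupport_smul_subset_right (fun _ => c) φ).trans hφ.2.2⟩

theorem H0.add (hu : H0 U u G) (hv : H0 U v H) : H0 U (u + v) (G + H) := by
  refine ⟨hu.1.add hv.1, fun ε hε => ?_⟩
  obtain ⟨φ, hφ, hd⟩ := hu.2 (ε / 2) (ENNReal.half_pos hε.ne')
  obtain ⟨ψ, hψ, hd'⟩ := hv.2 (ε / 2) (ENNReal.half_pos hε.ne')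
  have hg : gradient (φ + ψ) = gradient φ + gradient ψ := by
    funext x
    simp only [gradient, Pi.add_apply]
    rw [fderiv_add ((hφ.1.differentiable (by simp)) x) ((hψ.1.differentiable (by simp)) x), map_add]
  refine ⟨φ + ψ, hφ.add hψ, ?_⟩
  rw [hg]
  refine (pairDist_add_le hu.1 hv.1 (hφ.hg U) (hψ.hg U)).trans_lt ?_
  rw [← ENNReal.add_halves ε]
  exact ENNReal.add_lt_add hd hd'

theorem H0.smul (hu : H0 U u G) (c : ℝ) : H0 U (c • u) (c • G) := by
  refine ⟨hu.1.smul c, fun ε hε => ?_⟩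
  obtain ⟨δ, hδ, hδε⟩ := exists_pos_enorm_mul_lt c hε
  obtain ⟨φ, hφ, hd⟩ := hu.2 δ hδ
  have hg : gradient (c • φ) = c • gradient φ := by
    funext x
    simp only [gradient, Pi.smul_apply]
    rw [fderiv_const_smul ((hφ.1.differentiable (by simp)) x), map_smul]
  refine ⟨c • φ, hφ.smul c, ?_⟩
  rw [hg, pairDist_smul]
  exact hδε _ hd

theorem H0.zero (U : Set (Pt d)) : H0 U 0 0 :=
  ⟨HG.zero U, fun ε hε => ⟨0, ⟨contDiff_const, HasCompactSupport.zero, by simp [tsupport]⟩, by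
    have : gradient (0 : Pt d → ℝ) = 0 := by
      funext x
      simp [gradient]
    simpa [pairDist, this] using hε⟩⟩

/-- `H¹₀(U)` as a subspace. -/
def h10Submodule (hU : IsOpen U) : Submodule ℝ (Pt d → ℝ) where
  carrier := {u | MemH10 U u}
  add_mem' hu hv := ((hu.h0 hU).add (hv.h0 hU)).memH10 hU
  zero_mem' := (H0.zero U).memH10 hU
  smul_mem' c _ hu := ((hu.h0 hU).smul c).memH10 hU

variable {A : Pt d → Matrix (Fin d) (Fin d) ℝ} {α β : ℝ}

theorem MemH1.add (hU : IsOpen U) (hu : MemH1 U u) (hv : MemH1 U v) : MemH1 U (u + v) :=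
  ((hu.hg hU).add (hv.hg hU)).memH1

theorem MemH1.sub (hU : IsOpen U) (hu : MemH1 U u) (hv : MemH1 U v) : MemH1 U (u - v) :=
  ((hu.hg hU).sub (hv.hg hU)).memH1

theorem MemH1.smul (hU : IsOpen U) (hu : MemH1 U u) (c : ℝ) : MemH1 U (c • u) :=
  ((hu.hg hU).smul c).memH1

/-- The space `H_a(U)` as a subspace. -/
def harmonicSubmodule (hU : IsOpen U) (hA : IsElliptic U A α β) : Submodule ℝ (Pt d → ℝ) where
  carrier := harmonicSpace A U
  add_mem' {u v} hu hv := ⟨hu.1.add hU hv.1, fun φ hφ => by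
    rw [hA.energy_add_left hU hu.1 hv.1 hφ.1, hu.2 φ hφ, hv.2 φ hφ, add_zero]⟩
  zero_mem' := ⟨(HG.zero U).memH1, fun φ hφ => by
    have := energy_smul_left (A := A) hU 0 (HG.zero U).memH1 hφ.1
    rwa [zero_smul, zero_mul] at this⟩
  smul_mem' c u hu := ⟨hu.1.smul hU c, fun φ hφ => by
    rw [energy_smul_left hU c hu.1 hφ.1, hu.2 φ hφ, mul_zero]⟩

theorem IsElliptic.abs_form_le (hA : IsElliptic U A α β) (hG : MemLp G 2 (volume.restrict U))
    (hH : MemLp H 2 (volume.restrict U)) :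
    |form A U G H| ≤ |β| * (eLpNorm G 2 (volume.restrict U)).toReal *
      (eLpNorm H 2 (volume.restrict U)).toReal := by
  refine (abs_integral_inner_le (hA.memLp hG) hH).trans
    (mul_le_mul_of_nonneg_right ?_ ENNReal.toReal_nonneg)
  have h1 : eLpNorm (fun x => Matrix.toEuclideanLin (A x) (G x)) 2 (volume.restrict U) ≤
      eLpNorm (fun x => |β| • G x) 2 (volume.restrict U) := by
    refine eLpNorm_mono_ae ?_
    filter_upwards [hA.2.2] with x hx
    rw [norm_smul, Real.norm_eq_abs, abs_abs]
    exact norm_toEuclideanLin_le hx.1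
      (fun ξ => (mul_nonneg hA.1.le (sq_nonneg _)).trans (hx.2 ξ).1) (fun ξ => (hx.2 ξ).2) (G x)
  refine (ENNReal.toReal_mono (hG.const_smul |β|).2.ne h1).trans (le_of_eq ?_)
  have h2 := eLpNorm_const_smul |β| G 2 (volume.restrict U)
  change (eLpNorm (|β| • G) 2 (volume.restrict U)).toReal = _
  rw [h2, ENNReal.toReal_mul]
  simp

theorem IsElliptic.form_sub_left (hA : IsElliptic U A α β) {G' : Pt d → Pt d}
    (hG : MemLp G 2 (volume.restrict U)) (hG' : MemLp G' 2 (volume.restrict U))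
    (hH : MemLp H 2 (volume.restrict U)) :
    form A U (G - G') H = form A U G H - form A U G' H := by
  have h1 := hA.form_add_left hG (hG'.const_smul (-1 : ℝ)) hH
  rw [form_smul_left] at h1
  rw [sub_eq_add_neg, ← neg_one_smul ℝ G', h1]
  ring

/-- Limits in `H¹(U)` of operator-harmonic functions are operator-harmonic. -/
theorem harmonicSpace_of_approx (hU : IsOpen U) (hA : IsElliptic U A α β) (hu : HG U u G)
    (h : ∀ ε : ℝ≥0∞, 0 < ε → ∃ v ∈ harmonicSpace A U, pairDist U u G v (weakGrad U v) < ε) :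
    u ∈ harmonicSpace A U := by
  refine ⟨hu.memH1, fun φ hφ => ?_⟩
  refine eq_of_forall_abs_sub_le
    (C := |β| * (eLpNorm (weakGrad U φ) 2 (volume.restrict U)).toReal) fun ε hε => ?_
  obtain ⟨v, hv, hd⟩ := h (ENNReal.ofReal ε) (by simpa using hε)
  have hvg := hv.1.hg hU
  have hφg := hφ.1.hg hU
  rw [← hv.2 φ hφ, hu.energy_eq hU hφg, hvg.energy_eq hU hφg,
    ← hA.form_sub_left hu.2.1 hvg.2.1 hφg.2.1]
  refine (hA.abs_form_le (hu.2.1.sub hvg.2.1) hφg.2.1).trans ?_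
  have h2 := (toReal_le_of_pairDist_lt hε.le hd).2
  calc _ ≤ |β| * ε * (eLpNorm (weakGrad U φ) 2 (volume.restrict U)).toReal := by gcongr
    _ = _ := by ring

theorem IsElliptic.energy_sub_self (hA : IsElliptic U A α β) (hU : IsOpen U) (hu : MemH1 U u)
    (hv : MemH1 U v) : energy A U (u - v) (u - v) =
      energy A U u u - 2 * energy A U u v + energy A U v v := by
  have hv' := hv.smul hU (-1)
  have h1 : u - v = u + (-1 : ℝ) • v := by rw [neg_one_smul, sub_eq_add_neg]
  rw [h1, hA.energy_add_left hU hu hv' (hu.add hU hv'), hA.energy_add_right hU hu hu hv',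
    hA.energy_add_right hU hv' hu hv', energy_smul_left hU _ hv hu, energy_smul_left hU _ hv hv',
    hA.energy_smul_right hU _ hu hv, hA.energy_smul_right hU _ hv hv, hA.energy_comm v u]
  ring

theorem IsElliptic.energy_self_eq_zero_iff (hA : IsElliptic U A α β) (hu : HG U u G) (hU : IsOpen U) :
    energy A U u u = 0 ↔ G =ᵐ[volume.restrict U] 0 := by
  rw [hu.energy_eq hU hu]
  constructor
  · intro h
    have h1 := hA.le_form_self hu.2.1
    have h2 : ∫ x in U, ‖G x‖ ^ 2 = 0 := by
      refine le_antisymm ?_ (integral_nonneg fun _ => sq_nonneg _)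
      rw [h] at h1
      by_contra! h3
      linarith [mul_pos hA.1 h3]
    rw [integral_eq_zero_iff_of_nonneg (fun _ => sq_nonneg _) hu.2.1.norm.integrable_sq] at h2
    filter_upwards [h2] with x hx
    simpa using hx
  · intro h
    rw [form_congr h h, form]
    simp

end submodules

/-! ### Spectral gap and lower bound for the width on the ring -/

namespace RingSetup

variable {S : RingSetup d} {V : Submodule ℝ (Pt d → ℝ)}

/-- Closed spaces of operator-harmonic functions on the oversampling ring, with zero boundary values
on `∂Ω`, on which the energy is definite. -/
structure Admissible (S : RingSetup d) (V : Submodule ℝ (Pt d → ℝ)) : Prop where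
  le : ∀ v ∈ V, v ∈ S.boundarySpace S.Rs
  closed : IsClosedH1 S.Rs (V : Set (Pt d → ℝ))
  definite : ∀ v ∈ V, weakGrad S.Rs v =ᵐ[volume.restrict S.Rs] 0 → v =ᵐ[volume.restrict S.Rs] 0

theorem memH10_χR_mul {v : Pt d → ℝ} (hv : v ∈ S.boundarySpace S.Rs) : MemH10 S.R (S.χR * v) := by
  obtain ⟨g, C, hg, hC, hC'⟩ := S.exists_hg_χR
  exact (h0_χR_mul hg hC hC' (hv.2.hv S.isOpen_Rs)).memH10 S.isOpen_R

theorem Admissible.memH1 (hV : S.Admissible V) {v : Pt d → ℝ} (hv : v ∈ V) : MemH1 S.Rs v :=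
  (hV.le v hv).1.1

/-- Both forms of the ring eigenproblem satisfy the hypotheses of the spectral theory. -/
theorem Admissible.exists_spectral_gap (hV : S.Admissible V) {n : ℕ} {v : Fin n → Pt d → ℝ}
    {lam : Fin n → ℝ} (hv : S.IsFirstEigenpairs (V : Set (Pt d → ℝ)) n v lam) :
    ∃ M : ℝ, 0 ≤ M ∧
      (∀ u ∈ V, ∃ c : Fin n → ℝ, energy S.A S.R (S.χR * (u - ∑ k, c k • v k))
        (S.χR * (u - ∑ k, c k • v k)) ≤ M * energy S.A S.Rs u u) ∧
      (M = 0 ∨ ∃ x : Fin (n + 1) → V, ∀ c : Fin (n + 1) → ℝ, c ≠ 0 →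
        0 < energy S.A S.Rs (∑ k, c k • x k : V) (∑ k, c k • x k : V) ∧
        M * energy S.A S.Rs (∑ k, c k • x k : V) (∑ k, c k • x k : V) ≤
          energy S.A S.R (S.χR * (∑ k, c k • x k : V)) (S.χR * (∑ k, c k • x k : V))) := by
  obtain ⟨α, β, hell⟩ := S.exists_isElliptic
  have hA := hell.mono S.Rs_subset_Ω
  have hAR := hA.mono S.R_subset_Rs
  have hα := hA.1
  have hcomp := S.segment_Rs.compactlyEmbedded S.isOpen_Rs
    (S.isBounded_Ω.subset S.Rs_subset_Ω)
  have hV1 : ∀ w ∈ V, MemH1 S.Rs w := fun w hw => hV.memH1 hw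
  obtain ⟨K, hK, hP⟩ := exists_poincare S.isOpen_Rs hcomp hV1 hV.closed hV.definite
  obtain ⟨K', hK', hCac⟩ := S.exists_caccioppoli
  let a : V →ₗ[ℝ] V →ₗ[ℝ] ℝ := energyForm S.isOpen_Rs hA V LinearMap.id hV1
  let b : V →ₗ[ℝ] V →ₗ[ℝ] ℝ := energyForm S.isOpen_R hAR V (LinearMap.mulLeft ℝ S.χR)
    fun w hw => (memH10_χR_mul (hV.le w hw)).1
  have ha : ∀ x y, a x y = energy S.A S.Rs x y := fun x y => rfl
  have hb : ∀ x y, b x y = energy S.A S.R (S.χR * x) (S.χR * y) := fun x y => rfl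
  have haD : ∀ x : V, α * dirichlet S.Rs x ≤ a x x := fun x =>
    hA.le_form_self ((hV1 x x.2).hg S.isOpen_Rs).2.1
  have haD' : ∀ x : V, a x x ≤ β * dirichlet S.Rs x := fun x =>
    hA.form_self_le ((hV1 x x.2).hg S.isOpen_Rs).2.1
  have hbI : ∀ x : V, b x x ≤ K' * ∫ y in S.Rs, ‖(x : Pt d → ℝ) y‖ ^ 2 := fun x =>
    hCac x (hV.le x x.2)
  have ha0 : ∀ x, 0 ≤ a x x := fun x => hA.energy_self_nonneg _
  have hb0 : ∀ x, 0 ≤ b x x := fun x => hAR.energy_self_nonneg _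
  have hD : ∀ x : V, dirichlet S.Rs x ≤ α⁻¹ * a x x := fun x => by
    rw [← div_eq_inv_mul, le_div_iff₀ hα, mul_comm]
    exact haD x
  have hzero : ∀ x : V, a x x = 0 ↔ (x : Pt d → ℝ) =ᵐ[volume.restrict S.Rs] 0 := by
    intro x
    have hx := (hV1 x x.2).hg S.isOpen_Rs
    rw [ha, hA.energy_self_eq_zero_iff hx S.isOpen_Rs]
    exact ⟨hV.definite x x.2, hx.ae_eq_zero_of_ae_eq_zero S.isOpen_Rs⟩
  let v' : Fin n → V := fun k => ⟨v k, (hv.1 k).1⟩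
  have hsum : ∀ c : Fin n → ℝ, ((∑ k, c k • v' k : V) : Pt d → ℝ) = ∑ k, c k • v k := by
    intro c
    rw [Submodule.coe_sum]
    rfl
  -- The constant comparing `b` with `a` is the product of those of Caccioppoli (`K'`), Poincaré
  -- (`K`) and ellipticity (`α⁻¹`).
  obtain ⟨M, hM, h1, h2⟩ := RingGFEM.exists_spectral_gap a b (fun x y => hA.energy_comm _ _) ha0
    (fun x y => hAR.energy_comm _ _) hb0 (C := K' * (K * α⁻¹))
    (fun x => by
      refine (hbI x).trans ?_
      rw [mul_assoc, mul_assoc]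
      refine mul_le_mul_of_nonneg_left ((hP x x.2).trans ?_) hK'
      exact mul_le_mul_of_nonneg_left (hD x) hK.le)
    (fun u hu => by
      obtain ⟨w, hw, hlim⟩ := exists_dirichlet_limit S.isOpen_Rs hV1 hV.closed hK hP
        (u := fun i => (u i : Pt d → ℝ)) (fun i => (u i).2) (fun ε hε => by
          obtain ⟨N, hN⟩ := hu (α * ε) (by positivity)
          refine ⟨N, fun i hi j hj => ?_⟩
          exact le_of_mul_le_mul_left ((haD (u i - u j)).trans (hN i hi j hj)) hα)
      refine ⟨⟨w, hw⟩, squeeze_zero (fun i => ha0 _) (fun i => haD' _) ?_⟩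
      have h3 := hlim.const_mul β
      rwa [mul_zero] at h3)
    (fun u hu => by
      obtain ⟨φ, hφ, hφC⟩ := exists_subseq_cauchy_of_dirichlet_le S.isOpen_Rs hcomp hV1 hK hP
        (u := fun i => (u i : Pt d → ℝ)) (fun i => (u i).2) (B := α⁻¹) (fun i =>
          (hD (u i)).trans (mul_le_of_le_one_right (inv_nonneg.2 hα.le) (hu i)))
      refine ⟨φ, hφ, fun ε hε => ?_⟩
      -- Dividing by `K' + 1` avoids the possible value `K' = 0`.
      obtain ⟨N, hN⟩ := hφC (ε / (K' + 1)) (by positivity)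
      refine ⟨N, fun i hi j hj => (hbI _).trans ?_⟩
      have h3 := hN i hi j hj
      rw [le_div_iff₀ (by positivity)] at h3
      have h4 : 0 ≤ ∫ y in S.Rs, ‖(u (φ i) : Pt d → ℝ) y - (u (φ j) : Pt d → ℝ) y‖ ^ 2 :=
        integral_nonneg fun _ => sq_nonneg _
      change K' * ∫ y in S.Rs, ‖(u (φ i) : Pt d → ℝ) y - (u (φ j) : Pt d → ℝ) y‖ ^ 2 ≤ ε
      linarith)
    v' lam (fun k x => (hv.1 k).2.2 x x.2)
    (fun c hc => by
      rw [hzero, hsum] at hc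
      exact hv.2.1 c hc)
    (fun w μ hw hwe hws => by
      refine hv.2.2.2 w μ ⟨w.2, fun h => hw.ne' ((hzero w).2 h), fun φ hφ => hwe ⟨φ, hφ⟩⟩ ?_
      rintro ⟨c, hc⟩
      refine hws c ((hzero _).2 ?_)
      rw [Submodule.coe_sub, hsum]
      filter_upwards [hc] with y hy
      rw [Pi.sub_apply, hy, sub_self, Pi.zero_apply])
  refine ⟨M, hM, fun u hu => ?_, h2⟩
  obtain ⟨c, hc⟩ := h1 ⟨u, hu⟩
  refine ⟨c, ?_⟩
  rwa [hb, Submodule.coe_sub, hsum] at hc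

/-- The min-max lower bound for the width. -/
theorem le_width (hV : ∀ v ∈ V, MemH10 S.R (S.χR * v)) {n : ℕ} {M : ℝ} (hM : 0 ≤ M)
    (x : Fin (n + 1) → V) (hx : ∀ c : Fin (n + 1) → ℝ, c ≠ 0 →
        0 < energy S.A S.Rs (∑ k, c k • x k : V) (∑ k, c k • x k : V) ∧
        M * energy S.A S.Rs (∑ k, c k • x k : V) (∑ k, c k • x k : V) ≤
          energy S.A S.R (S.χR * (∑ k, c k • x k : V)) (S.χR * (∑ k, c k • x k : V))) :
    ENNReal.ofReal √M ≤ S.width (V : Set (Pt d → ℝ)) n := by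
  obtain ⟨α, β, hell⟩ := S.exists_isElliptic
  have hA := hell.mono (S.R_subset_oms.trans S.oms_subset)
  refine le_iInf fun Q => le_iInf fun hQ => le_iInf fun hQn => ?_
  obtain ⟨hQf, hQn⟩ := hQn
  let L := Fintype.linearCombination ℝ x
  have hL : ∀ c, L c = ∑ k, c k • x k := fun c => Fintype.linearCombination_apply ..
  -- A map from dimension `n + 1` to the dual of a space of dimension at most `n` has a nonzero
  -- kernel vector. It gives an element `w` with `χ^R w` energy-orthogonal to `Q`, so no `q ∈ Q`
  -- approximates `χ^R w` better than zero does.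
  let F : (Fin (n + 1) → ℝ) →ₗ[ℝ] Module.Dual ℝ Q :=
    LinearMap.mk₂ ℝ (fun c q => energy S.A S.R (S.χR * (L c : V)) q)
      (fun c c' q => by
        rw [map_add, Submodule.coe_add, mul_add]
        exact hA.energy_add_left S.isOpen_R (hV _ (L c).2).1 (hV _ (L c').2).1 (hQ q q.2).1)
      (fun t c q => by
        rw [map_smul, Submodule.coe_smul, mul_smul_comm]
        exact energy_smul_left S.isOpen_R t (hV _ (L c).2).1 (hQ q q.2).1)
      (fun c q q' => hA.energy_add_right S.isOpen_R (hV _ (L c).2).1 (hQ q q.2).1 (hQ q' q'.2).1)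
      (fun t c q => hA.energy_smul_right S.isOpen_R t (hV _ (L c).2).1 (hQ q q.2).1)
  obtain ⟨c, hc, hc0⟩ := (LinearMap.ker F).ne_bot_iff.1 (LinearMap.ker_ne_bot_of_finrank_lt (f := F) (by
    rw [Subspace.dual_finrank_eq, Module.finrank_fin_fun]
    omega))
  obtain ⟨hpos, hle⟩ := hx c hc0
  rw [← hL] at hpos hle
  set w : Pt d → ℝ := ((L c : V) : Pt d → ℝ) with hw
  have hwV : w ∈ V := (L c).2
  refine le_trans ?_ (le_iSup₂ (f := fun u (_ : u ∈ (V : Set (Pt d → ℝ))) =>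
    (⨅ q ∈ Q, ENNReal.ofReal (energyNorm S.A S.R (S.χR * u - q))) /
      ENNReal.ofReal (energyNorm S.A S.Rs u)) w hwV)
  have hden : 0 < energyNorm S.A S.Rs w := Real.sqrt_pos.2 hpos
  rw [ENNReal.le_div_iff_mul_le (Or.inl (by simpa using hden)) (Or.inl ENNReal.ofReal_ne_top),
    ← ENNReal.ofReal_mul (Real.sqrt_nonneg _), energyNorm, ← Real.sqrt_mul hM]
  refine le_iInf₂ fun q hq => ENNReal.ofReal_le_ofReal (Real.sqrt_le_sqrt (hle.trans ?_))
  have horth : energy S.A S.R (S.χR * w) q = 0 := by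
    have := congrFun (congrArg DFunLike.coe (LinearMap.mem_ker.1 hc)) ⟨q, hq⟩
    exact this
  rw [hA.energy_sub_self S.isOpen_R (hV w hwV).1 (hQ q hq).1, horth, mul_zero, sub_zero]
  exact le_add_of_nonneg_right (hA.energy_self_nonneg _)

end RingSetup

/-! ### From the ring to the whole subdomain -/

/-- Subtracting a function supported in a subset on which `p` is operator-harmonic increases the
energy. -/
theorem energy_le_energy_sub_of_harmonic {A : Pt d → Matrix (Fin d) (Fin d) ℝ} {U W : Set (Pt d)}
    {α β : ℝ} (hA : IsElliptic U A α β) (hU : IsOpen U) (hW : IsOpen W) (hWU : W ⊆ U)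
    {p r : Pt d → ℝ} (hp : MemH1 U p) (hpW : p ∈ harmonicSpace A W) (hr : MemH10 W r) :
    energy A U p p ≤ energy A U (p - W.indicator r) (p - W.indicator r) := by
  have h1 := (hr.h0 hW).indicator hW.measurableSet hWU
  have h2 : energy A U p (W.indicator r) = 0 := by
    rw [(hp.hg hU).energy_eq hU h1.1, form_indicator_right hW.measurableSet hWU,
      ← ((hp.hg hU).mono hWU).energy_eq hW (hr.1.hg hW)]
    exact hpW.2 r hr
  rw [hA.energy_sub_self hU hp h1.1.memH1, h2, mul_zero, sub_zero]
  exact le_add_of_nonneg_right (hA.energy_self_nonneg _)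

theorem harmonicSpace_congr {A : Pt d → Matrix (Fin d) (Fin d) ℝ} {U : Set (Pt d)} (hU : IsOpen U)
    {u v : Pt d → ℝ} (hu : u ∈ harmonicSpace A U) (h : u =ᵐ[volume.restrict U] v) :
    v ∈ harmonicSpace A U :=
  ⟨((hu.1.hg hU).congr h EventuallyEq.rfl).memH1, fun φ hφ => by
    rw [← energy_congr hU hu.1 hφ.1 h EventuallyEq.rfl]
    exact hu.2 φ hφ⟩

theorem form_indicator_self {A : Pt d → Matrix (Fin d) (Fin d) ℝ} {U W : Set (Pt d)}
    (hW : MeasurableSet W) (hWU : W ⊆ U) (G : Pt d → Pt d) :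
    form A U (W.indicator G) (W.indicator G) = form A W G G := by
  rw [form_indicator_right hW hWU]
  refine form_congr ?_ EventuallyEq.rfl
  filter_upwards [ae_restrict_mem hW] with x hx using indicator_of_mem hx _

namespace RingSetup

variable {S : RingSetup d}

/-- The energy of `χ e` on `om` is at most that of `χ^R w` on `R`, when `e` is operator-harmonic in
`omt`, agrees with `w` outside, and has the same boundary values there. -/
theorem energy_χ_mul_le {w e : Pt d → ℝ} (hw : MemH10 S.R (S.χR * w))
    (he : e ∈ harmonicSpace S.A S.omt) (hr : MemH10 S.omt (e - (1 - S.η) * w))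
    (hew : ∀ᵐ x ∂(volume.restrict (S.Rs \ S.omt)), e x = w x) :
    energy S.A S.om (S.χ * e) (S.χ * e) ≤ energy S.A S.R (S.χR * w) (S.χR * w) := by
  obtain ⟨α, β, hell⟩ := S.exists_isElliptic
  have hA := hell.mono S.om_subset_Ω
  set r := e - (1 - S.η) * w with hrdef
  have h1 := (hw.h0 S.isOpen_R).indicator S.isOpen_R.measurableSet S.R_subset_om
  have h2 := (hr.h0 S.isOpen_omt).indicator S.isOpen_omt.measurableSet S.omt_subset_om
  -- On `omt ∩ R`, `χ = 1` and the two terms add up to `e`. On `omt \ R`, `η = 1`, so `r = e` and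
  -- the first term is absent. Off `omt`, `η = 0` and `e = w`, so the first term alone is `χ e`.
  have hdec : S.R.indicator (S.χR * w) + S.omt.indicator r =ᵐ[volume.restrict S.om] S.χ * e := by
    rw [ae_restrict_iff' (S.isOpen_Rs.measurableSet.diff S.isOpen_omt.measurableSet)] at hew
    filter_upwards [ae_restrict_of_ae hew, ae_restrict_mem S.isOpen_om.measurableSet] with x hx hxo
    rw [Pi.add_apply, Pi.mul_apply]
    by_cases hxt : x ∈ S.omt
    · rw [indicator_of_mem hxt, S.χ_eq_one x hxt, hrdef]
      by_cases hxR : x ∈ S.R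
      · rw [indicator_of_mem hxR]
        simp [χR, S.χ_eq_one x hxt]
      · rw [indicator_of_notMem hxR]
        simp [S.η_eq_one x ⟨hxo, hxR⟩]
    · have hxR : x ∈ S.R := by
        rw [← S.omt_union_R] at hxo
        exact hxo.resolve_left hxt
      rw [indicator_of_notMem hxt, indicator_of_mem hxR, add_zero,
        hx ⟨S.R_subset_Rs hxR, hxt⟩]
      simp [χR, S.η_eq_zero x ⟨S.om_subset hxo, hxt⟩]
  have hp : MemH1 S.om (S.χ * e) := ((h1.1.add h2.1).congr hdec EventuallyEq.rfl).memH1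
  have hpt : S.χ * e ∈ harmonicSpace S.A S.omt := by
    refine harmonicSpace_congr S.isOpen_omt he ?_
    filter_upwards [ae_restrict_mem S.isOpen_omt.measurableSet] with x hx
    rw [Pi.mul_apply, S.χ_eq_one x hx, one_mul]
  refine (energy_le_energy_sub_of_harmonic hA S.isOpen_om S.isOpen_omt S.omt_subset_om hp hpt
    hr).trans (le_of_eq ?_)
  have hsub : S.χ * e - S.omt.indicator r =ᵐ[volume.restrict S.om] S.R.indicator (S.χR * w) := by
    filter_upwards [hdec] with x hx
    rw [Pi.sub_apply, ← hx, Pi.add_apply, add_sub_cancel_right]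
  have hsubm := hp.sub S.isOpen_om h2.1.memH1
  rw [energy_congr S.isOpen_om hsubm hsubm hsub hsub, h1.1.energy_eq S.isOpen_om h1.1,
    form_indicator_self S.isOpen_R.measurableSet S.R_subset_om]
  rfl

/-- The projection coefficients found on the ring are used unchanged for the extended
eigenfunctions. The energy comparison then transfers the ring error to `om`, and the width dominates
`√M`. -/
theorem Admissible.bestError_le {V : Submodule ℝ (Pt d → ℝ)} (hV : S.Admissible V) {n : ℕ}
    {v vext : Fin n → Pt d → ℝ} {lam : Fin n → ℝ}
    (hv : S.IsFirstEigenpairs (V : Set (Pt d → ℝ)) n v lam)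
    (hext : ∀ k, S.IsHarmonicExtension (v k) (vext k)) {u : Pt d → ℝ} (huV : u ∈ V)
    (hu : u ∈ S.boundarySpace S.oms) :
    S.bestError (S.approxSpace vext) u ≤
      S.width (V : Set (Pt d → ℝ)) n * ENNReal.ofReal (energyNorm S.A S.Rs u) := by
  obtain ⟨α, β, hell⟩ := S.exists_isElliptic
  obtain ⟨M, hM, hproj, hwid⟩ := hV.exists_spectral_gap hv
  have hχR : ∀ w ∈ V, MemH10 S.R (S.χR * w) := fun w hw => memH10_χR_mul (hV.le w hw)
  have hMw : ENNReal.ofReal √M ≤ S.width (V : Set (Pt d → ℝ)) n := by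
    rcases hwid with rfl | ⟨x, hx⟩
    · simp
    · exact le_width hχR hM x hx
  obtain ⟨c, hc⟩ := hproj u huV
  set w := u - ∑ k, c k • v k with hw
  set e := u - ∑ k, c k • vext k with he
  have hwV : w ∈ V := V.sub_mem huV (V.sum_mem fun k _ => V.smul_mem _ (hv.1 k).1)
  have hAt := hell.mono (S.omt_subset_oms.trans S.oms_subset)
  have hqe : e ∈ harmonicSpace S.A S.omt :=
    (harmonicSubmodule S.isOpen_omt hAt).sub_mem
      (harmonicSpace_mono S.isOpen_oms S.isOpen_omt S.omt_subset_oms hu.1)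
      ((harmonicSubmodule S.isOpen_omt hAt).sum_mem fun k _ =>
        (harmonicSubmodule S.isOpen_omt hAt).smul_mem _ (hext k).2.1)
  have hr : MemH10 S.omt (e - (1 - S.η) * w) := by
    -- The function `u` is its own extension: its contribution `u - (1 - η) u = η u` lies in
    -- `H¹₀(omt)`, and the eigenfunctions contribute the trace conditions of their extensions.
    have h1 : e - (1 - S.η) * w = S.η * u - ∑ k, c k • (vext k - (1 - S.η) * v k) := by
      simp only [he, hw, smul_sub, Finset.sum_sub_distrib, mul_sub, sub_mul, one_mul,
        Finset.mul_sum, mul_smul_comm]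
      abel
    rw [h1]
    exact (h10Submodule S.isOpen_omt).sub_mem (memH10_η_mul (hu.2.hv S.isOpen_oms))
      ((h10Submodule S.isOpen_omt).sum_mem fun k _ =>
        (h10Submodule S.isOpen_omt).smul_mem _ (hext k).2.2)
  have hew : ∀ᵐ x ∂(volume.restrict (S.Rs \ S.omt)), e x = w x := by
    filter_upwards [ae_all_iff.2 fun k => (hext k).1] with x hx
    simp [he, hw, Finset.sum_apply, hx]
  have hq : ∑ k, c k • (S.χ * vext k) ∈ S.approxSpace vext :=
    Submodule.sum_mem _ fun k _ => Submodule.smul_mem _ _ (Submodule.subset_span ⟨k, rfl⟩)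
  refine (iInf₂_le _ hq).trans ?_
  have h2 : S.χ * u - ∑ k, c k • (S.χ * vext k) = S.χ * e := by
    simp only [he, mul_sub, Finset.mul_sum, mul_smul_comm]
  rw [h2]
  refine le_trans (ENNReal.ofReal_le_ofReal (Real.sqrt_le_sqrt
    ((energy_χ_mul_le (hχR w hwV) hqe hr hew).trans hc))) ?_
  rw [Real.sqrt_mul hM, ENNReal.ofReal_mul (Real.sqrt_nonneg _)]
  exact mul_le_mul_left hMw _

end RingSetup

/-! ### Admissibility of the boundary and interior spaces -/

namespace RingSetup

variable {S : RingSetup d}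

theorem bdry_subset : S.bdry S.Rs ⊆ S.bdry S.oms :=
  frontier_inter_frontier_subset S.isOpen_oms S.isOpen_Ω S.Rs_subset S.oms_subset

/-- Restriction from the oversampling domain to the oversampling ring. -/
theorem boundarySpace_restrict {u : Pt d → ℝ} (hu : u ∈ S.boundarySpace S.oms) :
    u ∈ S.boundarySpace S.Rs :=
  ⟨harmonicSpace_mono S.isOpen_oms S.isOpen_Rs S.Rs_subset hu.1,
    ((hu.2.hv S.isOpen_oms).mono S.Rs_subset bdry_subset).memH1Vanishing S.isOpen_Rs⟩

variable (S) in
/-- The space `H^b_a(Rs)` as a subspace. -/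
def boundarySubmodule : Submodule ℝ (Pt d → ℝ) where
  carrier := S.boundarySpace S.Rs
  add_mem' hu hv := by
    obtain ⟨α, β, hell⟩ := S.exists_isElliptic
    exact ⟨(harmonicSubmodule S.isOpen_Rs (hell.mono S.Rs_subset_Ω)).add_mem hu.1 hv.1,
      ((hu.2.hv S.isOpen_Rs).add (hv.2.hv S.isOpen_Rs)).memH1Vanishing S.isOpen_Rs⟩
  zero_mem' := by
    obtain ⟨α, β, hell⟩ := S.exists_isElliptic
    exact ⟨(harmonicSubmodule S.isOpen_Rs (hell.mono S.Rs_subset_Ω)).zero_mem,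
      (HV.zero _ _).memH1Vanishing S.isOpen_Rs⟩
  smul_mem' c u hu := by
    obtain ⟨α, β, hell⟩ := S.exists_isElliptic
    exact ⟨(harmonicSubmodule S.isOpen_Rs (hell.mono S.Rs_subset_Ω)).smul_mem c hu.1,
      ((hu.2.hv S.isOpen_Rs).smul c).memH1Vanishing S.isOpen_Rs⟩

theorem isClosedH1_boundarySpace : IsClosedH1 S.Rs (S.boundarySpace S.Rs) := by
  intro z Z hz h
  obtain ⟨α, β, hell⟩ := S.exists_isElliptic
  refine ⟨harmonicSpace_of_approx S.isOpen_Rs (hell.mono S.Rs_subset_Ω) hz fun ε hε => ?_,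
    (HV.of_approx hz fun ε hε => ?_).memH1Vanishing S.isOpen_Rs⟩
  · obtain ⟨v, hv, hd⟩ := h ε hε
    exact ⟨v, hv.1, hd⟩
  · obtain ⟨v, hv, hd⟩ := h ε hε
    exact ⟨v, _, hv.2.hv S.isOpen_Rs, hd⟩

theorem admissible_boundarySubmodule (hS : S.DirichletExcludesConstants) :
    S.Admissible S.boundarySubmodule :=
  ⟨fun _ hv => hv, isClosedH1_boundarySpace, fun v hv => hS v hv.2⟩

theorem indicator_χR_mul {U : Set (Pt d)} (hU : MeasurableSet U) (hUo : U ⊆ S.oms) (v : Pt d → ℝ) :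
    S.R.indicator (S.χR * v) =ᵐ[volume.restrict U] S.χR * v := by
  filter_upwards [ae_restrict_mem hU] with x hx
  by_cases hxR : x ∈ S.R
  · rw [indicator_of_mem hxR]
  · rw [indicator_of_notMem hxR, Pi.mul_apply, χR_eq_zero (hUo hx) hxR, zero_mul]

section MR

variable {g : Pt d → Pt d} {C : ℝ} {z : Pt d → ℝ} {Z : Pt d → Pt d}

theorem hg_om_χR_mul (hg : HG S.oms S.χR g)
    (hC : ∀ᵐ x ∂(volume.restrict S.oms), |S.χR x| ≤ C)
    (hC' : ∀ᵐ x ∂(volume.restrict S.oms), ‖g x‖ ≤ C) (hz : HV S.Rs (S.bdry S.Rs) z Z) :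
    HG S.om (S.χR * z) (S.R.indicator fun x => S.χR x • Z x + z x • g x) :=
  (((h0_χR_mul hg hC hC' hz).indicator S.isOpen_R.measurableSet S.R_subset_om).1).congr
    (indicator_χR_mul S.isOpen_om.measurableSet S.om_subset z) EventuallyEq.rfl

/-- Expresses the numerator of `M^R` through `z` and `Z` on `R`, which makes it continuous under
`H¹(Rs)` limits. -/
theorem energy_χR_mul_χR (hg : HG S.oms S.χR g)
    (hC : ∀ᵐ x ∂(volume.restrict S.oms), |S.χR x| ≤ C)
    (hC' : ∀ᵐ x ∂(volume.restrict S.oms), ‖g x‖ ≤ C) (hz : HV S.Rs (S.bdry S.Rs) z Z) :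
    energy S.A S.om (S.χR * z) S.χR = form S.A S.R (fun x => S.χR x • Z x + z x • g x) g := by
  obtain ⟨α, β, hell⟩ := S.exists_isElliptic
  rw [(hg_om_χR_mul hg hC hC' hz).energy_eq S.isOpen_om (hg.mono S.om_subset),
    (hell.mono S.om_subset_Ω).form_comm,
    form_indicator_right S.isOpen_R.measurableSet S.R_subset_om,
    (hell.mono (S.R_subset_oms.trans S.oms_subset)).form_comm]

theorem memH1_om_χR : MemH1 S.om S.χR := by
  obtain ⟨g, C, hg, -, -⟩ := S.exists_hg_χR
  exact (hg.mono S.om_subset).memH1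

theorem memH1_om_χR_mul (hz : z ∈ S.boundarySpace S.Rs) : MemH1 S.om (S.χR * z) := by
  obtain ⟨g, C, hg, hC, hC'⟩ := S.exists_hg_χR
  exact (hg_om_χR_mul hg hC hC' (hz.2.hv S.isOpen_Rs)).memH1

theorem MR_add {u v : Pt d → ℝ} (hu : u ∈ S.boundarySpace S.Rs) (hv : v ∈ S.boundarySpace S.Rs) :
    S.MR (u + v) = S.MR u + S.MR v := by
  obtain ⟨α, β, hell⟩ := S.exists_isElliptic
  rw [MR, MR, MR, mul_add, (hell.mono S.om_subset_Ω).energy_add_left S.isOpen_om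
    (memH1_om_χR_mul hu) (memH1_om_χR_mul hv) memH1_om_χR, mul_add]

theorem MR_smul (c : ℝ) {u : Pt d → ℝ} (hu : u ∈ S.boundarySpace S.Rs) :
    S.MR (c • u) = c * S.MR u := by
  rw [MR, MR, mul_smul_comm, energy_smul_left S.isOpen_om c (memH1_om_χR_mul hu) memH1_om_χR]
  ring

variable (S) in
/-- The functions of `H^b_a(Rs)` with `M^R v = 0`. -/
def meanZeroSubmodule : Submodule ℝ (Pt d → ℝ) where
  carrier := {v | v ∈ S.boundarySpace S.Rs ∧ S.MR v = 0}
  add_mem' hu hv := ⟨S.boundarySubmodule.add_mem hu.1 hv.1, by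
    rw [MR_add hu.1 hv.1, hu.2, hv.2, add_zero]⟩
  zero_mem' := ⟨S.boundarySubmodule.zero_mem, by
    have := MR_smul 0 S.boundarySubmodule.zero_mem
    rwa [zero_smul, zero_mul] at this⟩
  smul_mem' c u hu := ⟨S.boundarySubmodule.smul_mem c hu.1, by
    rw [MR_smul c hu.1, hu.2, mul_zero]⟩

theorem isClosedH1_meanZeroSubmodule :
    IsClosedH1 S.Rs (S.meanZeroSubmodule : Set (Pt d → ℝ)) := by
  intro z Z hz h
  obtain ⟨α, β, hell⟩ := S.exists_isElliptic
  obtain ⟨g, C, hg, hC, hC'⟩ := S.exists_hg_χR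
  have hzb : z ∈ S.boundarySpace S.Rs := isClosedH1_boundarySpace z Z hz fun ε hε => by
    obtain ⟨v, hv, hd⟩ := h ε hε
    exact ⟨v, hv.1, hd⟩
  refine ⟨hzb, ?_⟩
  -- If the normalizing energy were zero, its inverse would be zero by convention and `M^R` would
  -- vanish identically.
  rcases eq_or_ne (energy S.A S.om S.χR S.χR) 0 with hE | hE
  · rw [MR, hE, inv_zero, zero_mul]
  rw [MR, mul_eq_zero]
  right
  have hAR := hell.mono (S.R_subset_oms.trans S.oms_subset)
  have hgR := hg.mono S.R_subset_oms
  have hCs := ae_restrict_of_ae_restrict_of_subset S.Rs_subset hC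
  have hCs' := ae_restrict_of_ae_restrict_of_subset S.Rs_subset hC'
  have hgs := hg.mono S.Rs_subset
  have hzv : HV S.Rs (S.bdry S.Rs) z Z :=
    HV.of_approx hz fun ε hε => by
      obtain ⟨v, hv, hd⟩ := h ε hε
      exact ⟨v, _, hv.1.2.hv S.isOpen_Rs, hd⟩
  refine eq_of_forall_abs_sub_le
    (C := |β| * (2 * |C|) * (eLpNorm g 2 (volume.restrict S.R)).toReal) fun ε hε => ?_
  obtain ⟨v, hv, hd⟩ := h (ENNReal.ofReal ε) (by simpa using hε)
  have hvv := hv.1.2.hv S.isOpen_Rs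
  have hv0 : energy S.A S.om (S.χR * v) S.χR = 0 := by
    have h1 := hv.2
    rw [MR] at h1
    exact (mul_eq_zero.1 h1).resolve_left (inv_ne_zero hE)
  have hz1 := (h0_χR_mul hg hC hC' hzv).1
  have hv1 := (h0_χR_mul hg hC hC' hvv).1
  rw [← hv0, energy_χR_mul_χR hg hC hC' hzv, energy_χR_mul_χR hg hC hC' hvv,
    ← hAR.form_sub_left hz1.2.1 hv1.2.1 hgR.2.1]
  refine (hAR.abs_form_le (hz1.2.1.sub hv1.2.1) hgR.2.1).trans ?_
  have h2 : eLpNorm ((fun x => S.χR x • Z x + z x • g x) -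
      fun x => S.χR x • weakGrad S.Rs v x + v x • g x) 2 (volume.restrict S.R) ≤
      ENNReal.ofReal (2 * |C| * ε) := by
    refine le_trans ?_ ((pairDist_mono S.R_subset_Rs (fun x => S.χR x * z x)
      (fun x => S.χR x * v x) _ _).trans ((pairDist_mul_le hgs hCs hCs' hzv.1 hvv.1).trans ?_))
    · exact le_add_self
    · rw [ENNReal.ofReal_mul (p := 2 * |C|) (by positivity)]
      exact mul_le_mul' (ENNReal.ofReal_le_ofReal (by linarith [le_abs_self C])) hd.le
  have h3 := ENNReal.toReal_le_of_le_ofReal (by positivity) h2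
  calc _ ≤ |β| * (2 * |C| * ε) * (eLpNorm g 2 (volume.restrict S.R)).toReal := by gcongr
    _ = _ := by ring

end MR

theorem closure_oms_subset (h : frontier S.oms ∩ frontier S.Ω = ∅) : closure S.oms ⊆ S.Ω := by
  intro x hx
  by_contra hxΩ
  have h1 : x ∈ frontier S.oms ∩ frontier S.Ω := by
    rw [S.isOpen_oms.frontier_eq, S.isOpen_Ω.frontier_eq]
    exact ⟨⟨hx, fun h' => hxΩ (S.oms_subset h')⟩, closure_mono S.oms_subset hx, hxΩ⟩
  rw [h] at h1
  exact h1

theorem hv_of_interior (h : frontier S.oms ∩ frontier S.Ω = ∅) {U : Set (Pt d)} (hU : U ⊆ S.oms)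
    {z : Pt d → ℝ} {Z : Pt d → Pt d} (hz : HG U z Z) : HV U (S.bdry U) z Z := by
  have h1 : S.bdry U = ∅ := subset_empty_iff.1
    ((frontier_inter_frontier_subset S.isOpen_oms S.isOpen_Ω hU S.oms_subset).trans h.subset)
  rw [h1]
  exact hz.hv_empty

theorem boundarySpace_of_interior (h : frontier S.oms ∩ frontier S.Ω = ∅) {U : Set (Pt d)}
    (hU : IsOpen U) (hUo : U ⊆ S.oms) {z : Pt d → ℝ} (hz : z ∈ harmonicSpace S.A U) :
    z ∈ S.boundarySpace U :=
  ⟨hz, (hv_of_interior h hUo (hz.1.hg hU)).memH1Vanishing hU⟩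

/-- The ring cut-off function of an interior subdomain equals one somewhere on the ring. -/
theorem exists_χR_eq_one [Nonempty (Fin d)] (h : frontier S.oms ∩ frontier S.Ω = ∅) :
    ∃ p ∈ S.R, S.χR p = 1 := by
  have hne : S.omt ≠ univ := by
    intro huniv
    refine NormedSpace.unbounded_univ ℝ (Pt d) ?_
    rw [← huniv]
    exact S.isBounded_Ω.subset (S.omt_subset_oms.trans S.oms_subset)
  -- A nonempty bounded open set has a frontier point `p`, which here lies in `Ω` and hence in `R`.
  -- By continuity `χ p = 1`, while `η p = 0` because `p` is outside `omt`.
  obtain ⟨p, hp⟩ := nonempty_frontier_iff.2 ⟨S.omt_nonempty, hne⟩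
  have hpΩ : p ∈ S.Ω := closure_oms_subset h (closure_mono S.omt_subset_oms hp.1)
  have hpR := S.frontier_omt ⟨hp, hpΩ⟩
  have hpt : p ∉ S.omt := by
    rw [S.isOpen_omt.frontier_eq] at hp
    exact hp.2
  have hχ : S.χ p = 1 := by
    have h1 := (S.χ_w1infty.1.continuousAt (S.isOpen_Ω.mem_nhds hpΩ)).tendsto
    by_contra hne'
    obtain ⟨y, hy, hyt⟩ := ((mem_closure_iff_frequently.1 hp.1).and_eventually
      (h1.eventually (isOpen_ne.mem_nhds hne'))).exists
    exact hyt (S.χ_eq_one y hy)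
  refine ⟨p, hpR, ?_⟩
  rw [χR, Pi.sub_apply, hχ, S.η_eq_zero p ⟨S.R_subset_oms hpR, hpt⟩, sub_zero]

theorem hg_one {U : Set (Pt d)} (hU : IsOpen U) (hb : Bornology.IsBounded U) :
    HG U (fun _ => (1 : ℝ)) 0 := by
  obtain ⟨φ, hφ, -, N, hN, hUN, hφ1⟩ := exists_isTestFunction_eq_one isOpen_univ
    hb.isCompact_closure (subset_univ _)
  refine (hφ.hg U).congr ?_ ?_
  · filter_upwards [ae_restrict_mem hU.measurableSet] with x hx using hφ1 x (hUN (subset_closure hx))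
  · filter_upwards [ae_restrict_mem hU.measurableSet] with x hx
    have h1 : φ =ᶠ[𝓝 x] fun _ => (1 : ℝ) := by
      filter_upwards [hN.mem_nhds (hUN (subset_closure hx))] with y hy using hφ1 y hy
    rw [gradient, h1.fderiv_eq]
    simp

/-- With zero energy, the extension of `χ^R` by zero would be an `H¹` function on the whole space
with zero gradient and bounded support, hence zero. By continuity this contradicts the point of `R`
where `χ^R = 1`. -/
theorem energy_χR_ne_zero [Nonempty (Fin d)] (h : frontier S.oms ∩ frontier S.Ω = ∅) :
    energy S.A S.om S.χR S.χR ≠ 0 := by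
  intro hE
  obtain ⟨α, β, hell⟩ := S.exists_isElliptic
  obtain ⟨g, C, hg, hC, hC'⟩ := S.exists_hg_χR
  rw [(hell.mono S.om_subset_Ω).energy_self_eq_zero_iff (hg.mono S.om_subset) S.isOpen_om] at hE
  -- Writing `χ^R = χ^R · 1` and applying the cut-off lemma to the constant one gives `χ^R ∈
  -- H¹₀(R)`.
  have h1 := h0_χR_mul hg hC hC' (hv_of_interior h S.Rs_subset
    (hg_one S.isOpen_Rs (S.isBounded_Ω.subset S.Rs_subset_Ω)))
  have h2 : H0 S.R S.χR 0 := h1.congr (Eventually.of_forall fun x => mul_one _) (by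
    filter_upwards [ae_restrict_of_ae_restrict_of_subset S.R_subset_om hE] with x hx
    simp [hx])
  have h3 := h2.indicator S.isOpen_R.measurableSet (subset_univ S.R)
  rw [indicator_zero'] at h3
  have h4 := ae_eq_zero_of_gradient_zero_of_bounded S.isOpen_R.measurableSet
    (S.isBounded_Ω.subset (S.R_subset_oms.trans S.oms_subset)) h3.1
    fun x hx => indicator_of_notMem hx _
  have h5 : S.χR =ᵐ[volume.restrict S.R] fun _ => (0 : ℝ) := by
    filter_upwards [h4, ae_restrict_mem S.isOpen_R.measurableSet] with x hx hxR
    rwa [indicator_of_mem hxR] at hx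
  obtain ⟨p, hp, hp1⟩ := exists_χR_eq_one h
  have h6 := Measure.eqOn_open_of_ae_eq h5 S.isOpen_R (continuousOn_χR.mono S.R_subset_oms)
    continuousOn_const hp
  rw [hp1] at h6
  exact one_ne_zero h6

/-- The factor in front of `M^R` is chosen so that constants are reproduced. -/
theorem MR_of_ae_eq_const (hE : energy S.A S.om S.χR S.χR ≠ 0) {v : Pt d → ℝ}
    (hv : v ∈ S.boundarySpace S.Rs) {c : ℝ} (hvc : v =ᵐ[volume.restrict S.Rs] fun _ => c) :
    S.MR v = c := by
  have h1 : S.χR * v =ᵐ[volume.restrict S.om] c • S.χR := by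
    rw [EventuallyEq, ae_restrict_iff' S.isOpen_Rs.measurableSet] at hvc
    filter_upwards [ae_restrict_of_ae hvc, ae_restrict_mem S.isOpen_om.measurableSet] with x hx hxo
    rw [Pi.mul_apply, Pi.smul_apply, smul_eq_mul]
    by_cases hxR : x ∈ S.R
    · rw [hx (S.R_subset_Rs hxR), mul_comm]
    · rw [χR_eq_zero (S.om_subset hxo) hxR, zero_mul, mul_zero]
  rw [MR, energy_congr S.isOpen_om (memH1_om_χR_mul hv) memH1_om_χR h1 EventuallyEq.rfl,
    energy_smul_left S.isOpen_om c memH1_om_χR memH1_om_χR]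
  field_simp

/-- Connectedness makes a function with zero gradient constant, and `M^R` reads off this constant,
which is therefore zero. -/
theorem admissible_meanZeroSubmodule [Nonempty (Fin d)] (h : frontier S.oms ∩ frontier S.Ω = ∅)
    (hc : IsConnected S.Rs) : S.Admissible S.meanZeroSubmodule := by
  refine ⟨fun _ hv => hv.1, isClosedH1_meanZeroSubmodule, fun v hv hv0 => ?_⟩
  obtain ⟨c, hvc⟩ := ae_eq_const_of_gradient_zero S.isOpen_Rs hc
    ((hv.1.1.1.hg S.isOpen_Rs).congr EventuallyEq.rfl hv0)
  have h1 := MR_of_ae_eq_const (energy_χR_ne_zero h) hv.1 hvc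
  rw [hv.2] at h1
  rw [← h1] at hvc
  exact hvc

theorem coe_meanZeroSubmodule (h : frontier S.oms ∩ frontier S.Ω = ∅) :
    (S.meanZeroSubmodule : Set (Pt d → ℝ)) = S.interiorSpace := by
  ext v
  exact ⟨fun hv => ⟨hv.1.1, hv.2⟩,
    fun hv => ⟨boundarySpace_of_interior h S.isOpen_Rs S.Rs_subset hv.1, hv.2⟩⟩

end RingSetup

end RingGFEM

end

/-- Local approximation error bound, for interior subdomains and for boundary subdomains. -/
theorem mainTheorem1 (d : ℕ) (hd : d = 2 ∨ d = 3) (S : RingGFEM.RingSetup d) (n : ℕ) :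
    (frontier S.oms ∩ frontier S.Ω = ∅ → IsConnected S.Rs →
      ∀ (v vext : Fin n → RingGFEM.Pt d → ℝ) (lam : Fin n → ℝ),
        S.IsFirstEigenpairs S.interiorSpace n v lam →
        (∀ k, S.IsHarmonicExtension (v k) (vext k)) →
        ∀ u ∈ RingGFEM.harmonicSpace S.A S.oms, S.MR u = 0 →
          S.bestError (S.approxSpace vext) u ≤
            S.width S.interiorSpace n * ENNReal.ofReal (RingGFEM.energyNorm S.A S.Rs u)) ∧
    ((frontier S.oms ∩ frontier S.Ω).Nonempty → S.DirichletExcludesConstants →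
      ∀ (v vext : Fin n → RingGFEM.Pt d → ℝ) (lam : Fin n → ℝ),
        S.IsFirstEigenpairs (S.boundarySpace S.Rs) n v lam →
        (∀ k, S.IsHarmonicExtension (v k) (vext k)) →
        ∀ u ∈ S.boundarySpace S.oms,
          S.bestError (S.approxSpace vext) u ≤
            S.width (S.boundarySpace S.Rs) n *
              ENNReal.ofReal (RingGFEM.energyNorm S.A S.Rs u)) := by
  -- A positive dimension makes the space unbounded, so that `omt` has a frontier point and bounded
  -- sets can be shifted off themselves.
  have : Nonempty (Fin d) := ⟨⟨0, by omega⟩⟩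
  refine ⟨fun h hc v vext lam hv hext u hu hMR => ?_, fun _ hS v vext lam hv hext u hu => ?_⟩
  · rw [← RingGFEM.RingSetup.coe_meanZeroSubmodule h] at hv ⊢
    have hu' := RingGFEM.RingSetup.boundarySpace_of_interior h S.isOpen_oms subset_rfl hu
    exact (RingGFEM.RingSetup.admissible_meanZeroSubmodule h hc).bestError_le hv hext
      ⟨RingGFEM.RingSetup.boundarySpace_restrict hu', hMR⟩ hu'
  · exact (RingGFEM.RingSetup.admissible_boundarySubmodule hS).bestError_le hv hext
      (RingGFEM.RingSetup.boundarySpace_restrict hu) hu
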